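/- Conventions. A computable vocabulary is a (possibly infinite) first-order vocabulary whose symbols are effectively coded by natural numbers so that arities are computable. A computable structure is a structure in such a vocabulary whose universe is a computable subset of $\mathbb N$ and whose functions and relations are computable uniformly in the symbol. An isomorphism $f:\mathcal A\cong\mathcal B$ of computable structures is a function on a computable set of natural numbers, and $\deg(f)$ is its Turing degree. Such an $f$ is $\Delta^0_3$ if its graph is. A structure is rigid if its only automorphism is the identity. The degree of categoricity of a computable structure $\mathcal A$ is, if it exists, the least degree in $$\{\deg(X): \text{for every computable } \mathcal B\cong\mathcal A \text{ there is } f:\mathcal A\cong\mathcal B \text{ with } f\le_T X\}.$$ A degree $\mathbf d$ is the strong degree of categoricity of $\mathcal A$ if it is the degree of categoricity of $\mathcal A$ and there are computable copies $\mathcal A_0,\mathcal A_1$ of $\mathcal A$ such that every isomorphism $f:\mathcal A_0\cong\mathcal A_1$ satisfies $\deg(f)\ge\mathbf d$. Lemma. There is a set $D\subseteq\mathbb N$ with $\mathbf 0'<\deg(D)<\mathbf 0''$ such that the following holds. For all computable structures $\mathcal A$ and $\mathcal B$ (in the same computable vocabulary) and every $\Delta^0_3$ isomorphism $g:\mathcal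 A\cong\mathcal B$, if $\deg(g)=\deg(D)$, then there are a computable structure $\mathcal N$ and an isomorphism $f:\mathcal A\cong\mathcal N$ with $\deg(f)\not\le\deg(D)$. Moreover, $\deg(D)$ is not the strong degree of categoricity of any rigid computable structure. -/

import Mathlib

noncomputable section

namespace CatDeg

/-! ## Turing degrees of sets, oracle programs and the jump -/

open Classical in
/-- The characteristic function of a set of natural numbers. -/
def charFun (X : Set ℕ) : ℕ → ℕ := fun n => if n ∈ X then 1 else 0

/-- The Turing degree of a total function `ℕ → ℕ`. -/
def degFun (f : ℕ → ℕ) : TuringDegree :=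
  toAntisymmetrization TuringReducible (f : ℕ →. ℕ)

/-- The Turing degree of a set of natural numbers. -/
def deg (X : Set ℕ) : TuringDegree := degFun (charFun X)

/-- Programs for oracle computations: one constructor for each clause of `Nat.RecursiveIn`. -/
inductive OracleCode : Type
  | zero : OracleCode
  | succ : OracleCode
  | left : OracleCode
  | right : OracleCode
  | oracle : OracleCode
  | pair : OracleCode → OracleCode → OracleCode
  | comp : OracleCode → OracleCode → OracleCode
  | prec : OracleCode → OracleCode → OracleCode
  | rfind : OracleCode → OracleCode

namespace OracleCode

/-- The partial function computed by a program with oracle `g`. -/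
def eval (g : ℕ →. ℕ) : OracleCode → ℕ →. ℕ
  | zero => fun _ => 0
  | succ => Nat.succ
  | left => fun n => (Nat.unpair n).1
  | right => fun n => (Nat.unpair n).2
  | oracle => g
  | pair c d => fun n => Nat.pair <$> eval g c n <*> eval g d n
  | comp c d => fun n => eval g d n >>= eval g c
  | prec c d => fun p =>
      let (a, n) := Nat.unpair p
      n.rec (eval g c a) fun y IH => do
        let i ← IH
        eval g d (Nat.pair a (Nat.pair y i))
  | rfind c => fun a =>
      Nat.rfind fun n => (fun m => m = 0) <$> eval g c (Nat.pair a n)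

/-- A Gödel numbering of oracle programs. -/
def number : OracleCode → ℕ
  | zero => Nat.pair 0 0
  | succ => Nat.pair 1 0
  | left => Nat.pair 2 0
  | right => Nat.pair 3 0
  | oracle => Nat.pair 4 0
  | pair c d => Nat.pair 5 (Nat.pair (number c) (number d))
  | comp c d => Nat.pair 6 (Nat.pair (number c) (number d))
  | prec c d => Nat.pair 7 (Nat.pair (number c) (number d))
  | rfind c => Nat.pair 8 (number c)

theorem number_injective : Function.Injective number := by
  intro c
  induction c with
  | zero | succ | left | right | oracle =>
    intro d h; cases d <;> simp_all [number, Nat.pair_eq_pair]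
  | pair a b iha ihb | comp a b iha ihb | prec a b iha ihb =>
    intro d h
    cases d <;> simp [number, Nat.pair_eq_pair] at h
    rw [iha h.1, ihb h.2]
  | rfind a iha =>
    intro d h
    cases d <;> simp [number, Nat.pair_eq_pair] at h
    rw [iha h]

/-- The programs with oracle `g` compute exactly the partial functions recursive in `g`. -/
theorem recursiveIn_iff_exists_code (g f : ℕ →. ℕ) :
    Nat.RecursiveIn {g} f ↔ ∃ c : OracleCode, eval g c = f := by
  constructor
  · intro h
    induction h with
    | zero => exact ⟨zero, rfl⟩
    | succ => exact ⟨succ, rfl⟩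
    | left => exact ⟨left, rfl⟩
    | right => exact ⟨right, rfl⟩
    | oracle k hk => exact ⟨oracle, (Set.mem_singleton_iff.1 hk).symm⟩
    | pair _ _ h1 h2 =>
      obtain ⟨c, rfl⟩ := h1
      obtain ⟨d, rfl⟩ := h2
      exact ⟨pair c d, rfl⟩
    | comp _ _ h1 h2 =>
      obtain ⟨c, rfl⟩ := h1
      obtain ⟨d, rfl⟩ := h2
      exact ⟨comp c d, rfl⟩
    | prec _ _ h1 h2 =>
      obtain ⟨c, rfl⟩ := h1
      obtain ⟨d, rfl⟩ := h2
      exact ⟨prec c d, rfl⟩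
    | rfind _ h1 =>
      obtain ⟨c, rfl⟩ := h1
      exact ⟨rfind c, rfl⟩
  · rintro ⟨c, rfl⟩
    induction c with
    | zero => exact .zero
    | succ => exact .succ
    | left => exact .left
    | right => exact .right
    | oracle => exact .oracle g rfl
    | pair _ _ h1 h2 => exact .pair h1 h2
    | comp _ _ h1 h2 => exact .comp h1 h2
    | prec _ _ h1 h2 => exact .prec h1 h2
    | rfind _ h1 => exact .rfind h1

end OracleCode

/-- The Turing jump `X'` of a set `X`: the numbers of those oracle programs that halt on their
own number when run with oracle `X`. -/
def jump (X : Set ℕ) : Set ℕ :=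
  {n | ∃ c : OracleCode, c.number = n ∧
    (OracleCode.eval (charFun X : ℕ →. ℕ) c n).Dom}

/-- The degree `0'`. -/
def zeroJump : TuringDegree := deg (jump ∅)

/-- The degree `0''`. -/
def zeroDoubleJump : TuringDegree := deg (jump (jump ∅))

/-! ## The third level of the arithmetical hierarchy -/

/-- `P` is `Σ⁰₃`. -/
def IsSigma03 {α : Type} [Primcodable α] (P : α → Prop) : Prop :=
  ∃ R : α × ℕ × ℕ × ℕ → Prop, ComputablePred R ∧
    ∀ x, P x ↔ ∃ a, ∀ b, ∃ c, R (x, a, b, c)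

/-- `P` is `Π⁰₃`. -/
def IsPi03 {α : Type} [Primcodable α] (P : α → Prop) : Prop :=
  ∃ R : α × ℕ × ℕ × ℕ → Prop, ComputablePred R ∧
    ∀ x, P x ↔ ∀ a, ∃ b, ∀ c, R (x, a, b, c)

/-- `P` is `Δ⁰₃`. -/
def IsDelta03 {α : Type} [Primcodable α] (P : α → Prop) : Prop :=
  IsSigma03 P ∧ IsPi03 P

/-! ## Computable vocabularies and structures -/

/-- A computable vocabulary: a (possibly infinite) first-order language whose symbols are
effectively coded by natural numbers, in such a way that the arity of a symbol can be computed. -/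
structure Vocabulary : Type 1 where
  /-- the language -/
  lang : FirstOrder.Language.{0, 0}
  /-- the coding of the function symbols (constants are function symbols of arity `0`) -/
  primFun : Primcodable (Σ n, lang.Functions n)
  /-- the coding of the relation symbols -/
  primRel : Primcodable (Σ n, lang.Relations n)
  computable_arityFun : Computable (fun s : Σ n, lang.Functions n => s.1)
  computable_arityRel : Computable (fun s : Σ n, lang.Relations n => s.1)

attribute [instance] Vocabulary.primFun Vocabulary.primRel

/-- A computable structure: its universe is a computable set of natural numbers, and its functions
and relations are computable, uniformly in the symbol. -/
structure CompStructure (τ : Vocabulary) : Type where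
  /-- the universe -/
  dom : Set ℕ
  /-- the interpretation of the symbols -/
  str : τ.lang.Structure dom
  computable_dom : ComputablePred (fun n => n ∈ dom)
  computable_fun : ∃ F : (Σ n, τ.lang.Functions n) → List ℕ → ℕ, Computable₂ F ∧
    ∀ (n : ℕ) (s : τ.lang.Functions n) (v : Fin n → dom),
      ((FirstOrder.Language.Structure.funMap s v : dom) : ℕ) = F ⟨n, s⟩ (List.ofFn fun i => (v i : ℕ))
  computable_rel : ∃ R : (Σ n, τ.lang.Relations n) → List ℕ → Bool, Computable₂ R ∧
    ∀ (n : ℕ) (s : τ.lang.Relations n) (v : Fin n → dom),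
      FirstOrder.Language.Structure.RelMap s v ↔ R ⟨n, s⟩ (List.ofFn fun i => (v i : ℕ)) = true

namespace CompStructure

variable {τ : Vocabulary}

instance (A : CompStructure τ) : τ.lang.Structure A.dom := A.str

/-- Isomorphisms between computable structures (not necessarily computable). -/
abbrev Iso (A B : CompStructure τ) : Type := FirstOrder.Language.Equiv τ.lang A.dom B.dom

/-- An isomorphism as a function on the natural numbers; outside the universe of `A`, which is a
computable set, it takes the value `0`. -/
def Iso.natFun {A B : CompStructure τ} (f : Iso A B) : ℕ → ℕ :=
  open Classical in fun n => if h : n ∈ A.dom then (f ⟨n, h⟩ : ℕ) else 0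

/-- The Turing degree of an isomorphism. -/
def Iso.deg {A B : CompStructure τ} (f : Iso A B) : TuringDegree := degFun (Iso.natFun f)

/-- An isomorphism is `Δ⁰₃` if its graph is. -/
def Iso.IsDelta03 {A B : CompStructure τ} (f : Iso A B) : Prop :=
  CatDeg.IsDelta03 (fun p : ℕ × ℕ => ∃ h : p.1 ∈ A.dom, (f ⟨p.1, h⟩ : ℕ) = p.2)

/-- A structure is rigid if the identity is its only automorphism. -/
def Rigid (A : CompStructure τ) : Prop :=
  ∀ f : Iso A A, f = FirstOrder.Language.Equiv.refl τ.lang A.dom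

/-- The categoricity spectrum of `A`: the degrees of those sets that compute, for every computable
copy `B` of `A`, an isomorphism from `A` to `B`. -/
def catSpec (A : CompStructure τ) : Set TuringDegree :=
  {d | ∃ X : Set ℕ, d = CatDeg.deg X ∧
    ∀ B : CompStructure τ, Nonempty (Iso A B) → ∃ f : Iso A B, Iso.deg f ≤ d}

/-- `d` is the degree of categoricity of `A`. -/
def IsDegreeOfCategoricity (A : CompStructure τ) (d : TuringDegree) : Prop :=
  IsLeast A.catSpec d

/-- `d` is the degree of categoricity of `A`, and `A` has two computable copies such that every
isomorphism between them computes `d`. -/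
def IsStrongDegreeOfCategoricity (A : CompStructure τ) (d : TuringDegree) : Prop :=
  A.IsDegreeOfCategoricity d ∧
    ∃ A₀ A₁ : CompStructure τ, Nonempty (Iso A A₀) ∧ Nonempty (Iso A A₁) ∧
      ∀ f : Iso A₀ A₁, d ≤ Iso.deg f

end CompStructure

end CatDeg

end

/-! The set is the join of `0'` with the parities of a function `gen` that meets or avoids every
`Σ⁰₂` set of strings (`generic`). Computations from `0'` and a finite string are `Σ⁰₂`
(`sig2_conv`), so this much genericity decides the facts that matter. The graph of the set is not
`Σ⁰₂` (`not_sig2_graph_genSet`), hence it is not below `0'`. If it computed `0''`, a complement of a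
`Σ⁰₂` set would become `Σ⁰₂`. Conversely `0''` can recognize the stages at which an initial part of
the construction of `gen` is final.

Let `g : A ≅ B` have the degree of this set `D`, say `g` is computed from `D` by `ψ` and `D` from
`g` by `Φ`. Two facts pull against each other. Failure of one step of back-and-forth is `Σ⁰₂`, so
some condition `σ₀` on `gen` forces the finite maps computed by `ψ` to respect one step
(`Setting.exists_forcing`). But every initial segment of `gen` has an extension on which `ψ`
disagrees with `g` (`Setting.exists_wrong`), since otherwise `Φ` would yield a `Σ⁰₂` graph for `D`.
If `τ` and `τ'` make `ψ` disagree at `a`, then following `ψ` on `τ'` and inverting `ψ` on `τ` gives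
a finite partial map of `A` to itself that moves `a` and respects one step of back-and-forth.

The copy `N` is given by an enumeration `F` of the universe of `A` whose finite atomic diagrams are
computable, and the isomorphism `A ≅ N` is the inverse of `F`. To defeat a program `Ξ`, take `τ`,
`τ'`, `a` as above such that `Ξ` on `τ` sends `a` to `v`. If the tuple built so far has `a` in place
`v`, apply the partial map to it. Then `F v ≠ a`, and the diagram already announced can still be
kept, because the two tuples are equivalent for one step.

The partial map has to be defined on the whole tuple, whereas `ψ` is only known to converge along
`gen`. So `gen` itself is led through `τ`, then `τ'`, and back to `τ`: these are the four moves of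
`Setting.Own`. While a requirement waits for its third or fourth move the tuple is frozen. The map
must also fix the elements that higher priority has put in the tuple, and must cover the frozen
tuple. Both bounds are expressed by `Settled`, whose witnesses dominate every computable function.
Thus the requirement can be stated before the enumeration that depends on its index.

True stages reconcile this construction with the computability of `N`. Work at stage `t` starts from
the last stage that looks true at `t`. At a true stage each move rests on a true `Σ⁰₂` fact
(`Tru.u2_of_sees`), and each true fact is eventually seen (`U2.eventually_sees`). The announced
diagram grows at false stages as well, but always so that the tuples of the stages believed true can
be extended to realize it (`Suitable.back`). Hence the next true stage has a continuation
(`exists_suitable`), and a search at a false stage stops when the stage is found false, so the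
enumeration is computable. The requirement is carried out in `limitTuple_not_computed`.

For a rigid `A` with strong degree of categoricity `deg D`, isomorphisms below `D` onto the two
witnessing copies combine to an isomorphism of degree exactly `deg D`. The resulting `N` contradicts
the bound, since isomorphisms between copies of a rigid structure are unique. -/

namespace CatDeg

/-! ## Closure properties of computable functions and predicates -/

attribute [fun_prop] Computable
attribute [fun_prop] ComputablePred
attribute [fun_prop] Computable.id Computable.const Computable.comp Computable.pair

/-! ### Course-of-values recursion. -/

section CourseOfValues

variable {σ : Type}

/-- Course-of-values recursion: the value at `t` is computed from the list of the earlier ones. -/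
def courseList (F : List σ → σ) : ℕ → List σ
  | 0 => []
  | t + 1 => courseList F t ++ [F (courseList F t)]

/-- The function defined by course-of-values recursion. -/
def courseRec (F : List σ → σ) (t : ℕ) : σ := F (courseList F t)

@[simp] theorem length_courseList (F : List σ → σ) (t : ℕ) : (courseList F t).length = t := by
  induction t with
  | zero => rfl
  | succ t ih => simp [courseList, ih]

theorem courseList_getElem? (F : List σ → σ) {t r : ℕ} (h : r < t) :
    (courseList F t)[r]? = some (courseRec F r) := by
  induction t with
  | zero => omega
  | succ t ih =>
    rcases Nat.lt_succ_iff_lt_or_eq.1 h with h | rfl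
    · rw [courseList, List.getElem?_append_left (by simpa using h), ih h]
    · simp [courseList, courseRec]

theorem courseList_getD (F : List σ → σ) {t r : ℕ} (h : r < t) (d : σ) :
    (courseList F t).getD r d = courseRec F r := by
  rw [List.getD_eq_getElem?_getD, courseList_getElem? F h]; rfl

end CourseOfValues

/-! ### Computable functions and predicates under composition, bounded quantifiers and search. -/

section Toolkit

variable {α β γ σ : Type} [Primcodable α] [Primcodable β] [Primcodable γ] [Primcodable σ]

@[fun_prop] theorem computable_fst {f : α → β × γ} (hf : Computable f) :
    Computable fun a => (f a).1 := Computable.fst.comp hf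

@[fun_prop] theorem computable_snd {f : α → β × γ} (hf : Computable f) :
    Computable fun a => (f a).2 := Computable.snd.comp hf

@[fun_prop] theorem computable_add {f g : α → ℕ} (hf : Computable f) (hg : Computable g) :
    Computable fun a => f a + g a := Primrec.nat_add.to_comp.comp hf hg

@[fun_prop] theorem computable_sub {f g : α → ℕ} (hf : Computable f) (hg : Computable g) :
    Computable fun a => f a - g a := Primrec.nat_sub.to_comp.comp hf hg

@[fun_prop] theorem computable_mul {f g : α → ℕ} (hf : Computable f) (hg : Computable g) :
    Computable fun a => f a * g a := Primrec.nat_mul.to_comp.comp hf hg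

@[fun_prop] theorem computable_mod {f g : α → ℕ} (hf : Computable f) (hg : Computable g) :
    Computable fun a => f a % g a := Primrec.nat_mod.to_comp.comp hf hg

@[fun_prop] theorem computable_div {f g : α → ℕ} (hf : Computable f) (hg : Computable g) :
    Computable fun a => f a / g a := Primrec.nat_div.to_comp.comp hf hg

@[fun_prop] theorem computable_natPair {f g : α → ℕ} (hf : Computable f) (hg : Computable g) :
    Computable fun a => Nat.pair (f a) (g a) := Primrec₂.natPair.to_comp.comp hf hg

@[fun_prop] theorem computable_unpair {f : α → ℕ} (hf : Computable f) :
    Computable fun a => Nat.unpair (f a) := Computable.unpair.comp hf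

@[fun_prop] theorem computable_encode {f : α → β} (hf : Computable f) :
    Computable fun a => Encodable.encode (f a) := Computable.encode.comp hf

@[fun_prop] theorem computable_decode {f : α → ℕ} (hf : Computable f) :
    Computable fun a => (Encodable.decode (f a) : Option β) := Computable.decode.comp hf

@[fun_prop] theorem computable_ofNat {δ : Type} [Denumerable δ] {f : α → ℕ} (hf : Computable f) :
    Computable fun a => Denumerable.ofNat δ (f a) := (Computable.ofNat δ).comp hf

@[fun_prop] theorem computable_append {f g : α → List β} (hf : Computable f)
    (hg : Computable g) : Computable fun a => f a ++ g a := Computable.list_append.comp hf hg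

@[fun_prop] theorem computable_cons {f : α → β} {g : α → List β} (hf : Computable f)
    (hg : Computable g) : Computable fun a => f a :: g a := Computable.list_cons.comp hf hg

@[fun_prop] theorem computable_length {f : α → List β} (hf : Computable f) :
    Computable fun a => (f a).length := Computable.list_length.comp hf

@[fun_prop] theorem computable_take {f : α → List β} {n : α → ℕ} (hn : Computable n)
    (hf : Computable f) : Computable fun a => (f a).take (n a) :=
  Primrec.list_take.to_comp.comp hn hf

@[fun_prop] theorem computable_getElem? {f : α → List β} {n : α → ℕ} (hf : Computable f)
    (hn : Computable n) : Computable fun a => (f a)[n a]? :=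
  Computable.list_getElem?.comp hf hn

@[fun_prop] theorem computable_optionGetD {f : α → Option β} {g : α → β} (hf : Computable f)
    (hg : Computable g) : Computable fun a => (f a).getD (g a) := Computable.option_getD hf hg

@[fun_prop] theorem computable_getD {f : α → List β} {n : α → ℕ} {d : α → β} (hf : Computable f)
    (hn : Computable n) (hd : Computable d) : Computable fun a => (f a).getD (n a) (d a) := by
  simp only [List.getD_eq_getElem?_getD]; fun_prop

@[fun_prop] theorem computable_some {f : α → β} (hf : Computable f) :
    Computable fun a => some (f a) := Computable.option_some.comp hf

theorem computablePred_of_bool {f : α → Bool} (hf : Computable f) :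
    ComputablePred fun a => f a = true :=
  ComputablePred.computable_iff.2 ⟨f, hf, rfl⟩

@[fun_prop] theorem computablePred_const (p : Prop) : ComputablePred fun _ : α => p := by
  by_cases h : p
  · exact (computablePred_of_bool (Computable.const true)).of_eq (by simp [h])
  · exact (computablePred_of_bool (Computable.const false)).of_eq (by simp [h])

@[fun_prop] theorem computablePred_not {P : α → Prop} (hP : ComputablePred P) :
    ComputablePred fun a => ¬ P a := hP.not

@[fun_prop] theorem computablePred_and {P Q : α → Prop} (hP : ComputablePred P)
    (hQ : ComputablePred Q) : ComputablePred fun a => P a ∧ Q a := by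
  obtain ⟨f, hf, rfl⟩ := ComputablePred.computable_iff.1 hP
  obtain ⟨g, hg, rfl⟩ := ComputablePred.computable_iff.1 hQ
  exact (computablePred_of_bool (Primrec.and.to_comp.comp hf hg)).of_eq (by simp)

@[fun_prop] theorem computablePred_or {P Q : α → Prop} (hP : ComputablePred P)
    (hQ : ComputablePred Q) : ComputablePred fun a => P a ∨ Q a := by
  obtain ⟨f, hf, rfl⟩ := ComputablePred.computable_iff.1 hP
  obtain ⟨g, hg, rfl⟩ := ComputablePred.computable_iff.1 hQ
  exact (computablePred_of_bool (Primrec.or.to_comp.comp hf hg)).of_eq (by simp)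

@[fun_prop] theorem computablePred_imp {P Q : α → Prop} (hP : ComputablePred P)
    (hQ : ComputablePred Q) : ComputablePred fun a => P a → Q a :=
  ((computablePred_or hP.not hQ)).of_eq fun a => by tauto

@[fun_prop] theorem computablePred_iff {P Q : α → Prop} (hP : ComputablePred P)
    (hQ : ComputablePred Q) : ComputablePred fun a => (P a ↔ Q a) :=
  (computablePred_and (computablePred_imp hP hQ) (computablePred_imp hQ hP)).of_eq
    fun a => by tauto

@[fun_prop] theorem computablePred_eq {f g : α → β} (hf : Computable f) (hg : Computable g) :
    ComputablePred fun a => f a = g a := by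
  classical
  exact (computablePred_of_bool ((Primrec.eq (α := β)).decide.to_comp.comp hf hg)).of_eq
    fun a => by simp

@[fun_prop] theorem computablePred_lt {f g : α → ℕ} (hf : Computable f) (hg : Computable g) :
    ComputablePred fun a => f a < g a :=
  (computablePred_of_bool (Primrec.nat_lt.decide.to_comp.comp hf hg)).of_eq fun a => by simp

@[fun_prop] theorem computablePred_le {f g : α → ℕ} (hf : Computable f) (hg : Computable g) :
    ComputablePred fun a => f a ≤ g a :=
  (computablePred_of_bool (Primrec.nat_le.decide.to_comp.comp hf hg)).of_eq fun a => by simp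

@[fun_prop] theorem computablePred_comp {P : β → Prop} {f : α → β} (hP : ComputablePred P)
    (hf : Computable f) : ComputablePred fun a => P (f a) := by
  obtain ⟨g, hg, rfl⟩ := ComputablePred.computable_iff.1 hP
  exact computablePred_of_bool (hg.comp hf)

@[fun_prop] theorem computable_ite {P : α → Prop} [DecidablePred P] {f g : α → β}
    (hP : ComputablePred P) (hf : Computable f) (hg : Computable g) :
    Computable fun a => if P a then f a else g a := by
  have := Computable.cond hP.decide hf hg
  exact this.of_eq fun a => by by_cases h : P a <;> simp [h]

open Classical in
@[fun_prop] theorem computablePred_exists_lt {f : α → ℕ} {P : α → ℕ → Prop} (hf : Computable f)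
    (hP : ComputablePred fun x : α × ℕ => P x.1 x.2) :
    ComputablePred fun a => ∃ n, n < f a ∧ P a n := by
  have h : Computable fun a => (Nat.rec false
      (fun n ih => if P a n then true else ih) (f a) : Bool) := by
    refine Computable.nat_rec (f := f) (g := fun _ => false)
      (h := fun a (p : ℕ × Bool) => if P a p.1 then true else p.2) hf (by fun_prop) ?_
    exact computable_ite (P := fun x : α × ℕ × Bool => P x.1 x.2.1)
      (computablePred_comp hP (f := fun x : α × ℕ × Bool => (x.1, x.2.1)) (by fun_prop))
      (by fun_prop) (by fun_prop)
  refine (computablePred_of_bool h).of_eq fun a => ?_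
  induction f a with
  | zero => simp
  | succ n ih =>
    by_cases hn : P a n
    · simp only [hn, if_true, true_iff]; exact ⟨n, by omega, hn⟩
    · simp only [hn, if_false, ih]
      constructor
      · rintro ⟨m, h1, h2⟩; exact ⟨m, by omega, h2⟩
      · rintro ⟨m, h1, h2⟩
        refine ⟨m, ?_, h2⟩
        rcases Nat.lt_succ_iff_lt_or_eq.1 h1 with h | rfl
        · exact h
        · exact absurd h2 hn

@[fun_prop] theorem computablePred_forall_lt {f : α → ℕ} {P : α → ℕ → Prop} (hf : Computable f)
    (hP : ComputablePred fun x : α × ℕ => P x.1 x.2) :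
    ComputablePred fun a => ∀ n, n < f a → P a n :=
  (computablePred_exists_lt (P := fun a n => ¬ P a n) hf hP.not).not.of_eq
    fun a => by push Not; rfl

theorem ComputablePred.exists_uncurried {P : α → β → Prop}
    (hP : ComputablePred fun x : α × β => P x.1 x.2) :
    ∃ g : α × β → Bool, Computable g ∧ ∀ a b, P a b ↔ g (a, b) = true := by
  obtain ⟨g, hg, hge⟩ := ComputablePred.computable_iff.1 hP
  exact ⟨g, hg, fun a b => by simpa using congrFun hge (a, b)⟩

@[fun_prop] theorem computablePred_exists_option {o : α → Option β} {P : α → β → Prop}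
    (ho : Computable o) (hP : ComputablePred fun x : α × β => P x.1 x.2) :
    ComputablePred fun a => ∃ b, o a = some b ∧ P a b := by
  obtain ⟨g, hg, hge⟩ := ComputablePred.exists_uncurried hP
  have h2 : Computable₂ fun (a : α) (b : β) => g (a, b) := hg.to₂
  refine (computablePred_of_bool (Computable.option_casesOn (f := fun _ => false) ho
    (Computable.const false) h2)).of_eq fun a => ?_
  cases o a <;> simp [hge]

@[fun_prop] theorem computablePred_forall_option {o : α → Option β} {P : α → β → Prop}
    (ho : Computable o) (hP : ComputablePred fun x : α × β => P x.1 x.2) :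
    ComputablePred fun a => ∀ b, o a = some b → P a b :=
  (computablePred_exists_option (P := fun a b => ¬ P a b) ho hP.not).not.of_eq
    fun a => by push Not; rfl

@[fun_prop] theorem computablePred_forall_mem {f : α → List β} {P : α → β → Prop}
    (hf : Computable f) (hP : ComputablePred fun x : α × β => P x.1 x.2) :
    ComputablePred fun a => ∀ b, b ∈ f a → P a b := by
  have h : ComputablePred fun a => ∀ n, n < (f a).length → ∀ b, (f a)[n]? = some b → P a b := by
    refine computablePred_forall_lt (P := fun a n => ∀ b, (f a)[n]? = some b → P a b)
      (by fun_prop) (computablePred_forall_option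
        (o := fun x : α × ℕ => (f x.1)[x.2]?) (P := fun x b => P x.1 b) (by fun_prop) ?_)
    exact computablePred_comp hP (f := fun x : (α × ℕ) × β => (x.1.1, x.2)) (by fun_prop)
  refine h.of_eq fun a => ?_
  constructor
  · intro H b hb
    obtain ⟨n, hn, rfl⟩ := List.mem_iff_getElem.1 hb
    exact H n hn _ (by simp [hn])
  · intro H n hn b hb
    exact H b (List.mem_of_getElem? hb)

@[fun_prop] theorem computablePred_exists_mem {f : α → List β} {P : α → β → Prop}
    (hf : Computable f) (hP : ComputablePred fun x : α × β => P x.1 x.2) :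
    ComputablePred fun a => ∃ b, b ∈ f a ∧ P a b :=
  (computablePred_forall_mem (P := fun a b => ¬ P a b) hf hP.not).not.of_eq
    fun a => by push Not; rfl

@[fun_prop] theorem computablePred_mem {f : α → β} {g : α → List β} (hf : Computable f)
    (hg : Computable g) : ComputablePred fun a => f a ∈ g a :=
  (computablePred_not (computablePred_forall_mem (P := fun a b => ¬ f a = b) hg
    (by fun_prop))).of_eq fun a => by simp

@[fun_prop] theorem computablePred_isPrefix {f g : α → List β} (hf : Computable f)
    (hg : Computable g) : ComputablePred fun a => f a <+: g a :=
  (computablePred_eq (f := fun a => f a) (g := fun a => (g a).take (f a).length) hf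
    (by fun_prop)).of_eq fun a => by rw [List.prefix_iff_eq_take]

@[fun_prop] theorem computablePred_nodup {f : α → List β} (hf : Computable f) :
    ComputablePred fun a => (f a).Nodup := by
  refine ComputablePred.of_eq (p := fun a => ∀ i, i < (f a).length → ∀ j, j < (f a).length →
    (f a)[i]? = (f a)[j]? → i = j) (by fun_prop) fun a => ?_
  constructor
  · intro h
    rw [List.nodup_iff_injective_get]
    intro i j hij
    exact Fin.ext (h i i.2 j j.2 (by simpa using hij))
  · intro h i hi j hj hij
    exact (List.getElem?_inj hi h).1 hij

theorem computable_find {P : α → ℕ → Prop} [∀ a, DecidablePred (P a)]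
    (hP : ComputablePred fun x : α × ℕ => P x.1 x.2) (h : ∀ a, ∃ n, P a n) :
    Computable fun a => Nat.find (h a) := Computable.find hP h

theorem computable_courseRec {F : List σ → σ} (hF : Computable F) : Computable (courseRec F) := by
  have h : Computable (courseList F) := by
    have := Computable.nat_rec (f := fun t : ℕ => t) (g := fun _ => ([] : List σ))
      (h := fun _ (p : ℕ × List σ) => p.2 ++ [F p.2]) Computable.id (by fun_prop)
      (Computable.to₂ (f := fun x : ℕ × ℕ × List σ => x.2.2 ++ [F x.2.2]) (by fun_prop))
    refine this.of_eq fun t => ?_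
    induction t with
    | zero => rfl
    | succ t ih => simp only [courseList, ← ih]
  exact hF.comp h

end Toolkit

end CatDeg


namespace CatDeg

/-! ## The first two levels of the arithmetical hierarchy -/

section Hierarchy

variable {α β γ : Type} [Primcodable α] [Primcodable β] [Primcodable γ]

/-- `P` is `Σ⁰₁`. -/
def Sig1 (P : α → Prop) : Prop :=
  ∃ R : α → ℕ → Prop, ComputablePred (fun x : α × ℕ => R x.1 x.2) ∧ ∀ x, P x ↔ ∃ u, R x u

/-- `P` is `Σ⁰₂`. -/
@[fun_prop] def Sig2 (P : α → Prop) : Prop :=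
  ∃ R : α → ℕ → ℕ → Prop, ComputablePred (fun x : α × ℕ × ℕ => R x.1 x.2.1 x.2.2) ∧
    ∀ x, P x ↔ ∃ u, ∀ v, R x u v

theorem ComputablePred.sig1 {P : α → Prop} (h : ComputablePred P) : Sig1 P :=
  ⟨fun a _ => P a, computablePred_comp h computable_fst_id, fun _ => by simp⟩
where computable_fst_id : Computable fun x : α × ℕ => x.1 := Computable.fst

theorem Sig1.of_eq {P Q : α → Prop} (h : Sig1 P) (e : ∀ a, P a ↔ Q a) : Sig1 Q := by
  rwa [← show P = Q from funext fun a => propext (e a)]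

theorem Sig2.of_eq {P Q : α → Prop} (h : Sig2 P) (e : ∀ a, P a ↔ Q a) : Sig2 Q := by
  rwa [← show P = Q from funext fun a => propext (e a)]

theorem Sig1.comp {P : β → Prop} {f : α → β} (h : Sig1 P) (hf : Computable f) :
    Sig1 fun a => P (f a) := by
  obtain ⟨R, hR, e⟩ := h
  exact ⟨fun a u => R (f a) u, computablePred_comp hR (f := fun x : α × ℕ => (f x.1, x.2))
    (by fun_prop), fun x => e _⟩

@[fun_prop] theorem Sig2.comp {P : β → Prop} {f : α → β} (h : Sig2 P) (hf : Computable f) :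
    Sig2 fun a => P (f a) := by
  obtain ⟨R, hR, e⟩ := h
  exact ⟨fun a u v => R (f a) u v,
    computablePred_comp hR (f := fun x : α × ℕ × ℕ => (f x.1, x.2.1, x.2.2))
    (by fun_prop), fun x => e _⟩

@[fun_prop] theorem ComputablePred.sig2 {P : α → Prop} (h : ComputablePred P) : Sig2 P :=
  ⟨fun a _ _ => P a, computablePred_comp h (f := fun x : α × ℕ × ℕ => x.1) (by fun_prop),
    fun _ => by simp⟩

theorem Sig1.sig2 {P : α → Prop} (h : Sig1 P) : Sig2 P := by
  obtain ⟨R, hR, e⟩ := h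
  exact ⟨fun a u _ => R a u, computablePred_comp hR (f := fun x : α × ℕ × ℕ => (x.1, x.2.1))
    (by fun_prop), fun x => by simp [e]⟩

theorem Sig1.not_sig2 {P : α → Prop} (h : Sig1 P) : Sig2 fun a => ¬ P a := by
  obtain ⟨R, hR, e⟩ := h
  exact ⟨fun a _ v => ¬ R a v, (computablePred_comp hR
    (f := fun x : α × ℕ × ℕ => (x.1, x.2.2)) (by fun_prop)).not, fun x => by simp [e]⟩

theorem Sig1.exists {P : α → β → Prop} (h : Sig1 fun x : α × β => P x.1 x.2) :
    Sig1 fun a => ∃ b, P a b := by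
  obtain ⟨R, hR, e⟩ := h
  refine ⟨fun a u => ∃ b, (Encodable.decode u.unpair.1 : Option β) = some b ∧
    R (a, b) u.unpair.2, ?_, fun x => ?_⟩
  · refine computablePred_exists_option
      (o := fun x : α × ℕ => (Encodable.decode x.2.unpair.1 : Option β))
      (P := fun x b => R (x.1, b) x.2.unpair.2) (by fun_prop) ?_
    exact computablePred_comp hR
      (f := fun x : (α × ℕ) × β => ((x.1.1, x.2), x.1.2.unpair.2)) (by fun_prop)
  · constructor
    · rintro ⟨b, hb⟩
      obtain ⟨u, hu⟩ := (e (x, b)).1 hb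
      exact ⟨Nat.pair (Encodable.encode b) u, b, by simp, by simpa using hu⟩
    · rintro ⟨u, b, -, h⟩
      exact ⟨b, (e (x, b)).2 ⟨_, h⟩⟩

@[fun_prop] theorem Sig2.exists {P : α → β → Prop} (h : Sig2 fun x : α × β => P x.1 x.2) :
    Sig2 fun a => ∃ b, P a b := by
  obtain ⟨R, hR, e⟩ := h
  refine ⟨fun a u v => ∃ b, (Encodable.decode u.unpair.1 : Option β) = some b ∧
    R (a, b) u.unpair.2 v, ?_, fun x => ?_⟩
  · refine computablePred_exists_option
      (o := fun x : α × ℕ × ℕ => (Encodable.decode x.2.1.unpair.1 : Option β))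
      (P := fun x b => R (x.1, b) x.2.1.unpair.2 x.2.2) (by fun_prop) ?_
    exact computablePred_comp hR
      (f := fun x : (α × ℕ × ℕ) × β => ((x.1.1, x.2), x.1.2.1.unpair.2, x.1.2.2)) (by fun_prop)
  · constructor
    · rintro ⟨b, hb⟩
      obtain ⟨u, hu⟩ := (e (x, b)).1 hb
      exact ⟨Nat.pair (Encodable.encode b) u, fun v => ⟨b, by simp, by simpa using hu v⟩⟩
    · rintro ⟨u, h⟩
      obtain ⟨b, hb, -⟩ := h 0
      refine ⟨b, (e (x, b)).2 ⟨u.unpair.2, fun v => ?_⟩⟩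
      obtain ⟨b', hb', h'⟩ := h v
      rw [hb] at hb'
      cases hb'
      exact h'

@[fun_prop] theorem Sig2.and {P Q : α → Prop} (hP : Sig2 P) (hQ : Sig2 Q) :
    Sig2 fun a => P a ∧ Q a := by
  obtain ⟨R, hR, e⟩ := hP
  obtain ⟨S, hS, e'⟩ := hQ
  refine ⟨fun a u v => R a u.unpair.1 v ∧ S a u.unpair.2 v, computablePred_and
    (computablePred_comp hR (f := fun x : α × ℕ × ℕ => (x.1, x.2.1.unpair.1, x.2.2)) (by fun_prop))
    (computablePred_comp hS (f := fun x : α × ℕ × ℕ => (x.1, x.2.1.unpair.2, x.2.2)) (by fun_prop)),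
    fun x => ?_⟩
  refine (and_congr (e x) (e' x)).trans ?_
  constructor
  · rintro ⟨⟨u, hu⟩, w, hw⟩
    exact ⟨Nat.pair u w, fun v => by simp [hu, hw]⟩
  · rintro ⟨u, hu⟩
    exact ⟨⟨_, fun v => (hu v).1⟩, _, fun v => (hu v).2⟩

@[fun_prop] theorem Sig2.or {P Q : α → Prop} (hP : Sig2 P) (hQ : Sig2 Q) :
    Sig2 fun a => P a ∨ Q a := by
  -- The number `n` names the disjunct that holds, `0` for `P` and `1` for `Q`. A disjunction with a
  -- decidable equation keeps the quantifier prefix.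
  have h : Sig2 fun a => ∃ n : ℕ, (n = 0 ∨ Q a) ∧ (n = 1 ∨ P a) := by
    obtain ⟨R, hR, e⟩ := hP
    obtain ⟨S, hS, e'⟩ := hQ
    refine Sig2.exists (P := fun a (n : ℕ) => (n = 0 ∨ Q a) ∧ (n = 1 ∨ P a)) (Sig2.and ?_ ?_)
    · refine ⟨fun x u v => x.2 = 0 ∨ S x.1 u v, computablePred_or (by fun_prop)
        (computablePred_comp hS (f := fun x : (α × ℕ) × ℕ × ℕ => (x.1.1, x.2)) (by fun_prop)),
        fun x => ?_⟩
      refine (or_congr Iff.rfl (e' x.1)).trans ?_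
      by_cases h : x.2 = 0 <;> simp [h]
    · refine ⟨fun x u v => x.2 = 1 ∨ R x.1 u v, computablePred_or (by fun_prop)
        (computablePred_comp hR (f := fun x : (α × ℕ) × ℕ × ℕ => (x.1.1, x.2)) (by fun_prop)),
        fun x => ?_⟩
      refine (or_congr Iff.rfl (e x.1)).trans ?_
      by_cases h : x.2 = 1 <;> simp [h]
  refine h.of_eq fun a => ?_
  constructor
  · rintro ⟨n, h | h, h' | h'⟩
    · omega
    · exact .inl h'
    · exact .inr h
    · exact .inr h
  · rintro (h | h)
    · exact ⟨0, .inl rfl, .inr h⟩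
    · exact ⟨1, .inr h, .inl rfl⟩

@[fun_prop] theorem sig2_not {P : α → Prop} (h : ComputablePred P) : Sig2 fun a => ¬ P a :=
  ComputablePred.sig2 (computablePred_not h)

@[fun_prop] theorem sig2_eq {f g : α → β} (hf : Computable f) (hg : Computable g) :
    Sig2 fun a => f a = g a := ComputablePred.sig2 (by fun_prop)

@[fun_prop] theorem sig2_lt {f g : α → ℕ} (hf : Computable f) (hg : Computable g) :
    Sig2 fun a => f a < g a := ComputablePred.sig2 (by fun_prop)

@[fun_prop] theorem sig2_le {f g : α → ℕ} (hf : Computable f) (hg : Computable g) :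
    Sig2 fun a => f a ≤ g a := ComputablePred.sig2 (by fun_prop)

@[fun_prop] theorem sig2_mem {f : α → β} {g : α → List β} (hf : Computable f)
    (hg : Computable g) : Sig2 fun a => f a ∈ g a := ComputablePred.sig2 (by fun_prop)

@[fun_prop] theorem sig2_isPrefix {f g : α → List β} (hf : Computable f)
    (hg : Computable g) : Sig2 fun a => f a <+: g a := ComputablePred.sig2 (by fun_prop)

@[fun_prop] theorem Sig2.imp {P Q : α → Prop} (hP : ComputablePred P) (hQ : Sig2 Q) :
    Sig2 fun a => P a → Q a :=
  (Sig2.or (ComputablePred.sig2 (computablePred_not hP)) hQ).of_eq fun a => by tauto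

@[fun_prop] theorem Sig2.forall_lt {f : α → ℕ} {P : α → ℕ → Prop} (hf : Computable f)
    (hP : Sig2 fun x : α × ℕ => P x.1 x.2) : Sig2 fun a => ∀ n, n < f a → P a n := by
  obtain ⟨R, hR, e⟩ := hP
  -- Collection: the finitely many existential witnesses are gathered in one list `U`, so that the
  -- bounded quantifier moves inside.
  have h : Sig2 fun a => ∃ U : List ℕ, ∀ n, n < f a → ∀ v, R (a, n) (U.getD n 0) v := by
    refine Sig2.exists ⟨fun x _ v => ∀ n, n < f x.1 → R (x.1, n) (x.2.getD n 0) v, ?_, ?_⟩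
    · refine computablePred_forall_lt (f := fun x : (α × List ℕ) × ℕ × ℕ => f x.1.1)
        (P := fun x n => R (x.1.1, n) (x.1.2.getD n 0) x.2.2) (by fun_prop) ?_
      exact computablePred_comp hR (f := fun x : ((α × List ℕ) × ℕ × ℕ) × ℕ =>
        ((x.1.1.1, x.2), x.1.1.2.getD x.2 0, x.1.2.2)) (by fun_prop)
    · intro x
      constructor
      · intro h
        exact ⟨0, fun v n hn => h n hn v⟩
      · rintro ⟨_, h⟩ n hn v
        exact h v n hn
  refine h.of_eq fun a => ?_
  constructor
  · rintro ⟨U, hU⟩ n hn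
    exact (e (a, n)).2 ⟨_, hU n hn⟩
  · intro h
    choose! u hu using fun n hn => (e (a, n)).1 (h n hn)
    refine ⟨(List.range (f a)).map u, fun n hn v => ?_⟩
    have := hu n hn v
    rwa [List.getD_eq_getElem?_getD, List.getElem?_map, List.getElem?_range hn]

@[fun_prop] theorem Sig2.forall_mem {f : α → List β} {P : α → β → Prop} (hf : Computable f)
    (hP : Sig2 fun x : α × β => P x.1 x.2) : Sig2 fun a => ∀ b, b ∈ f a → P a b := by
  have h : Sig2 fun a => ∀ n, n < (f a).length → ∃ b, (f a)[n]? = some b ∧ P a b := by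
    refine Sig2.forall_lt (P := fun a n => ∃ b, (f a)[n]? = some b ∧ P a b) (by fun_prop)
      (Sig2.exists (P := fun (x : α × ℕ) b => (f x.1)[x.2]? = some b ∧ P x.1 b)
      (Sig2.and (by fun_prop) ?_))
    exact hP.comp (f := fun x : (α × ℕ) × β => (x.1.1, x.2)) (by fun_prop)
  refine h.of_eq fun a => ?_
  constructor
  · intro H b hb
    obtain ⟨n, hn, rfl⟩ := List.mem_iff_getElem.1 hb
    obtain ⟨b, hb, hP⟩ := H n hn
    rw [List.getElem?_eq_getElem hn] at hb
    cases hb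
    exact hP
  · intro H n hn
    exact ⟨_, List.getElem?_eq_getElem hn, H _ (List.getElem_mem hn)⟩

open Nat.Partrec (Code)

@[fun_prop] theorem computable_evaln {k n : α → ℕ} {c : α → Code} (hk : Computable k)
    (hc : Computable c) (hn : Computable n) :
    Computable fun a => Code.evaln (k a) (c a) (n a) :=
  Code.primrec_evaln.to_comp.comp (f := fun x : (ℕ × Code) × ℕ => Code.evaln x.1.1 x.1.2 x.2)
    (g := fun a => ((k a, c a), n a)) (by fun_prop)

/-! ## A universal c.e. set and its enumeration -/

/-- The stage `t` approximation to the universal c.e. set. -/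
def Kst (n t : ℕ) : Prop :=
  -- The bound `y < t` makes the stage of enumeration exceed the output, which is what lets settling
  -- times dominate computable functions.
  n < t ∧ ∃ y, y < t ∧
    Code.evaln t (Denumerable.ofNat Code n.unpair.1) n.unpair.2 = some y

/-- The universal c.e. set. -/
def KSet (n : ℕ) : Prop := ∃ t, Kst n t

@[fun_prop] theorem computablePred_kst {f g : α → ℕ} (hf : Computable f) (hg : Computable g) :
    ComputablePred fun a => Kst (f a) (g a) := by
  unfold Kst; fun_prop

theorem Kst.mono {n t t' : ℕ} (h : t ≤ t') (hn : Kst n t) : Kst n t' := by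
  obtain ⟨h1, y, h2, h3⟩ := hn
  exact ⟨by omega, y, by omega, Code.evaln_mono h h3⟩

theorem sig1_kset : Sig1 KSet := ⟨Kst, by fun_prop, fun _ => Iff.rfl⟩

theorem kset_pair (c : Code) (x : ℕ) :
    KSet (Nat.pair (Encodable.encode c) x) ↔ (Code.eval c x).Dom := by
  rw [Part.dom_iff_mem]
  simp only [KSet, Kst, Nat.unpair_pair, Denumerable.ofNat_encode]
  constructor
  · rintro ⟨t, -, y, -, h⟩
    exact ⟨y, Code.evaln_sound h⟩
  · rintro ⟨y, h⟩
    obtain ⟨k, hk⟩ := Code.evaln_complete.1 h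
    refine ⟨k + y + 1 + Nat.pair (Encodable.encode c) x, by omega, y, by omega,
      Code.evaln_mono (by omega) hk⟩

/-- Every `Σ⁰₁` predicate is a section of the universal c.e. set. -/
theorem Sig1.exists_index {P : α → Prop} (h : Sig1 P) :
    ∃ p, ∀ x, P x ↔ KSet (Nat.pair p (Encodable.encode x)) := by
  classical
  obtain ⟨R, hR, e⟩ := h
  have hf : Partrec fun x : α => Nat.rfind fun u => Part.some (decide (R x u)) := by
    apply Partrec.rfind
    exact (hR.decide).partrec
  obtain ⟨c, hc⟩ := Code.exists_code.1 hf
  refine ⟨Encodable.encode c, fun x => ?_⟩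
  rw [kset_pair, hc, e]
  simp only [Encodable.encodek, Part.coe_some, Part.bind_some]
  refine Iff.trans ?_ (Nat.rfind_dom (p := fun u => Part.some (decide (R x u)))).symm
  simp

/-- The universal `Σ⁰₂` predicate. -/
def U2 (p x : ℕ) : Prop := ∃ u, ¬ KSet (Nat.pair p (Nat.pair u x))

theorem sig2_u2 {f g : α → ℕ} (hf : Computable f) (hg : Computable g) :
    Sig2 fun a => U2 (f a) (g a) := by
  refine Sig2.exists (P := fun a u => ¬ KSet (Nat.pair (f a) (Nat.pair u (g a)))) ?_
  exact (sig1_kset.comp (f := fun x : α × ℕ => Nat.pair (f x.1) (Nat.pair x.2 (g x.1)))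
    (by fun_prop)).not_sig2

theorem Sig2.exists_index {P : α → Prop} (h : Sig2 P) :
    ∃ p, ∀ x, P x ↔ U2 p (Encodable.encode x) := by
  obtain ⟨R, hR, e⟩ := h
  have h1 : Sig1 fun x : ℕ × α => ∃ v, ¬ R x.2 x.1 v :=
    ⟨fun x v => ¬ R x.2 x.1 v, (computablePred_comp hR
      (f := fun x : (ℕ × α) × ℕ => (x.1.2, x.1.1, x.2)) (by fun_prop)).not, fun _ => Iff.rfl⟩
  obtain ⟨p, hp⟩ := h1.exists_index
  refine ⟨p, fun x => ?_⟩
  rw [e]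
  refine exists_congr fun u => ?_
  have := hp (u, x)
  simp only [Encodable.encode_prod_val, Encodable.encode_nat] at this
  rw [← this]
  simp

/-- A total computable function is dominated by the settling time of the universal c.e. set. -/
theorem kset_of_computable {f : ℕ → ℕ} (hf : Computable f) :
    ∃ e, (∀ x, KSet (Nat.pair e x)) ∧ ∀ x w, Kst (Nat.pair e x) w → f x < w := by
  obtain ⟨c, hc⟩ := Code.exists_code.1 hf
  refine ⟨Encodable.encode c, fun x => ?_, fun x w h => ?_⟩
  · rw [kset_pair, hc]; simp
  · obtain ⟨-, y, hy, h⟩ := h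
    simp only [Nat.unpair_pair, Denumerable.ofNat_encode] at h
    have := Code.evaln_sound h
    rw [hc] at this
    simp at this
    omega

end Hierarchy

/-! ## True stages -/

section TrueStages

theorem exists_new (t : ℕ) : ∃ n, n = t ∨ (Kst n t ∧ ¬ Kst n (t - 1)) := ⟨t, .inl rfl⟩

open Classical in
/-- The least number enumerated at stage `t` (at most `t`). -/
noncomputable def kk (t : ℕ) : ℕ := Nat.find (exists_new t)

/-- Stage `t` looks true at stage `r`. -/
def Bel (t r : ℕ) : Prop := t ≤ r ∧ ∀ q, q < r + 1 → t ≤ q → kk t ≤ kk q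

/-- `t` is a true stage of the enumeration. -/
def Tru (t : ℕ) : Prop := ∀ q, t ≤ q → kk t ≤ kk q

/-- `P x` looks true at stage `t`, where `p` is an index for `P`. -/
def Sees (p x t : ℕ) : Prop :=
  ∃ u, u < t ∧ Nat.pair p (Nat.pair u x) < kk t ∧ ¬ Kst (Nat.pair p (Nat.pair u x)) t

variable {α : Type} [Primcodable α]

@[fun_prop] theorem computable_kk {f : α → ℕ} (hf : Computable f) :
    Computable fun a => kk (f a) := by
  classical
  have : Computable kk := computable_find (P := fun t n => n = t ∨ (Kst n t ∧ ¬ Kst n (t - 1)))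
    (by fun_prop) exists_new
  exact this.comp hf

@[fun_prop] theorem computablePred_bel {f g : α → ℕ} (hf : Computable f) (hg : Computable g) :
    ComputablePred fun a => Bel (f a) (g a) := by
  unfold Bel; fun_prop

@[fun_prop] theorem computablePred_sees {f g h : α → ℕ} (hf : Computable f) (hg : Computable g)
    (hh : Computable h) : ComputablePred fun a => Sees (f a) (g a) (h a) := by
  unfold Sees; fun_prop

theorem kk_le (t : ℕ) : kk t ≤ t := by
  classical
  exact Nat.find_min' _ (.inl rfl)

theorem kk_le_of_new {n t : ℕ} (h : Kst n t) (h' : ¬ Kst n (t - 1)) : kk t ≤ n := by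
  classical
  exact Nat.find_min' _ (.inr ⟨h, h'⟩)

theorem kk_spec (t : ℕ) : kk t = t ∨ (Kst (kk t) t ∧ ¬ Kst (kk t) (t - 1)) := by
  classical
  exact Nat.find_spec (exists_new t)

/-- Once membership of `m` has stabilized, `m` cannot be the new number of a later stage. -/
theorem tendsto_kk (m : ℕ) : ∃ T, ∀ t, T ≤ t → m ≤ kk t := by
  induction m with
  | zero => exact ⟨0, fun _ _ => Nat.zero_le _⟩
  | succ m ih =>
    obtain ⟨T, hT⟩ := ih
    obtain ⟨T', hT'⟩ : ∃ T', ∀ t, T' ≤ t → (Kst m t ↔ KSet m) := by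
      by_cases h : KSet m
      · obtain ⟨s, hs⟩ := h
        exact ⟨s, fun t ht => ⟨fun h => ⟨t, h⟩, fun _ => hs.mono ht⟩⟩
      · exact ⟨0, fun t _ => ⟨fun h => ⟨t, h⟩, fun h' => absurd h' h⟩⟩
    refine ⟨T + T' + m + 1, fun t ht => ?_⟩
    have h1 := hT t (by omega)
    by_contra h2
    have h3 : kk t = m := by omega
    rcases kk_spec t with h | ⟨h, h'⟩
    · omega
    · rw [h3] at h h'
      exact h' ((hT' _ (by omega)).2 ((hT' t (by omega)).1 h))

/-- A stage that minimizes `kk` beyond `T` is true. -/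
theorem exists_tru (T : ℕ) : ∃ t, T ≤ t ∧ Tru t := by
  obtain ⟨t, ht, h⟩ := WellFounded.has_min (measure kk).wf {t | T ≤ t} ⟨T, le_refl T⟩
  refine ⟨t, ht, fun q hq => ?_⟩
  have := h q (le_trans ht hq)
  simpa [measure, InvImage, WellFoundedRelation.rel] using this

/-- A number below `kk t` that entered after the true stage `t` would give a later stage a smaller
value of `kk`. So below `kk t` the enumeration is complete at `t`. -/
theorem Tru.kst {t n : ℕ} (ht : Tru t) (hn : n < kk t) (h : KSet n) : Kst n t := by
  by_contra h1
  classical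
  have h2 := Nat.find_spec h
  set q := Nat.find h with hq
  have h3 : t < q := by
    by_contra h4
    exact h1 (h2.mono (by omega))
  have h4 : ¬ Kst n (q - 1) := Nat.find_min h (by omega)
  have := kk_le_of_new h2 h4
  have := ht q h3.le
  omega

theorem Bel.refl (t : ℕ) : Bel t t := ⟨le_rfl, fun q h h' => by
  rw [show q = t by omega]⟩

theorem Bel.le {t r : ℕ} (h : Bel t r) : t ≤ r := h.1

theorem Bel.kk_le {t r : ℕ} (h : Bel t r) : kk t ≤ kk r := h.2 r (by omega) h.1

theorem Bel.trans {t s r : ℕ} (h : Bel t s) (h' : Bel s r) : Bel t r :=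
  ⟨h.1.trans h'.1, fun q hq htq => by
    by_cases hqs : q < s + 1
    · exact h.2 q hqs htq
    · exact h.kk_le.trans (h'.2 q hq (by omega))⟩

theorem Bel.mid {t s r : ℕ} (h : Bel t r) (hts : t ≤ s) (hsr : s ≤ r) : Bel t s :=
  ⟨hts, fun q hq htq => h.2 q (by omega) htq⟩

theorem Tru.bel {t r : ℕ} (h : Tru t) (htr : t ≤ r) : Bel t r := ⟨htr, fun q _ hq => h q hq⟩

theorem Tru.of_bel {t r : ℕ} (h : Tru r) (h' : Bel t r) : Tru t := fun q hq => by
  by_cases hqr : q < r + 1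
  · exact h'.2 q hqr hq
  · exact h'.kk_le.trans (h q (by omega))

theorem kk_zero : kk 0 = 0 := Nat.le_zero.1 (kk_le 0)

theorem bel_zero (t : ℕ) : Bel 0 t := ⟨Nat.zero_le _, fun q _ _ => by simp [kk_zero]⟩

theorem tru_zero : Tru 0 := fun q _ => by simp [kk_zero]

theorem exists_pred (t : ℕ) : ∃ d, t = 0 ∨ (Bel (t - 1 - d) t) :=
  ⟨t - 1, .inr (by simpa using bel_zero t)⟩

open Classical in
/-- The last stage before `t` that looks true at `t` (and `0` for `t = 0`). -/
noncomputable def prd (t : ℕ) : ℕ := t - 1 - Nat.find (exists_pred t)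

@[fun_prop] theorem computable_prd {f : α → ℕ} (hf : Computable f) :
    Computable fun a => prd (f a) := by
  classical
  have : Computable fun t => Nat.find (exists_pred t) :=
    computable_find (P := fun t d => t = 0 ∨ (Bel (t - 1 - d) t)) (by fun_prop) exists_pred
  have h : Computable prd := by unfold prd; fun_prop
  exact h.comp hf

theorem prd_lt {t : ℕ} (h : 0 < t) : prd t < t := by unfold prd; omega

theorem bel_prd (t : ℕ) : Bel (prd t) t := by
  classical
  rcases Nat.find_spec (exists_pred t) with h | h
  · subst h; simpa [prd] using Bel.refl 0
  · exact h

/-- The stages that look true at `r` form a chain with `prd r` as its last member before `r`.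
Inductions along `prd` therefore reach all of them. -/
theorem Bel.to_prd {t r : ℕ} (h : Bel t r) (hlt : t < r) : Bel t (prd r) := by
  classical
  refine h.mid ?_ (prd_lt (by omega)).le
  have : Nat.find (exists_pred r) ≤ r - 1 - t :=
    Nat.find_min' _ (.inr (by rwa [show r - 1 - (r - 1 - t) = t by omega]))
  unfold prd; omega

theorem Tru.u2_of_sees {t p x : ℕ} (ht : Tru t) (h : Sees p x t) : U2 p x := by
  obtain ⟨u, -, h1, h2⟩ := h
  exact ⟨u, fun h => h2 (ht.kst h1 h)⟩

/-- A true `Σ⁰₂` fact has a witness whose code is never enumerated, and `kk t` eventually stays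
above that code, at false stages too. -/
theorem U2.eventually_sees {p x : ℕ} (h : U2 p x) : ∃ T, ∀ t, T ≤ t → Sees p x t := by
  obtain ⟨u, hu⟩ := h
  obtain ⟨T, hT⟩ := tendsto_kk (Nat.pair p (Nat.pair u x) + 1)
  exact ⟨T + u + 1, fun t ht => ⟨u, by omega, hT t (by omega), fun h => hu ⟨t, h⟩⟩⟩

end TrueStages

end CatDeg


namespace CatDeg

/-! ## Derivations -/

section Derivations

variable {ε : Type} {J : List ε → ε → Prop}

/-- `L` is a derivation for the rules `J`: each entry follows from the earlier ones. -/
def Deriv (J : List ε → ε → Prop) (L : List ε) : Prop :=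
  ∀ i, i < L.length → ∀ e, L[i]? = some e → J (L.take i) e

/-- `e` is derivable by the rules `J`. -/
def Drv (J : List ε → ε → Prop) (e : ε) : Prop := ∃ L, Deriv J L ∧ e ∈ L

theorem Deriv.mem_induction {P : ε → Prop} {L : List ε} (hL : Deriv J L)
    (h : ∀ L' e, L' ⊆ L → e ∈ L → J L' e → (∀ q ∈ L', P q) → P e) : ∀ e ∈ L, P e := by
  have : ∀ i, i < L.length → ∀ e, L[i]? = some e → P e := by
    intro i
    induction i using Nat.strong_induction_on with
    | _ i ih =>
      intro hi e he
      refine h _ e (List.take_subset i L) (List.mem_of_getElem? he) (hL i hi e he) fun q hq => ?_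
      obtain ⟨j, hj, rfl⟩ := List.mem_iff_getElem.1 hq
      rw [List.length_take] at hj
      exact ih j (by omega) (by omega) _ (by simp)
  intro e he
  obtain ⟨i, hi, rfl⟩ := List.mem_iff_getElem.1 he
  exact this i hi _ (List.getElem?_eq_getElem hi)

theorem Drv.induction {P : ε → Prop} {e : ε} (he : Drv J e)
    (h : ∀ L e, J L e → (∀ q ∈ L, P q) → P e) : P e := by
  obtain ⟨L, hL, he⟩ := he
  exact hL.mem_induction (fun L' e _ _ => h L' e) e he

theorem Deriv.append (hJ : ∀ L L' e, L ⊆ L' → J L e → J L' e) {L L' : List ε} (h : Deriv J L)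
    (h' : Deriv J L') : Deriv J (L ++ L') := by
  intro i hi e he
  rcases Nat.lt_or_ge i L.length with h1 | h1
  · rw [List.getElem?_append_left h1] at he
    rw [List.take_append_of_le_length h1.le]
    exact h i h1 e he
  · rw [List.getElem?_append_right h1] at he
    rw [List.length_append] at hi
    refine hJ _ _ _ ?_ (h' _ (by omega) e he)
    rw [List.take_append, List.take_of_length_le h1]
    exact List.subset_append_right _ _

/-- The derivations of the premises are concatenated, and monotone rules remain applicable over
longer lists. -/
theorem Drv.intro (hJ : ∀ L L' e, L ⊆ L' → J L e → J L' e) {L : List ε} {e : ε} (h : J L e)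
    (hL : ∀ q ∈ L, Drv J q) : Drv J e := by
  have : ∃ L', Deriv J L' ∧ L ⊆ L' := by
    clear h
    induction L with
    | nil => exact ⟨[], fun i hi => absurd hi (by simp), by simp⟩
    | cons q L ih =>
      obtain ⟨L', h1, h2⟩ := ih fun r hr => hL r (List.mem_cons_of_mem _ hr)
      obtain ⟨M, h3, h4⟩ := hL q List.mem_cons_self
      refine ⟨M ++ L', h3.append hJ h1, ?_⟩
      intro r hr
      rcases List.mem_cons.1 hr with rfl | hr
      · exact List.mem_append_left _ h4
      · exact List.mem_append_right _ (h2 hr)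
  obtain ⟨L', h1, h2⟩ := this
  refine ⟨L' ++ [e], ?_, by simp⟩
  intro i hi x hx
  rw [List.length_append, List.length_singleton] at hi
  rcases Nat.lt_succ_iff_lt_or_eq.1 hi with h3 | rfl
  · rw [List.getElem?_append_left h3] at hx
    rw [List.take_append_of_le_length h3.le]
    exact h1 i h3 x hx
  · simp only [List.getElem?_concat_length, Option.some.injEq] at hx
    subst hx
    rw [List.take_append_of_le_length le_rfl, List.take_length]
    exact hJ _ _ _ h2 h

end Derivations

/-! ## Oracle computations as derivations -/

/-- The rules deriving the numbers of oracle programs. -/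
def CodeRule (L : List ℕ) (m : ℕ) : Prop :=
  (∃ k, k < 5 ∧ m = Nat.pair k 0) ∨
  (∃ q, q ∈ L ∧ ∃ r, r ∈ L ∧ ∃ k, k < 8 ∧ 5 ≤ k ∧ m = Nat.pair k (Nat.pair q r)) ∨
  (∃ q, q ∈ L ∧ m = Nat.pair 8 q)

theorem codeRule_mono (L L' : List ℕ) (m : ℕ) (h : L ⊆ L') (hm : CodeRule L m) :
    CodeRule L' m := by
  rcases hm with hm | ⟨q, hq, r, hr, hm⟩ | ⟨q, hq, hm⟩
  · exact .inl hm
  · exact .inr (.inl ⟨q, h hq, r, h hr, hm⟩)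
  · exact .inr (.inr ⟨q, h hq, hm⟩)

theorem drv_codeRule (m : ℕ) : Drv CodeRule m ↔ ∃ c : OracleCode, c.number = m := by
  constructor
  · intro h
    refine h.induction (P := fun m => ∃ c : OracleCode, c.number = m) fun L e he ih => ?_
    rcases he with ⟨k, hk, rfl⟩ | ⟨q, hq, r, hr, k, hk, hk', rfl⟩ | ⟨q, hq, rfl⟩
    · interval_cases k
      exacts [⟨.zero, rfl⟩, ⟨.succ, rfl⟩, ⟨.left, rfl⟩, ⟨.right, rfl⟩, ⟨.oracle, rfl⟩]
    · obtain ⟨c, rfl⟩ := ih q hq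
      obtain ⟨d, rfl⟩ := ih r hr
      interval_cases k
      exacts [⟨.pair c d, rfl⟩, ⟨.comp c d, rfl⟩, ⟨.prec c d, rfl⟩]
    · obtain ⟨c, rfl⟩ := ih q hq
      exact ⟨.rfind c, rfl⟩
  · rintro ⟨c, rfl⟩
    have h0 : ∀ k, k < 5 → Drv CodeRule (Nat.pair k 0) := fun k hk =>
      Drv.intro codeRule_mono (L := []) (.inl ⟨k, hk, rfl⟩) (by simp)
    have h2 : ∀ k c d, k < 8 → 5 ≤ k → Drv CodeRule c → Drv CodeRule d →
        Drv CodeRule (Nat.pair k (Nat.pair c d)) := fun k c d hk hk' hc hd =>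
      Drv.intro codeRule_mono (L := [c, d])
        (.inr (.inl ⟨c, by simp, d, by simp, k, hk, hk', rfl⟩)) (by simp [hc, hd])
    induction c with
    | zero => exact h0 0 (by omega)
    | succ => exact h0 1 (by omega)
    | left => exact h0 2 (by omega)
    | right => exact h0 3 (by omega)
    | oracle => exact h0 4 (by omega)
    | pair c d hc hd => exact h2 5 _ _ (by omega) (by omega) hc hd
    | comp c d hc hd => exact h2 6 _ _ (by omega) (by omega) hc hd
    | prec c d hc hd => exact h2 7 _ _ (by omega) (by omega) hc hd
    | rfind c hc =>
      exact Drv.intro codeRule_mono (L := [c.number]) (.inr (.inr ⟨_, by simp, rfl⟩)) (by simp [hc])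

/-- The evaluation rules: an entry `(c, a, b)` says that program number `c` gives `b` on `a`. -/
def EvalRule (O : ℕ → ℕ → Prop) (L : List (ℕ × ℕ × ℕ)) (e : ℕ × ℕ × ℕ) : Prop :=
  (e.1 = Nat.pair 0 0 ∧ e.2.2 = 0) ∨
  (e.1 = Nat.pair 1 0 ∧ e.2.2 = e.2.1 + 1) ∨
  (e.1 = Nat.pair 2 0 ∧ e.2.2 = e.2.1.unpair.1) ∨
  (e.1 = Nat.pair 3 0 ∧ e.2.2 = e.2.1.unpair.2) ∨
  (e.1 = Nat.pair 4 0 ∧ O e.2.1 e.2.2) ∨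
  (∃ q, q ∈ L ∧ ∃ r, r ∈ L ∧ q.2.1 = e.2.1 ∧ r.2.1 = e.2.1 ∧
    e.1 = Nat.pair 5 (Nat.pair q.1 r.1) ∧ e.2.2 = Nat.pair q.2.2 r.2.2) ∨
  (∃ q, q ∈ L ∧ ∃ r, r ∈ L ∧ r.2.1 = e.2.1 ∧ q.2.1 = r.2.2 ∧
    e.1 = Nat.pair 6 (Nat.pair q.1 r.1) ∧ e.2.2 = q.2.2) ∨
  (∃ q, q ∈ L ∧ e.2.1.unpair.2 = 0 ∧ q.2.1 = e.2.1.unpair.1 ∧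
    e.1 = Nat.pair 7 (Nat.pair q.1 e.1.unpair.2.unpair.2) ∧ e.2.2 = q.2.2) ∨
  (∃ q, q ∈ L ∧ ∃ r, r ∈ L ∧ e.1 = q.1 ∧ q.2.1.unpair.1 = e.2.1.unpair.1 ∧
    e.2.1.unpair.2 = q.2.1.unpair.2 + 1 ∧
    r.2.1 = Nat.pair e.2.1.unpair.1 (Nat.pair q.2.1.unpair.2 q.2.2) ∧
    e.1 = Nat.pair 7 (Nat.pair e.1.unpair.2.unpair.1 r.1) ∧ e.2.2 = r.2.2) ∨
  (∃ q, q ∈ L ∧ e.1 = Nat.pair 8 q.1 ∧ q.2.1 = Nat.pair e.2.1 e.2.2 ∧ q.2.2 = 0 ∧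
    ∀ m, m < e.2.2 → ∃ r, r ∈ L ∧ r.1 = q.1 ∧ r.2.1 = Nat.pair e.2.1 m ∧ ¬ r.2.2 = 0)

theorem evalRule_mono' {O O' : ℕ → ℕ → Prop} {L L' : List (ℕ × ℕ × ℕ)} {e : ℕ × ℕ × ℕ}
    (h : L ⊆ L') (hO : O e.2.1 e.2.2 → O' e.2.1 e.2.2) (he : EvalRule O L e) :
    EvalRule O' L' e := by
  rcases he with he | he | he | he | he | ⟨q, hq, r, hr, he⟩ | ⟨q, hq, r, hr, he⟩ | ⟨q, hq, he⟩ |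
    ⟨q, hq, r, hr, he⟩ | ⟨q, hq, h1, h2, h3, h4⟩
  · exact .inl he
  · exact .inr (.inl he)
  · exact .inr (.inr (.inl he))
  · exact .inr (.inr (.inr (.inl he)))
  · exact .inr (.inr (.inr (.inr (.inl ⟨he.1, hO he.2⟩))))
  · exact .inr (.inr (.inr (.inr (.inr (.inl ⟨q, h hq, r, h hr, he⟩)))))
  · exact .inr (.inr (.inr (.inr (.inr (.inr (.inl ⟨q, h hq, r, h hr, he⟩))))))
  · exact .inr (.inr (.inr (.inr (.inr (.inr (.inr (.inl ⟨q, h hq, he⟩)))))))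
  · exact .inr (.inr (.inr (.inr (.inr (.inr (.inr (.inr (.inl ⟨q, h hq, r, h hr, he⟩))))))))
  · refine .inr (.inr (.inr (.inr (.inr (.inr (.inr (.inr (.inr ⟨q, h hq, h1, h2, h3, ?_⟩))))))))
    intro m hm
    obtain ⟨r, hr, h5⟩ := h4 m hm
    exact ⟨r, h hr, h5⟩

theorem evalRule_mono (O : ℕ → ℕ → Prop) (L L' : List (ℕ × ℕ × ℕ)) (e : ℕ × ℕ × ℕ)
    (h : L ⊆ L') (he : EvalRule O L e) : EvalRule O L' e := evalRule_mono' h id he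

/-- Program number `c` with the oracle (graph) `O` gives `b` on input `a`. -/
def Der (O : ℕ → ℕ → Prop) (c a b : ℕ) : Prop := Drv (EvalRule O) (c, a, b)

theorem Der.mono {O O' : ℕ → ℕ → Prop} {c a b : ℕ} (h : Der O c a b)
    (hO : ∀ a b, O a b → O' a b) : Der O' c a b := by
  obtain ⟨L, hL, he⟩ := h
  exact ⟨L, fun i hi e he => evalRule_mono' (List.Subset.refl _) (hO _ _) (hL i hi e he), he⟩

/-- A derivation uses only finitely much of the oracle. -/
theorem Der.finite {O : ℕ → ℕ → Prop} {c a b : ℕ} (h : Der O c a b) :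
    ∃ M : List (ℕ × ℕ), (∀ p ∈ M, O p.1 p.2) ∧ Der (fun x y => (x, y) ∈ M) c a b := by
  classical
  obtain ⟨L, hL, he⟩ := h
  refine ⟨(L.map fun e => e.2).filter fun p => O p.1 p.2, fun p hp => ?_, L, ?_, he⟩
  · simpa using (List.mem_filter.1 hp).2
  · intro i hi e he
    refine evalRule_mono' (List.Subset.refl _) (fun h => ?_) (hL i hi e he)
    refine List.mem_filter.2 ⟨List.mem_map.2 ⟨e, List.mem_of_getElem? he, rfl⟩, by simpa using h⟩

theorem Der.sound {O : ℕ → ℕ → Prop} {g : ℕ →. ℕ} (hO : ∀ a b, O a b → b ∈ g a)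
    {Ξ : OracleCode} {a b : ℕ} (h : Der O Ξ.number a b) : b ∈ Ξ.eval g a := by
  suffices ∀ e, Drv (EvalRule O) e → ∀ Ξ : OracleCode, Ξ.number = e.1 → e.2.2 ∈ Ξ.eval g e.2.1 from
    this _ h _ rfl
  intro e he
  refine he.induction (P := fun e => ∀ Ξ : OracleCode, Ξ.number = e.1 → e.2.2 ∈ Ξ.eval g e.2.1)
    fun L e he ih => ?_
  obtain ⟨c, a, b⟩ := e
  intro Ξ hΞ
  simp only at hΞ
  subst hΞ
  rcases he with he | he | he | he | he | ⟨q, hq, r, hr, he⟩ | ⟨q, hq, r, hr, he⟩ | ⟨q, hq, he⟩ |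
    ⟨q, hq, r, hr, he⟩ | ⟨q, hq, he⟩ <;> cases Ξ <;>
    simp only [OracleCode.number, Nat.pair_eq_pair, Nat.reduceEqDiff, false_and, and_false,
      true_and, and_true, Nat.unpair_pair, OfNat.ofNat_ne_zero, OfNat.ofNat_ne_one,
      OfNat.zero_ne_ofNat, OfNat.one_ne_ofNat, zero_ne_one, one_ne_zero] at he
  · subst he; exact Part.mem_some _
  · subst he; exact Part.mem_some _
  · subst he; exact Part.mem_some _
  · subst he; exact Part.mem_some _
  · exact hO _ _ he
  · obtain ⟨h1, h2, ⟨h3, h4⟩, h5⟩ := he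
    have h6 := ih q hq _ h3
    have h7 := ih r hr _ h4
    rw [h1] at h6
    rw [h2] at h7
    subst h5
    simp only [OracleCode.eval, Seq.seq, Part.mem_bind_iff, Part.map_eq_map, Part.mem_map_iff]
    exact ⟨_, ⟨_, h6, rfl⟩, _, h7, rfl⟩
  · obtain ⟨h1, h2, ⟨h3, h4⟩, h5⟩ := he
    have h6 := ih q hq _ h3
    have h7 := ih r hr _ h4
    rw [h2] at h6
    rw [h1] at h7
    subst h5
    exact Part.mem_bind_iff.2 ⟨_, h7, h6⟩
  · obtain ⟨h1, h2, h3, h5⟩ := he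
    have h6 := ih q hq _ h3
    subst h5
    simp only [OracleCode.eval, h1]
    rwa [h2] at h6
  · rename_i c d
    obtain ⟨h0, h1, h2, h3, h4, h5⟩ := he
    have h6 := ih q hq (.prec c d) h0
    have h7 := ih r hr _ h4
    subst h5
    simp only [OracleCode.eval, h2] at h6 ⊢
    rw [h1] at h6
    simp only [Part.bind_eq_bind, Part.mem_bind_iff]
    exact ⟨_, h6, by rwa [h3] at h7⟩
  · obtain ⟨h1, h2, h3, h4⟩ := he
    have h5 := ih q hq _ h1
    refine Nat.mem_rfind.2 ⟨?_, ?_⟩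
    · rw [h2] at h5
      exact (Part.mem_map_iff _).2 ⟨_, h5, by simpa using h3⟩
    · intro m hm
      obtain ⟨r, hr, h6, h7, h8⟩ := h4 m hm
      have h9 := ih r hr _ (h1.trans h6.symm)
      rw [h7] at h9
      exact (Part.mem_map_iff _).2 ⟨_, h9, by simpa using h8⟩

theorem Der.complete {g : ℕ →. ℕ} {Ξ : OracleCode} {a b : ℕ} (h : b ∈ Ξ.eval g a) :
    Der (fun x y => y ∈ g x) Ξ.number a b := by
  have H := @Drv.intro _ _ (evalRule_mono (fun x y => y ∈ g x))
  induction Ξ generalizing a b with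
  | zero =>
    refine H (L := []) (.inl ⟨rfl, ?_⟩) (by simp)
    exact (Part.mem_some_iff.1 h)
  | succ =>
    refine H (L := []) (.inr (.inl ⟨rfl, ?_⟩)) (by simp)
    exact (Part.mem_some_iff.1 h)
  | left =>
    refine H (L := []) (.inr (.inr (.inl ⟨rfl, ?_⟩))) (by simp)
    exact (Part.mem_some_iff.1 h)
  | right =>
    refine H (L := []) (.inr (.inr (.inr (.inl ⟨rfl, ?_⟩)))) (by simp)
    exact (Part.mem_some_iff.1 h)
  | oracle => exact H (L := []) (.inr (.inr (.inr (.inr (.inl ⟨rfl, h⟩))))) (by simp)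
  | pair c d hc hd =>
    simp only [OracleCode.eval, Seq.seq, Part.mem_bind_iff, Part.map_eq_map,
      Part.mem_map_iff] at h
    obtain ⟨_, ⟨x, hx, rfl⟩, y, hy, rfl⟩ := h
    refine H (L := [(c.number, a, x), (d.number, a, y)])
      (.inr (.inr (.inr (.inr (.inr (.inl ⟨_, List.mem_cons_self, _, List.mem_cons_of_mem _
        List.mem_cons_self, rfl, rfl, rfl, rfl⟩)))))) ?_
    intro q hq
    rcases List.mem_pair.1 hq with rfl | rfl
    exacts [hc hx, hd hy]
  | comp c d hc hd =>
    obtain ⟨x, hx, hy⟩ := Part.mem_bind_iff.1 h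
    refine H (L := [(c.number, x, b), (d.number, a, x)])
      (.inr (.inr (.inr (.inr (.inr (.inr (.inl ⟨_, List.mem_cons_self, _, List.mem_cons_of_mem _
        List.mem_cons_self, rfl, rfl, rfl, rfl⟩))))))) ?_
    intro q hq
    rcases List.mem_pair.1 hq with rfl | rfl
    exacts [hc hy, hd hx]
  | prec c d hc hd =>
    obtain ⟨a', n, rfl⟩ : ∃ a' n, a = Nat.pair a' n := ⟨_, _, (Nat.pair_unpair a).symm⟩
    induction n generalizing b with
    | zero =>
      simp only [OracleCode.eval, Nat.unpair_pair] at h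
      refine H (L := [(c.number, a', b)]) (.inr (.inr (.inr (.inr (.inr (.inr (.inr
        (.inl ⟨_, List.mem_cons_self, by simp, by simp, by simp [OracleCode.number],
        rfl⟩)))))))) ?_
      intro q hq
      rcases List.mem_singleton.1 hq with rfl
      exact hc h
    | succ n ih =>
      simp only [OracleCode.eval, Nat.unpair_pair, Part.bind_eq_bind, Part.mem_bind_iff] at h
      obtain ⟨i, hi, h⟩ := h
      have h1 := ih (b := i) (by simpa only [OracleCode.eval, Nat.unpair_pair, Part.bind_eq_bind] using hi)
      refine H (L := [((OracleCode.prec c d).number, Nat.pair a' n, i),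
        (d.number, Nat.pair a' (Nat.pair n i), b)]) (.inr (.inr (.inr (.inr (.inr (.inr (.inr
        (.inr (.inl ⟨_, List.mem_cons_self, _, List.mem_cons_of_mem _
        List.mem_cons_self, rfl, by simp, by simp, by simp, by simp [OracleCode.number],
        rfl⟩))))))))) ?_
      intro q hq
      rcases List.mem_pair.1 hq with rfl | rfl
      exacts [h1, hd h]
  | rfind c hc =>
    obtain ⟨h0, h⟩ := Nat.mem_rfind.1 h
    obtain ⟨z, hz, hz'⟩ := (Part.mem_map_iff _).1 h0
    replace hz' : z = 0 := by simpa using hz'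
    subst hz'
    replace h : ∀ {m : ℕ}, m < b → ∃ y, y ∈ c.eval g (Nat.pair a m) ∧ decide (y = 0) = false :=
      fun hm => (Part.mem_map_iff _).1 (h hm)
    choose! y hy hy' using fun m (hm : m < b) => h hm
    refine H (L := (c.number, Nat.pair a b, 0) ::
      (List.range b).map fun m => (c.number, Nat.pair a m, y m))
      (.inr (.inr (.inr (.inr (.inr (.inr (.inr (.inr (.inr
        ⟨_, List.mem_cons_self, rfl, rfl, rfl, fun m hm => ⟨(c.number, Nat.pair a m, y m),
        List.mem_cons_of_mem _ (List.mem_map.2 ⟨m, List.mem_range.2 hm, rfl⟩), rfl, rfl,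
        by simpa using hy' m hm⟩⟩))))))))) ?_
    intro q hq
    rcases List.mem_cons.1 hq with rfl | hq
    · exact hc hz
    · obtain ⟨m, hm, rfl⟩ := List.mem_map.1 hq
      exact hc (hy m (List.mem_range.1 hm))

/-! ### The complexity of derivability. -/

section

variable {α : Type} [Primcodable α]

/-- A derivation is a finite list checked by bounded quantifiers, so a `Σ⁰₂` oracle graph keeps the
whole at `Σ⁰₂`. -/
theorem sig2_der_aux {Q : α × ℕ × ℕ → Prop} (hQ : Sig2 Q) {c m n : α → ℕ} (hc : Computable c)
    (hm : Computable m) (hn : Computable n) :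
    Sig2 fun a => Der (fun x y => Q (a, x, y)) (c a) (m a) (n a) := by
  unfold Der Drv Deriv
  refine Sig2.exists (Sig2.and (Sig2.forall_lt (by fun_prop) ?_) (by fun_prop))
  -- The disjunct for an index out of range turns the quantifier over the entry at that index into
  -- an existential one.
  refine Sig2.of_eq (P := fun x : (α × List (ℕ × ℕ × ℕ)) × ℕ =>
    ∃ e, x.1.2.length ≤ x.2 ∨ x.1.2[x.2]? = some e ∧
      EvalRule (fun y z => Q (x.1.1, y, z)) (x.1.2.take x.2) e) ?_ ?_
  · unfold EvalRule
    beta_reduce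
    fun_prop
  · intro x
    constructor
    · rintro ⟨e, h⟩ e' h'
      rcases h with h | ⟨h, h2⟩
      · rw [List.getElem?_eq_none h] at h'; cases h'
      · rw [h] at h'; cases h'; exact h2
    · intro h
      rcases Nat.lt_or_ge x.2 x.1.2.length with h1 | h1
      · exact ⟨_, .inr ⟨List.getElem?_eq_getElem h1, h _ (List.getElem?_eq_getElem h1)⟩⟩
      · exact ⟨(0, 0, 0), .inl h1⟩

@[fun_prop] theorem sig2_der {O : α → ℕ → ℕ → Prop}
    (hO : Sig2 fun x : α × ℕ × ℕ => O x.1 x.2.1 x.2.2) {c m n : α → ℕ} (hc : Computable c)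
    (hm : Computable m) (hn : Computable n) : Sig2 fun a => Der (O a) (c a) (m a) (n a) :=
  sig2_der_aux hO hc hm hn

theorem sig1_der {O : ℕ → ℕ → Prop}
    (hO : ComputablePred fun x : ℕ × ℕ => O x.1 x.2) {c m n : α → ℕ} (hc : Computable c)
    (hm : Computable m) (hn : Computable n) : Sig1 fun a => Der O (c a) (m a) (n a) := by
  unfold Der Drv Deriv EvalRule
  refine Sig1.exists (ComputablePred.sig1 (computablePred_and (computablePred_forall_lt
    (by fun_prop) (computablePred_forall_option (by fun_prop) ?_)) (by fun_prop)))
  fun_prop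

theorem sig1_isCode : Sig1 fun m => ∃ c : OracleCode, c.number = m := by
  refine Sig1.of_eq (P := Drv CodeRule) ?_ drv_codeRule
  unfold Drv Deriv CodeRule
  refine Sig1.exists (ComputablePred.sig1 (computablePred_and (computablePred_forall_lt
    (by fun_prop) (computablePred_forall_option (by fun_prop) ?_)) (by fun_prop)))
  fun_prop

end

end CatDeg


namespace CatDeg

open Nat.Partrec (Code)

/-! ## Turing reductions -/

theorem mem_coe_iff {f : ℕ → ℕ} {x y : ℕ} : y ∈ (f : ℕ →. ℕ) x ↔ y = f x := Part.mem_some_iff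

section Turing

theorem degFun_le_iff {f g : ℕ → ℕ} :
    degFun f ≤ degFun g ↔ TuringReducible (f : ℕ →. ℕ) (g : ℕ →. ℕ) := Iff.rfl

theorem turingReducible_iff {f g : ℕ →. ℕ} :
    TuringReducible f g ↔ ∃ Ξ : OracleCode, Ξ.eval g = f := by
  rw [← OracleCode.recursiveIn_iff_exists_code]
  exact RecursiveIn.iff_nat

theorem recIn_of_computable {f : ℕ → ℕ} (hf : Computable f) (O : Set (ℕ →. ℕ)) :
    Nat.RecursiveIn O (f : ℕ →. ℕ) := Nat.Partrec.recursiveIn (Partrec.nat_iff.1 hf)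

theorem recIn_comp {O : Set (ℕ →. ℕ)} {f g : ℕ → ℕ} (hf : Nat.RecursiveIn O (f : ℕ →. ℕ))
    (hg : Nat.RecursiveIn O (g : ℕ →. ℕ)) :
    Nat.RecursiveIn O ((fun n => f (g n) : ℕ → ℕ) : ℕ →. ℕ) :=
  (Nat.RecursiveIn.comp hf hg).of_eq fun n => Part.bind_some (g n) (f : ℕ →. ℕ)

theorem recIn_pair {O : Set (ℕ →. ℕ)} {f g : ℕ → ℕ} (hf : Nat.RecursiveIn O (f : ℕ →. ℕ))
    (hg : Nat.RecursiveIn O (g : ℕ →. ℕ)) :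
    Nat.RecursiveIn O ((fun n => Nat.pair (f n) (g n) : ℕ → ℕ) : ℕ →. ℕ) :=
  (Nat.RecursiveIn.pair hf hg).of_eq fun n => by simp [Seq.seq]

/-- A total function found by an unbounded search with an oracle is reducible to the oracle. -/
theorem turingReducible_of_search {g h : ℕ → ℕ} {R : ℕ → ℕ → ℕ → Prop} {q out : ℕ → ℕ → ℕ}
    (hR : ComputablePred fun x : ℕ × ℕ × ℕ => R x.1 x.2.1 x.2.2)
    (hq : Computable fun x : ℕ × ℕ => q x.1 x.2) (hout : Computable fun x : ℕ × ℕ => out x.1 x.2)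
    (hex : ∀ a, ∃ u, R a u (g (q a u))) (hval : ∀ a u, R a u (g (q a u)) → h a = out a u) :
    TuringReducible (h : ℕ →. ℕ) (g : ℕ →. ℕ) := by
  classical
  rw [TuringReducible, RecursiveIn.iff_nat]
  set O : Set (ℕ →. ℕ) := {(g : ℕ →. ℕ)}
  have h1 : Nat.RecursiveIn O ((fun n => g (q n.unpair.1 n.unpair.2) : ℕ → ℕ) : ℕ →. ℕ) :=
    recIn_comp (f := g) (.oracle _ rfl) (recIn_of_computable
      (hq.comp (g := fun n : ℕ => (n.unpair.1, n.unpair.2)) (by fun_prop)) O)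
  have h2 := recIn_pair (recIn_of_computable (f := fun n => n) (by fun_prop) O) h1
  have h3 : Computable fun n : ℕ =>
      if R n.unpair.1.unpair.1 n.unpair.1.unpair.2 n.unpair.2 then 0 else 1 :=
    computable_ite (computablePred_comp hR
      (f := fun n : ℕ => (n.unpair.1.unpair.1, n.unpair.1.unpair.2, n.unpair.2)) (by fun_prop))
      (by fun_prop) (by fun_prop)
  have h4 := recIn_comp (recIn_of_computable h3 O) h2
  simp only [Nat.unpair_pair] at h4
  have h5 := Nat.RecursiveIn.rfind h4
  choose u hu hmin using fun a => (⟨Nat.find (hex a), Nat.find_spec (hex a),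
    fun m hm => Nat.find_min (hex a) hm⟩ :
    ∃ u, R a u (g (q a u)) ∧ ∀ m, m < u → ¬ R a m (g (q a m)))
  have h6 : Nat.RecursiveIn O (u : ℕ →. ℕ) := by
    refine h5.of_eq_tot fun a => ?_
    refine Nat.mem_rfind.2 ⟨?_, fun {m} hm => ?_⟩
    · refine (Part.mem_map_iff _).2 ⟨_, Part.mem_some _, ?_⟩
      simp [hu]
    · refine (Part.mem_map_iff _).2 ⟨_, Part.mem_some _, ?_⟩
      simp [hmin a m hm]
  have h7 := recIn_comp (recIn_of_computable (f := fun n => out n.unpair.1 n.unpair.2)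
    (hout.comp (g := fun n : ℕ => (n.unpair.1, n.unpair.2)) (by fun_prop)) O)
    (recIn_pair (recIn_of_computable (f := fun n => n) (by fun_prop) O) h6)
  refine h7.of_eq fun a => ?_
  simp only [Nat.unpair_pair]
  exact congrArg Part.some (hval a _ (hu a)).symm

theorem turingReducible_of_computable {g h : ℕ → ℕ} {q : ℕ → ℕ} (hq : Computable q)
    (hval : ∀ a, h a = g (q a)) : TuringReducible (h : ℕ →. ℕ) (g : ℕ →. ℕ) := by
  rw [TuringReducible, RecursiveIn.iff_nat]
  refine (recIn_comp (f := g) (.oracle (O := {(g : ℕ →. ℕ)}) _ rfl)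
    (recIn_of_computable hq _)).of_eq fun a => ?_
  exact congrArg Part.some (hval a).symm

/-! ## The jump -/

/-- A program computing a constant function. -/
def constCode : ℕ → OracleCode
  | 0 => .zero
  | n + 1 => .comp .succ (constCode n)

theorem eval_constCode (g : ℕ →. ℕ) (n a : ℕ) : (constCode n).eval g a = Part.some n := by
  induction n with
  | zero => rfl
  | succ n ih => exact (congrArg (· >>= _) ih).trans (Part.bind_some n _)

theorem computable_number_constCode : Computable fun n => (constCode n).number := by
  have := Computable.nat_rec (f := fun t : ℕ => t) (g := fun _ => Nat.pair 0 0)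
    (h := fun _ (p : ℕ × ℕ) => Nat.pair 6 (Nat.pair (Nat.pair 1 0) p.2)) Computable.id
    (by fun_prop) (Computable.to₂
      (f := fun x : ℕ × ℕ × ℕ => Nat.pair 6 (Nat.pair (Nat.pair 1 0) x.2.2)) (by fun_prop))
  refine this.of_eq fun t => ?_
  induction t with
  | zero => rfl
  | succ t ih => simp only [constCode, OracleCode.number, ← ih]

/-- Precomposing with a constant program makes the behaviour on one's own number agree with the
behaviour on `x`, which removes the diagonal from the jump. -/
theorem exists_reduction_dom (X : Set ℕ) (Ξ : OracleCode) :
    ∃ q : ℕ → ℕ, Computable q ∧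
      ∀ x, (Ξ.eval (charFun X : ℕ →. ℕ) x).Dom ↔ q x ∈ jump X := by
  refine ⟨fun x => (OracleCode.comp Ξ (constCode x)).number, ?_, fun x => ?_⟩
  · have := computable_number_constCode
    simp only [OracleCode.number]
    fun_prop
  · have key : (OracleCode.comp Ξ (constCode x)).eval (charFun X : ℕ →. ℕ)
        (OracleCode.comp Ξ (constCode x)).number = Ξ.eval (charFun X : ℕ →. ℕ) x := by
      exact (congrArg (· >>= _) (eval_constCode _ x _)).trans (Part.bind_some x _)
    constructor
    · intro h
      exact ⟨_, rfl, by rwa [key]⟩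
    · rintro ⟨c, hc, h⟩
      rw [OracleCode.number_injective hc] at h
      rwa [key] at h

theorem exists_reduction_of_turing {X : Set ℕ} {f : ℕ →. ℕ}
    (hf : Nat.RecursiveIn {(charFun X : ℕ →. ℕ)} f) :
    ∃ q : ℕ → ℕ, Computable q ∧ ∀ x, (f x).Dom ↔ q x ∈ jump X := by
  obtain ⟨Ξ, rfl⟩ := (OracleCode.recursiveIn_iff_exists_code _ _).1 hf
  exact exists_reduction_dom X Ξ

theorem Sig1.reduction {P : ℕ → Prop} (h : Sig1 P) :
    ∃ q : ℕ → ℕ, Computable q ∧ ∀ x, P x ↔ q x ∈ jump ∅ := by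
  classical
  obtain ⟨R, hR, e⟩ := h
  have hf : Partrec fun x : ℕ => Nat.rfind fun u => Part.some (decide (R x u)) :=
    Partrec.rfind (hR.decide).partrec
  obtain ⟨q, hq, hqe⟩ := exists_reduction_of_turing (X := ∅)
    (Nat.Partrec.recursiveIn (Partrec.nat_iff.1 hf))
  refine ⟨q, hq, fun x => ?_⟩
  rw [e, ← hqe]
  refine Iff.trans ?_ (Nat.rfind_dom (p := fun u => Part.some (decide (R x u)))).symm
  simp

/-- The outer existential is an unbounded search, and each test in it is one question to `0'`. -/
theorem Sig2.reduction {P : ℕ → Prop} (h : Sig2 P) :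
    ∃ q : ℕ → ℕ, Computable q ∧ ∀ x, P x ↔ q x ∈ jump (jump ∅) := by
  obtain ⟨R, hR, e⟩ := h
  have h1 : Sig1 fun n : ℕ => ∃ v, ¬ R n.unpair.1 n.unpair.2 v :=
    ⟨fun n v => ¬ R n.unpair.1 n.unpair.2 v, computablePred_not (computablePred_comp hR
      (f := fun x : ℕ × ℕ => (x.1.unpair.1, x.1.unpair.2, x.2)) (by fun_prop)), fun _ => Iff.rfl⟩
  obtain ⟨q, hq, hqe⟩ := h1.reduction
  have h2 : Nat.RecursiveIn {(charFun (jump ∅) : ℕ →. ℕ)}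
      ((fun n => charFun (jump ∅) (q n) : ℕ → ℕ) : ℕ →. ℕ) :=
    recIn_comp (f := charFun (jump ∅)) (.oracle _ rfl) (recIn_of_computable hq _)
  have h3 := Nat.RecursiveIn.rfind h2
  obtain ⟨q', hq', hqe'⟩ := exists_reduction_of_turing h3
  refine ⟨q', hq', fun x => ?_⟩
  rw [e, ← hqe']
  have h4 : ∀ u, (∀ v, R x u v) ↔ charFun (jump ∅) (q (Nat.pair x u)) = 0 := by
    intro u
    have := hqe (Nat.pair x u)
    simp only [Nat.unpair_pair] at this
    rw [charFun]
    split_ifs with h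
    · simpa using this.2 h
    · simpa using fun v => not_not.1 fun hv => h (this.1 ⟨v, hv⟩)
  refine Iff.trans ?_ (Nat.rfind_dom
    (p := fun n => (fun m => decide (m = 0)) <$> ((fun n => charFun (jump ∅) (q n) : ℕ → ℕ) :
      ℕ →. ℕ) (Nat.pair x n))).symm
  simp [h4]

/-- A total function found by searching with a `Π⁰₂` test is reducible to `0''`. -/
theorem turingReducible_jump_jump {f : ℕ → ℕ} {W : ℕ → ℕ → Prop} {out : ℕ → ℕ → ℕ}
    (hW : Sig2 fun x : ℕ × ℕ => ¬ W x.1 x.2) (hout : Computable fun x : ℕ × ℕ => out x.1 x.2)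
    (hex : ∀ a, ∃ u, W a u) (hval : ∀ a u, W a u → f a = out a u) :
    TuringReducible (f : ℕ →. ℕ) (charFun (jump (jump ∅)) : ℕ →. ℕ) := by
  have h1 : Sig2 fun n : ℕ => ¬ W n.unpair.1 n.unpair.2 :=
    hW.comp (f := fun n : ℕ => (n.unpair.1, n.unpair.2)) (by fun_prop)
  obtain ⟨q, hq, hqe⟩ := h1.reduction
  have h2 : ∀ a u, W a u ↔ charFun (jump (jump ∅)) (q (Nat.pair a u)) = 0 := by
    intro a u
    have := hqe (Nat.pair a u)
    simp only [Nat.unpair_pair] at this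
    rw [charFun]
    split_ifs with h
    · simpa using this.2 h
    · simpa using not_not.1 fun hv => h (this.1 hv)
  refine turingReducible_of_search (R := fun _ _ y => y = 0) (q := fun a u => q (Nat.pair a u))
    (out := out) (by fun_prop) (by fun_prop) hout (fun a => ?_) (fun a u hu => ?_)
  · obtain ⟨u, hu⟩ := hex a
    exact ⟨u, (h2 a u).1 hu⟩
  · exact hval a u ((h2 a u).2 hu)

end Turing

/-! ## The oracles extending `0'` -/

section Oracles

variable {α : Type} [Primcodable α]

theorem Sig1.and {P Q : α → Prop} (hP : Sig1 P) (hQ : Sig1 Q) : Sig1 fun a => P a ∧ Q a := by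
  obtain ⟨R, hR, e⟩ := hP
  obtain ⟨S, hS, e'⟩ := hQ
  refine ⟨fun a u => R a u.unpair.1 ∧ S a u.unpair.2, computablePred_and
    (computablePred_comp hR (f := fun x : α × ℕ => (x.1, x.2.unpair.1)) (by fun_prop))
    (computablePred_comp hS (f := fun x : α × ℕ => (x.1, x.2.unpair.2)) (by fun_prop)),
    fun x => ?_⟩
  refine (and_congr (e x) (e' x)).trans ?_
  constructor
  · rintro ⟨⟨u, hu⟩, w, hw⟩
    exact ⟨Nat.pair u w, by simp [hu, hw]⟩
  · rintro ⟨u, hu⟩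
    exact ⟨⟨_, hu.1⟩, _, hu.2⟩

theorem sig1_jump : Sig1 fun n => n ∈ jump ∅ := by
  refine Sig1.of_eq (P := fun n => (∃ c : OracleCode, c.number = n) ∧
    ∃ b, Der (fun _ b => b = 0) n n b) (sig1_isCode.and (Sig1.exists
    (sig1_der (by fun_prop) (by fun_prop) (by fun_prop) (by fun_prop)))) fun n => ?_
  have h0 : ∀ a b : ℕ, b ∈ (charFun ∅ : ℕ →. ℕ) a ↔ b = 0 := by simp [charFun]
  constructor
  · rintro ⟨⟨c, rfl⟩, b, h⟩
    exact ⟨c, rfl, Part.dom_iff_mem.2 ⟨b, h.sound fun a b hb => (h0 a b).2 hb⟩⟩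
  · rintro ⟨c, rfl, h⟩
    obtain ⟨b, hb⟩ := Part.dom_iff_mem.1 h
    exact ⟨⟨c, rfl⟩, b, (Der.complete hb).mono fun a b => (h0 a b).1⟩

@[fun_prop] theorem sig2_jump {f : α → ℕ} (hf : Computable f) : Sig2 fun a => f a ∈ jump ∅ :=
  sig1_jump.sig2.comp hf

theorem sig2_not_jump {f : α → ℕ} (hf : Computable f) : Sig2 fun a => ¬ f a ∈ jump ∅ :=
  sig1_jump.not_sig2.comp hf

/-- The graph of the characteristic function of `0'`. -/
def JGraph (a b : ℕ) : Prop := (b = 1 ∧ a ∈ jump ∅) ∨ (b = 0 ∧ ¬ a ∈ jump ∅)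

theorem jGraph_iff {a b : ℕ} : JGraph a b ↔ b = charFun (jump ∅) a := by
  unfold JGraph charFun
  split_ifs with h <;> simp [h]

@[fun_prop] theorem sig2_jGraph {f g : α → ℕ} (hf : Computable f) (hg : Computable g) :
    Sig2 fun a => JGraph (f a) (g a) := by
  have h1 := sig2_jump hf
  have h2 := sig2_not_jump hf
  exact Sig2.or (Sig2.and (by fun_prop) h1) (Sig2.and (by fun_prop) h2)

/-- The join of `0'` with the set of the positions of odd entries of `G`. -/
def dset (G : ℕ → ℕ) : Set ℕ := {a | (a % 2 = 0 ∧ a / 2 ∈ jump ∅) ∨ (a % 2 = 1 ∧ G (a / 2) % 2 = 1)}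

theorem charFun_dset_even {G : ℕ → ℕ} {a : ℕ} (h : a % 2 = 0) :
    charFun (dset G) a = charFun (jump ∅) (a / 2) := by
  have : a ∈ dset G ↔ a / 2 ∈ jump ∅ := by
    show (a % 2 = 0 ∧ a / 2 ∈ jump ∅) ∨ (a % 2 = 1 ∧ G (a / 2) % 2 = 1) ↔ _
    exact ⟨fun h' => h'.elim And.right fun h' => absurd (h.symm.trans h'.1) (by omega),
      fun h' => .inl ⟨h, h'⟩⟩
  by_cases h' : a / 2 ∈ jump ∅
  · rw [charFun, charFun, if_pos (this.2 h'), if_pos h']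
  · rw [charFun, charFun, if_neg (mt this.1 h'), if_neg h']

theorem charFun_dset_odd {G : ℕ → ℕ} {a : ℕ} (h : a % 2 = 1) :
    charFun (dset G) a = G (a / 2) % 2 := by
  have : a ∈ dset G ↔ G (a / 2) % 2 = 1 := by
    show (a % 2 = 0 ∧ a / 2 ∈ jump ∅) ∨ (a % 2 = 1 ∧ G (a / 2) % 2 = 1) ↔ _
    omega
  by_cases h' : G (a / 2) % 2 = 1
  · rw [charFun, if_pos (this.2 h'), h']
  · rw [charFun, if_neg (mt this.1 h')]; omega

/-- The part of the graph of the characteristic function of `dset G` that is determined by an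
initial segment `τ` of `G`. -/
def Orc (τ : List ℕ) (a b : ℕ) : Prop :=
  (a % 2 = 0 ∧ JGraph (a / 2) b) ∨ (a % 2 = 1 ∧ a / 2 < τ.length ∧ b = τ.getD (a / 2) 0 % 2)

/-- `τ` is an initial segment of `G`. -/
def IsInit (τ : List ℕ) (G : ℕ → ℕ) : Prop := ∀ n, n < τ.length → τ.getD n 0 = G n

/-- Program number `c` gives `b` on input `a`, using `0'` and the string `τ` as oracle. -/
def Conv (τ : List ℕ) (c a b : ℕ) : Prop := Der (Orc τ) c a b

@[fun_prop] theorem sig2_conv {τ : α → List ℕ} {c m n : α → ℕ} (hτ : Computable τ)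
    (hc : Computable c) (hm : Computable m) (hn : Computable n) :
    Sig2 fun a => Conv (τ a) (c a) (m a) (n a) := by
  unfold Conv
  refine sig2_der ?_ hc hm hn
  unfold Orc
  fun_prop

theorem orc_mono {τ τ' : List ℕ} (h : τ <+: τ') {a b : ℕ} (ho : Orc τ a b) : Orc τ' a b := by
  rcases ho with ho | ⟨h1, h2, h3⟩
  · exact .inl ho
  · refine .inr ⟨h1, h2.trans_le h.length_le, ?_⟩
    obtain ⟨t, rfl⟩ := h
    rw [h3, List.getD_append _ _ _ _ h2]

theorem Conv.mono {τ τ' : List ℕ} (h : τ <+: τ') {c a b : ℕ} (hc : Conv τ c a b) :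
    Conv τ' c a b := Der.mono hc fun _ _ => orc_mono h

theorem orc_eq {τ : List ℕ} {G : ℕ → ℕ} (h : IsInit τ G) {a b : ℕ} (ho : Orc τ a b) :
    b = charFun (dset G) a := by
  rcases ho with ⟨h1, h2⟩ | ⟨h1, h2, h3⟩
  · rw [charFun_dset_even h1, jGraph_iff.1 h2]
  · rw [charFun_dset_odd h1, h3, h _ h2]

theorem isInit_map (G : ℕ → ℕ) (m : ℕ) : IsInit ((List.range m).map G) G := by
  intro n hn
  have hn' : n < m := by simpa using hn
  rw [List.getD_eq_getElem?_getD, List.getElem?_map, List.getElem?_range hn']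
  rfl

theorem isInit_getD (τ : List ℕ) : IsInit τ fun n => τ.getD n 0 := fun _ _ => rfl

theorem IsInit.of_prefix {τ τ' : List ℕ} {G : ℕ → ℕ} (h : IsInit τ' G) (hp : τ <+: τ') :
    IsInit τ G := by
  intro n hn
  obtain ⟨t, rfl⟩ := hp
  rw [← h n (by rw [List.length_append]; omega), List.getD_append _ _ _ _ hn]

theorem IsInit.prefix_of_le {τ τ' : List ℕ} {G : ℕ → ℕ} (h : IsInit τ G) (h' : IsInit τ' G)
    (hl : τ.length ≤ τ'.length) : τ <+: τ' := by
  rw [List.prefix_iff_eq_take]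
  apply List.ext_getElem
  · simp [hl]
  · intro i h1 h2
    have e1 := h i h1
    have e2 := h' i (by omega)
    rw [List.getD_eq_getElem _ _ h1] at e1
    rw [List.getD_eq_getElem _ _ (by omega)] at e2
    simp [e1, e2]

theorem conv_sound {τ : List ℕ} {G : ℕ → ℕ} (h : IsInit τ G) {Ξ : OracleCode} {a b : ℕ}
    (hc : Conv τ Ξ.number a b) : b ∈ Ξ.eval (charFun (dset G) : ℕ →. ℕ) a :=
  Der.sound (fun x y hxy => by simp [orc_eq h hxy]) hc

theorem Conv.unique {τ : List ℕ} {Ξ : OracleCode} {a b b' : ℕ} (h : Conv τ Ξ.number a b)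
    (h' : Conv τ Ξ.number a b') : b = b' :=
  Part.mem_unique (conv_sound (isInit_getD τ) h) (conv_sound (isInit_getD τ) h')

theorem orc_complete {τ : List ℕ} {G : ℕ → ℕ} (h : IsInit τ G) {a : ℕ} (ha : a < τ.length) :
    Orc τ a (charFun (dset G) a) := by
  rcases Nat.mod_two_eq_zero_or_one a with h1 | h1
  · exact .inl ⟨h1, jGraph_iff.2 (charFun_dset_even h1)⟩
  · exact .inr ⟨h1, by omega, by rw [charFun_dset_odd h1, h _ (by omega)]⟩

theorem exists_list_bound {β : Type} (f : β → ℕ) (M : List β) : ∃ m, ∀ p ∈ M, f p < m := by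
  induction M with
  | nil => exact ⟨0, by simp⟩
  | cons q M ih =>
    obtain ⟨m, hm⟩ := ih
    refine ⟨m + f q + 1, fun p hp => ?_⟩
    rcases List.mem_cons.1 hp with rfl | hp
    · omega
    · have := hm p hp; omega

/-- A computation asks finitely many questions, so every long enough initial segment already
supports it. -/
theorem conv_complete {G : ℕ → ℕ} {Ξ : OracleCode} {a b : ℕ}
    (h : b ∈ Ξ.eval (charFun (dset G) : ℕ →. ℕ) a) :
    ∃ m, ∀ τ, IsInit τ G → m ≤ τ.length → Conv τ Ξ.number a b := by
  obtain ⟨M, hM, hd⟩ := (Der.complete h).finite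
  obtain ⟨m, hm⟩ := exists_list_bound Prod.fst M
  refine ⟨m, fun τ hτ hl => hd.mono fun x y hxy => ?_⟩
  have h1 := hM _ hxy
  have h2 := hm _ hxy
  replace h1 := mem_coe_iff.1 h1
  simp only at h1
  subst h1
  exact orc_complete hτ (by simpa using h2.trans_le hl)

/-- A function reducible to `0'` has a `Σ⁰₂` graph. -/
theorem sig2_graph_of_turingReducible {f : ℕ → ℕ}
    (h : TuringReducible (f : ℕ →. ℕ) (charFun (jump ∅) : ℕ →. ℕ)) :
    Sig2 fun x : ℕ × ℕ => f x.1 = x.2 := by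
  obtain ⟨Ξ, hΞ⟩ := turingReducible_iff.1 h
  have h1 : Sig2 fun x : ℕ × ℕ => Der JGraph Ξ.number x.1 x.2 := by fun_prop
  refine h1.of_eq fun x => ?_
  have h2 : x.2 ∈ Ξ.eval (charFun (jump ∅) : ℕ →. ℕ) x.1 ↔ f x.1 = x.2 := by
    rw [hΞ]; simp [eq_comm]
  rw [← h2]
  constructor
  · intro h
    exact h.sound fun a b hab => by simp [jGraph_iff.1 hab]
  · intro h
    exact (Der.complete h).mono fun a b hab => jGraph_iff.2 (by simpa using hab)

end Oracles

end CatDeg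


namespace CatDeg

/-! ## The true-stage construction of a generic set -/

/-- A move of the construction: two strings, two numbers, and a finite relation. -/
abbrev Move := List ℕ × List ℕ × ℕ × ℕ × List (ℕ × ℕ)

/-- What a requirement knows about its own past: the stage at which it was initialized, the string
it has to extend, and its moves with their stages. -/
abbrev Past := ℕ × List ℕ × List (Move × ℕ)

/-- The record of a requirement: its current string and its past. -/
abbrev Rec := List ℕ × Past

/-- Besides filling `getD`, this value is read by `newRec` when there are no records yet: the first
record starts from the empty string. -/
def rec0 : Rec := ([], 0, [], [])

/-- The requirement in position `e` can make the move with code `b` at stage `t`. -/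
def Act (S : List Rec) (e b t : ℕ) : Prop :=
  e < S.length ∧ (S.getD e rec0).2.2.2.length < 4 ∧
    (S.getD e rec0).2.2.1 <+: (Denumerable.ofNat Move b).1 ∧
    Sees e.unpair.1 (Encodable.encode (e.unpair.2, (S.getD e rec0).2, Denumerable.ofNat Move b)) t

theorem exists_selPos (S : List Rec) (t : ℕ) :
    ∃ e, e = S.length ∨ ∃ b, b < t ∧ Act S e b t := ⟨_, .inl rfl⟩

open Classical in
/-- The first position that can move. -/
noncomputable def selPos (S : List Rec) (t : ℕ) : ℕ := Nat.find (exists_selPos S t)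

theorem exists_selMove (S : List Rec) (e t : ℕ) : ∃ b, b = t ∨ Act S e b t := ⟨_, .inl rfl⟩

open Classical in
/-- The code of the first move that can be made in position `e`. -/
noncomputable def selMove (S : List Rec) (e t : ℕ) : ℕ := Nat.find (exists_selMove S e t)

/-- The record after the move `β` at stage `t`. -/
def upd (r : Rec) (β : Move) (t : ℕ) : Rec :=
  (β.1, r.2.1, r.2.2.1, r.2.2.2 ++ [(β, t)])

/-- A new record at stage `t`. -/
def newRec (S : List Rec) (t : ℕ) : Rec :=
  ((S.getD (S.length - 1) rec0).1, t, (S.getD (S.length - 1) rec0).1, [])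

/-- One step of the construction. -/
noncomputable def step (S : List Rec) (t : ℕ) : List Rec :=
  if selPos S t = S.length then S ++ [newRec S t]
  -- The records after the acting position are discarded, which is the injury of lower priority.
  else S.take (selPos S t) ++ [upd (S.getD (selPos S t) rec0)
    (Denumerable.ofNat Move (selMove S (selPos S t) t)) t]

/-- The records at stage `t`, computed from those at the last stage that looks true. -/
noncomputable def stg : ℕ → List Rec :=
  courseRec fun l => if l.length = 0 then [] else step (l.getD (prd l.length) []) l.length

section Computability

variable {α : Type} [Primcodable α]

@[fun_prop] theorem computablePred_act {S : α → List Rec} {e b t : α → ℕ} (hS : Computable S)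
    (he : Computable e) (hb : Computable b) (ht : Computable t) :
    ComputablePred fun a => Act (S a) (e a) (b a) (t a) := by
  have h : ComputablePred fun x : List Rec × ℕ × ℕ × ℕ => Act x.1 x.2.1 x.2.2.1 x.2.2.2 := by
    unfold Act
    have h1 : Computable fun x : List Rec × ℕ × ℕ × ℕ => Denumerable.ofNat Move x.2.2.1 :=
      computable_ofNat (by fun_prop)
    obtain ⟨m, hm, hme⟩ : ∃ m : List Rec × ℕ × ℕ × ℕ → Move, Computable m ∧
      ∀ x, Denumerable.ofNat Move x.2.2.1 = m x := ⟨_, h1, fun _ => rfl⟩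
    simp only [hme]
    fun_prop
  exact computablePred_comp h (f := fun a => (S a, e a, b a, t a)) (by fun_prop)

@[fun_prop] theorem computable_selPos {S : α → List Rec} {t : α → ℕ} (hS : Computable S)
    (ht : Computable t) : Computable fun a => selPos (S a) (t a) := by
  classical
  exact computable_find (P := fun a e => e = (S a).length ∨ ∃ b, b < t a ∧ Act (S a) e b (t a))
    (by fun_prop) fun a => exists_selPos (S a) (t a)

@[fun_prop] theorem computable_selMove {S : α → List Rec} {e t : α → ℕ} (hS : Computable S)
    (he : Computable e) (ht : Computable t) : Computable fun a => selMove (S a) (e a) (t a) := by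
  classical
  exact computable_find (P := fun a b => b = t a ∨ Act (S a) (e a) b (t a))
    (by fun_prop) fun a => exists_selMove (S a) (e a) (t a)

@[fun_prop] theorem computable_step {S : α → List Rec} {t : α → ℕ} (hS : Computable S)
    (ht : Computable t) : Computable fun a => step (S a) (t a) := by
  have h1 : Computable fun a => Denumerable.ofNat Move (selMove (S a) (selPos (S a) (t a)) (t a)) :=
    computable_ofNat (by fun_prop)
  obtain ⟨m, hm, hme⟩ : ∃ m : α → Move, Computable m ∧
    ∀ a, Denumerable.ofNat Move (selMove (S a) (selPos (S a) (t a)) (t a)) = m a :=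
    ⟨_, h1, fun _ => rfl⟩
  unfold step newRec upd
  simp only [hme]
  fun_prop

theorem computable_stg' : Computable stg := by
  refine computable_courseRec ?_
  fun_prop

@[fun_prop] theorem computable_stg {t : α → ℕ} (ht : Computable t) :
    Computable fun a => stg (t a) := computable_stg'.comp ht

end Computability

theorem stg_zero : stg 0 = [] := rfl

theorem stg_eq {t : ℕ} (ht : 0 < t) : stg t = step (stg (prd t)) t := by
  unfold stg
  conv_lhs => rw [courseRec]
  simp only [length_courseList, courseList_getD _ (prd_lt ht)]
  rw [if_neg (by omega)]

/-- The two cases of a step. -/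
theorem step_cases (S : List Rec) (t : ℕ) :
    (step S t = S ++ [newRec S t] ∧ ∀ e b, b < t → ¬ Act S e b t) ∨
    ∃ e b, Act S e b t ∧ (∀ e' b', b' < t → Act S e' b' t → e ≤ e') ∧
      step S t = S.take e ++ [upd (S.getD e rec0) (Denumerable.ofNat Move b) t] := by
  classical
  by_cases h : selPos S t = S.length
  · left
    refine ⟨by rw [step, if_pos h], fun e b hb ha => ?_⟩
    have : selPos S t ≤ e := Nat.find_min' _ (.inr ⟨b, hb, ha⟩)
    have := ha.1
    omega
  · right
    obtain ⟨b, hb, ha⟩ := (Nat.find_spec (exists_selPos S t)).resolve_left h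
    refine ⟨selPos S t, selMove S (selPos S t) t, ?_, fun e' b' hb' ha' =>
      Nat.find_min' _ (.inr ⟨b', hb', ha'⟩), by rw [step, if_neg h]⟩
    have h1 : selMove S (selPos S t) t ≤ b := Nat.find_min' _ (.inr ha)
    exact (Nat.find_spec (exists_selMove S (selPos S t) t)).resolve_left
      (show selMove S (selPos S t) t ≠ t by omega)

/-- A record in position `e` at stage `t` is as it should be. -/
structure GoodRec (e t : ℕ) (r : Rec) : Prop where
  init_bel : Bel r.2.1 t
  init_pos : 0 < r.2.1
  length_le : r.2.2.2.length ≤ 4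
  str_prefix : r.2.2.1 <+: r.1
  cur_nil : r.2.2.2 = [] → r.1 = r.2.2.1
  cur_last : ∀ (j : ℕ) (m : Move × ℕ), r.2.2.2[j]? = some m → j + 1 = r.2.2.2.length → r.1 = m.1.1
  hist : ∀ (j : ℕ) (m : Move × ℕ), r.2.2.2[j]? = some m → r.2.1 < m.2 ∧ Bel m.2 t ∧ r.2.2.1 <+: m.1.1 ∧
    Sees e.unpair.1 (Encodable.encode (e.unpair.2, (r.2.1, r.2.2.1, r.2.2.2.take j), m.1)) m.2
  hist_mono : ∀ (i j : ℕ) (m m' : Move × ℕ), i < j → r.2.2.2[i]? = some m → r.2.2.2[j]? = some m' → m.2 < m'.2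

theorem GoodRec.mono {e t t' : ℕ} {r : Rec} (h : GoodRec e t r) (ht : Bel t t') :
    GoodRec e t' r :=
  { h with
    init_bel := h.init_bel.trans ht
    hist := fun j m hm => ⟨(h.hist j m hm).1, (h.hist j m hm).2.1.trans ht, (h.hist j m hm).2.2⟩ }

theorem goodRec_new (S : List Rec) {e t : ℕ} (ht : 0 < t) : GoodRec e t (newRec S t) where
  init_bel := Bel.refl t
  init_pos := ht
  length_le := by simp [newRec]
  str_prefix := List.prefix_refl _
  cur_nil := fun _ => rfl
  cur_last := by simp [newRec]
  hist := by simp [newRec]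
  hist_mono := by simp [newRec]

theorem GoodRec.upd {e t t' : ℕ} {r : Rec} (h : GoodRec e t' r) (ht : Bel t' t) (hlt : t' < t)
    {β : Move} (h4 : r.2.2.2.length < 4) (hp : r.2.2.1 <+: β.1)
    (hs : Sees e.unpair.1 (Encodable.encode (e.unpair.2, r.2, β)) t) :
    GoodRec e t (upd r β t) where
  init_bel := h.init_bel.trans ht
  init_pos := h.init_pos
  length_le := by simp only [CatDeg.upd, List.length_append, List.length_singleton]; omega
  str_prefix := hp
  cur_nil := by simp [CatDeg.upd]
  cur_last := by
    intro j m hm hj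
    simp only [CatDeg.upd, List.length_append, List.length_singleton] at hm hj ⊢
    obtain rfl : j = r.2.2.2.length := by omega
    simp only [List.getElem?_concat_length, Option.some.injEq] at hm
    rw [← hm]
  hist := by
    intro j m hm
    simp only [CatDeg.upd] at hm ⊢
    rcases Nat.lt_or_ge j r.2.2.2.length with h1 | h1
    · rw [List.getElem?_append_left h1] at hm
      rw [List.take_append_of_le_length h1.le]
      obtain ⟨h2, h3, h5⟩ := h.hist j m hm
      exact ⟨h2, h3.trans ht, h5⟩
    · rw [List.getElem?_append_right h1] at hm
      obtain h2 : j - r.2.2.2.length = 0 := by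
        by_contra h2
        rw [List.getElem?_eq_none (by simp; omega)] at hm
        cases hm
      obtain rfl : j = r.2.2.2.length := by omega
      simp only [Nat.sub_self, List.getElem?_cons_zero, Option.some.injEq] at hm
      subst hm
      rw [List.take_append_of_le_length le_rfl, List.take_length]
      exact ⟨h.init_bel.le.trans_lt hlt, Bel.refl t, hp, hs⟩
  hist_mono := by
    intro i j m m' hij hm hm'
    simp only [CatDeg.upd] at hm hm'
    have hj : j < r.2.2.2.length + 1 := by
      by_contra h2
      rw [List.getElem?_eq_none (by simp; omega)] at hm'
      cases hm'
    rw [List.getElem?_append_left (by omega)] at hm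
    rcases Nat.lt_or_ge j r.2.2.2.length with h1 | h1
    · rw [List.getElem?_append_left h1] at hm'
      exact h.hist_mono i j m m' hij hm hm'
    · obtain rfl : j = r.2.2.2.length := by omega
      simp only [List.getElem?_concat_length, Option.some.injEq] at hm'
      rw [← hm']
      exact (h.hist i m hm).2.1.le.trans_lt hlt

theorem stg_induction {P : ℕ → List Rec → Prop} (h0 : P 0 [])
    (hnew : ∀ t, 0 < t → P (prd t) (stg (prd t)) →
      stg t = stg (prd t) ++ [newRec (stg (prd t)) t] → P t (stg t))
    (hupd : ∀ t e b, 0 < t → P (prd t) (stg (prd t)) → Act (stg (prd t)) e b t →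
      stg t = (stg (prd t)).take e ++
        [upd ((stg (prd t)).getD e rec0) (Denumerable.ofNat Move b) t] → P t (stg t)) :
    ∀ t, P t (stg t) := by
  intro t
  induction t using Nat.strong_induction_on with
  | _ t ih =>
    rcases Nat.eq_zero_or_pos t with rfl | ht
    · exact h0
    · have h := ih _ (prd_lt ht)
      rcases step_cases (stg (prd t)) t with ⟨h1, -⟩ | ⟨e, b, h1, -, h2⟩
      · exact hnew t ht h ((stg_eq ht).trans h1)
      · exact hupd t e b ht h h1 ((stg_eq ht).trans h2)

theorem getD_append_singleton_lt {S : List Rec} {x : Rec} {i : ℕ} (h : i < S.length) :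
    (S ++ [x]).getD i rec0 = S.getD i rec0 := List.getD_append _ _ _ _ h

theorem getD_append_singleton_eq {S : List Rec} {x : Rec} :
    (S ++ [x]).getD S.length rec0 = x := by
  rw [List.getD_append_right _ _ _ _ le_rfl]; simp

theorem getD_take_append_lt {S : List Rec} {x : Rec} {i e : ℕ} (he : e < S.length) (h : i < e) :
    (S.take e ++ [x]).getD i rec0 = S.getD i rec0 := by
  rw [List.getD_append _ _ _ _ (by simp; omega), List.getD_eq_getElem?_getD,
    List.getElem?_take_of_lt h, ← List.getD_eq_getElem?_getD]

theorem getD_take_append_eq {S : List Rec} {x : Rec} {e : ℕ} (he : e < S.length) :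
    (S.take e ++ [x]).getD e rec0 = x := by
  rw [List.getD_append_right _ _ _ _ (by simp)]
  simp [Nat.min_eq_left he.le]

theorem length_take_append {S : List Rec} {x : Rec} {e : ℕ} (he : e < S.length) :
    (S.take e ++ [x]).length = e + 1 := by
  simp [Nat.min_eq_left he.le]

theorem goodRec_stg (t : ℕ) : ∀ e, e < (stg t).length → GoodRec e t ((stg t).getD e rec0) := by
  refine stg_induction (P := fun t S => ∀ e, e < S.length → GoodRec e t (S.getD e rec0))
    (by simp) ?_ ?_ t
  · intro t ht ih hS e he
    rw [hS] at he ⊢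
    rw [List.length_append, List.length_singleton] at he
    rcases Nat.lt_succ_iff_lt_or_eq.1 he with h | rfl
    · rw [getD_append_singleton_lt h]
      exact (ih e h).mono (bel_prd t)
    · rw [getD_append_singleton_eq]
      exact goodRec_new _ ht
  · intro t e b ht ih ha hS e' he'
    rw [hS] at he' ⊢
    rw [length_take_append ha.1] at he'
    rcases Nat.lt_succ_iff_lt_or_eq.1 he' with h | rfl
    · rw [getD_take_append_lt ha.1 h]
      exact (ih e' (h.trans ha.1)).mono (bel_prd t)
    · rw [getD_take_append_eq ha.1]
      exact (ih e' ha.1).upd (bel_prd t) (prd_lt ht) ha.2.1 ha.2.2.1 ha.2.2.2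

/-- Each record starts from the current string of the preceding one. -/
theorem stg_chain (t : ℕ) : ∀ e, e + 1 < (stg t).length →
    ((stg t).getD (e + 1) rec0).2.2.1 = ((stg t).getD e rec0).1 := by
  refine stg_induction (P := fun _ S => ∀ e, e + 1 < S.length →
    (S.getD (e + 1) rec0).2.2.1 = (S.getD e rec0).1) (by simp) ?_ ?_ t
  · intro t ht ih hS e he
    rw [hS] at he ⊢
    rw [List.length_append, List.length_singleton] at he
    rcases Nat.lt_succ_iff_lt_or_eq.1 he with h | h
    · rw [getD_append_singleton_lt h, getD_append_singleton_lt (by omega)]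
      exact ih e h
    · rw [h, getD_append_singleton_eq, getD_append_singleton_lt (by omega), newRec, ← h]
      rfl
  · intro t e b ht ih ha hS e' he'
    rw [hS] at he' ⊢
    rw [length_take_append ha.1] at he'
    rcases Nat.lt_succ_iff_lt_or_eq.1 he' with h | h
    · rw [getD_take_append_lt ha.1 h, getD_take_append_lt ha.1 (by omega)]
      exact ih e' (h.trans ha.1)
    · subst h
      rw [getD_take_append_eq ha.1, getD_take_append_lt ha.1 (by omega)]
      exact ih e' ha.1

/-- The last record was initialized or moved at the present stage. -/
theorem stg_last (t : ℕ) (h4 : 0 < t) : 0 < (stg t).length ∧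
    ((((stg t).getD ((stg t).length - 1) rec0).2.1 = t ∧
      ((stg t).getD ((stg t).length - 1) rec0).2.2.2 = []) ∨
    ∃ h β, ((stg t).getD ((stg t).length - 1) rec0).2.2.2 = h ++ [(β, t)]) := by
  rcases step_cases (stg (prd t)) t with ⟨h1, -⟩ | ⟨e, b, ha, -, h2⟩
  · rw [stg_eq h4, h1]
    simp [newRec]
  · rw [stg_eq h4, h2, length_take_append ha.1, Nat.add_sub_cancel, getD_take_append_eq ha.1]
    exact ⟨by omega, .inr ⟨_, _, rfl⟩⟩

/-- The record in position `e` at a stage `r` that looks true at `t`, from the one at `t`. -/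
theorem stg_history (t : ℕ) : ∀ e r, e < (stg t).length → Bel r t →
    ((stg t).getD e rec0).2.1 ≤ r →
    e < (stg r).length ∧ ∃ j, j ≤ ((stg t).getD e rec0).2.2.2.length ∧
      ((stg r).getD e rec0).2 = (((stg t).getD e rec0).2.1, ((stg t).getD e rec0).2.2.1,
        ((stg t).getD e rec0).2.2.2.take j) ∧
      (∀ i m, ((stg t).getD e rec0).2.2.2[i]? = some m → (i < j ↔ m.2 ≤ r)) := by
  have base : ∀ t e, e < (stg t).length →
    e < (stg t).length ∧ ∃ j, j ≤ ((stg t).getD e rec0).2.2.2.length ∧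
      ((stg t).getD e rec0).2 = (((stg t).getD e rec0).2.1, ((stg t).getD e rec0).2.2.1,
        ((stg t).getD e rec0).2.2.2.take j) ∧
      (∀ i m, ((stg t).getD e rec0).2.2.2[i]? = some m → (i < j ↔ m.2 ≤ t)) := by
    intro t e he
    refine ⟨he, _, le_rfl, by rw [List.take_length], fun i m hm => ?_⟩
    have h1 := ((goodRec_stg t e he).hist i m hm).2.1.le
    have h2 : i < ((stg t).getD e rec0).2.2.2.length := (List.getElem?_eq_some_iff.1 hm).1
    exact ⟨fun _ => h1, fun _ => h2⟩
  refine stg_induction (P := fun t S => ∀ e r, e < S.length → Bel r t → (S.getD e rec0).2.1 ≤ r →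
    e < (stg r).length ∧ ∃ j, j ≤ (S.getD e rec0).2.2.2.length ∧
      ((stg r).getD e rec0).2 = ((S.getD e rec0).2.1, (S.getD e rec0).2.2.1,
        (S.getD e rec0).2.2.2.take j) ∧
      (∀ i m, (S.getD e rec0).2.2.2[i]? = some m → (i < j ↔ m.2 ≤ r))) (by simp) ?_ ?_ t
  · intro t ht ih hS e r he hb hr
    rcases Nat.lt_or_eq_of_le hb.le with hlt | rfl
    · have hb' := hb.to_prd hlt
      rw [hS] at he hr ⊢
      rw [List.length_append, List.length_singleton] at he
      rcases Nat.lt_succ_iff_lt_or_eq.1 he with h | rfl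
      · rw [getD_append_singleton_lt h] at hr ⊢
        exact ih e r h hb' hr
      · rw [getD_append_singleton_eq] at hr
        simp only [newRec] at hr
        omega
    · exact base _ e he
  · intro t e b ht ih ha hS e' r he' hb hr
    rcases Nat.lt_or_eq_of_le hb.le with hlt | rfl
    · have hb' := hb.to_prd hlt
      rw [hS] at he' hr ⊢
      rw [length_take_append ha.1] at he'
      rcases Nat.lt_succ_iff_lt_or_eq.1 he' with h | rfl
      · rw [getD_take_append_lt ha.1 h] at hr ⊢
        exact ih e' r (h.trans ha.1) hb' hr
      · rw [getD_take_append_eq ha.1] at hr ⊢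
        obtain ⟨h1, j, h2, h3, h4⟩ := ih e' r ha.1 hb' hr
        refine ⟨h1, j, ?_, ?_, ?_⟩
        · simp only [upd, List.length_append]; omega
        · simp only [upd]
          rw [h3, List.take_append_of_le_length h2]
        · intro i m hm
          simp only [upd] at hm
          rcases Nat.lt_or_ge i ((stg (prd t)).getD e' rec0).2.2.2.length with h5 | h5
          · rw [List.getElem?_append_left h5] at hm
            exact h4 i m hm
          · have h6 : i < ((stg (prd t)).getD e' rec0).2.2.2.length + 1 := by
              by_contra h2
              rw [List.getElem?_eq_none (by rw [List.length_append]; simpa using h2)] at hm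
              cases hm
            obtain rfl : i = ((stg (prd t)).getD e' rec0).2.2.2.length := by omega
            simp only [List.getElem?_concat_length, Option.some.injEq] at hm
            subst hm
            simp only
            omega
    · exact base _ e' he'

/-! ### The final records -/

/-- The records at the true stage `T` are never injured. -/
def Final (T : ℕ) : Prop := Tru T ∧ ∀ t, Tru t → T ≤ t → stg T <+: stg t

theorem final_zero : Final 0 := ⟨tru_zero, fun t _ _ => by simp [stg_zero]⟩

theorem tru_induction {T : ℕ} {P : ℕ → Prop} (h0 : P T)
    (h : ∀ t, Tru t → T < t → T ≤ prd t → Tru (prd t) → P (prd t) → P t) (hT : Tru T) :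
    ∀ t, Tru t → T ≤ t → P t := by
  intro t
  induction t using Nat.strong_induction_on with
  | _ t ih =>
    intro ht hle
    rcases Nat.lt_or_eq_of_le hle with hlt | rfl
    · have h1 := ((hT.bel hle).to_prd hlt).le
      have h2 := ht.of_bel (bel_prd t)
      exact h t ht hlt h1 h2 (ih _ (prd_lt (by omega)) h2 h1)
    · exact h0

/-- After a final stage, a requirement of higher priority does not move. -/
theorem Final.pos_le {T t e b : ℕ} (hT : Final T) (ht : Tru t) (hlt : T < t)
    (ha : Act (stg (prd t)) e b t)
    (hS : stg t = (stg (prd t)).take e ++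
      [upd ((stg (prd t)).getD e rec0) (Denumerable.ofNat Move b) t]) : (stg T).length ≤ e := by
  by_contra hlt'
  have h1 := ((hT.1.bel hlt.le).to_prd hlt).le
  have h2 := hT.2 _ (ht.of_bel (bel_prd t)) h1
  have h3 := hT.2 t ht hlt.le
  have h4 := h3.length_le
  rw [hS, length_take_append ha.1] at h4
  have h5 : (stg T).getD e rec0 = (stg (prd t)).getD e rec0 := by
    obtain ⟨u, hu⟩ := h2
    rw [← hu, List.getD_append _ _ _ _ (by omega)]
  have h6 : (stg T).getD e rec0 = (stg t).getD e rec0 := by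
    obtain ⟨u, hu⟩ := h3
    rw [← hu, List.getD_append _ _ _ _ (by omega)]
  rw [hS, getD_take_append_eq ha.1, h5] at h6
  have := congrArg (fun r : Rec => r.2.2.2.length) h6
  simp [upd] at this

/-- The next position is present at some later true stage, and it makes at most four moves. A stage
at which it has made as many moves as it ever does at such stages is final for it. -/
theorem Final.next {T : ℕ} (hT : Final T) :
    ∃ T', Final T' ∧ T < T' ∧ (stg T').length = (stg T).length + 1 := by
  classical
  set n := (stg T).length with hn
  have hex : ∃ t, Tru t ∧ T < t ∧ (stg t).length = n + 1 := by
    obtain ⟨t', ht', htru'⟩ := exists_tru (T + 1)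
    have hex' : ∃ t, T < t ∧ Tru t := ⟨t', by omega, htru'⟩
    set t := Nat.find hex' with htdef
    obtain ⟨h1, h2⟩ := Nat.find_spec hex'
    rw [← htdef] at h1 h2
    have h3 : prd t = T := by
      have h4 := ((hT.1.bel h1.le).to_prd h1).le
      by_contra h5
      exact Nat.find_min hex' (m := prd t) (by rw [← htdef]; exact prd_lt (by omega))
        ⟨by omega, h2.of_bel (bel_prd t)⟩
    -- The first true stage after `T` works from the records at `T` itself. It cannot act on one of
    -- them, so it appends.
    refine ⟨t, h2, h1, ?_⟩
    rcases step_cases (stg (prd t)) t with ⟨h4, -⟩ | ⟨e, b, ha, -, h4⟩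
    · rw [stg_eq (by omega), h4, h3]; simp [hn]
    · rw [← stg_eq (by omega)] at h4
      have h5 := hT.pos_le h2 h1 ha h4
      have := ha.1
      rw [h3] at this
      omega
  have hbd : ∃ k, ∃ t, Tru t ∧ T < t ∧ (stg t).length = n + 1 ∧
      ((stg t).getD n rec0).2.2.2.length = k ∧
      ∀ t', Tru t' → T < t' → (stg t').length = n + 1 →
        ((stg t').getD n rec0).2.2.2.length ≤ k := by
    by_contra hno
    push Not at hno
    have : ∀ k, ∃ t, Tru t ∧ T < t ∧ (stg t).length = n + 1 ∧
        k ≤ ((stg t).getD n rec0).2.2.2.length := by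
      intro k
      induction k with
      | zero =>
        obtain ⟨t, h1, h2, h3⟩ := hex
        exact ⟨t, h1, h2, h3, Nat.zero_le _⟩
      | succ k ih =>
        obtain ⟨t, h1, h2, h3, h4⟩ := ih
        obtain ⟨t', h5, h6, h7, h8⟩ := hno _ t h1 h2 h3 rfl
        exact ⟨t', h5, h6, h7, by omega⟩
    obtain ⟨t, h1, h2, h3, h4⟩ := this 5
    have := (goodRec_stg t n (by omega)).length_le
    omega
  obtain ⟨k, T', h1, h2, h3, h4, h5⟩ := hbd
  refine ⟨T', ⟨h1, ?_⟩, h2, h3⟩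
  refine tru_induction (List.prefix_refl _) ?_ h1
  intro t ht hlt hle htp ih
  rcases step_cases (stg (prd t)) t with ⟨h6, -⟩ | ⟨e, b, ha, -, h6⟩
  · rw [stg_eq (t := t) (by omega), h6]
    exact ih.trans (List.prefix_append _ _)
  · rw [← stg_eq (by omega)] at h6
    have h7 := hT.pos_le ht (by omega) ha h6
    rcases Nat.lt_or_eq_of_le h7 with h8 | h8
    · rw [h6]
      refine List.IsPrefix.trans ?_ (List.prefix_append _ _)
      rw [List.prefix_take_iff]
      exact ⟨ih, by omega⟩
    -- An action in position `n` would give a record with more moves than the maximum `k`.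
    · exfalso
      have h9 : (stg t).length = n + 1 := by
        rw [h6, length_take_append ha.1, ← h8]
      have h10 := h5 t ht (by omega) h9
      have hne : n = e := h8
      rw [h6, hne, getD_take_append_eq ha.1] at h10
      have h11 : (stg T').getD n rec0 = (stg (prd t)).getD n rec0 := by
        obtain ⟨u, hu⟩ := ih
        rw [← hu, List.getD_append _ _ _ _ (by omega)]
      rw [← hne, ← h11] at h10
      simp only [upd, List.length_append, List.length_singleton] at h10
      omega

theorem exists_final (n : ℕ) : ∃ T, Final T ∧ (stg T).length = n := by
  induction n with
  | zero => exact ⟨0, final_zero, by simp [stg_zero]⟩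
  | succ n ih =>
    obtain ⟨T, hT, h⟩ := ih
    obtain ⟨T', hT', -, h'⟩ := hT.next
    exact ⟨T', hT', by omega⟩

theorem Final.prefix {T T' : ℕ} (h : Final T) (h' : Final T')
    (hle : (stg T).length ≤ (stg T').length) : stg T <+: stg T' := by
  obtain ⟨t, ht, htru⟩ := exists_tru (T + T')
  exact List.prefix_of_prefix_length_le (h.2 t htru (by omega)) (h'.2 t htru (by omega)) hle

/-- A final stage with exactly the first `e + 1` requirements present. -/
noncomputable def finStage (e : ℕ) : ℕ := (exists_final (e + 1)).choose

theorem final_finStage (e : ℕ) : Final (finStage e) := (exists_final (e + 1)).choose_spec.1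

theorem length_finStage (e : ℕ) : (stg (finStage e)).length = e + 1 :=
  (exists_final (e + 1)).choose_spec.2

/-- The final record in position `e`. -/
noncomputable def finRec (e : ℕ) : Rec := (stg (finStage e)).getD e rec0

theorem getD_eq_of_prefix {S S' : List Rec} (h : S <+: S') {i : ℕ} (hi : i < S.length) :
    S'.getD i rec0 = S.getD i rec0 := by
  obtain ⟨u, rfl⟩ := h
  exact List.getD_append _ _ _ _ hi

theorem Final.getD_eq {T e : ℕ} (h : Final T) (he : e < (stg T).length) :
    (stg T).getD e rec0 = finRec e := by
  have h1 := length_finStage e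
  exact getD_eq_of_prefix ((final_finStage e).prefix h (by omega)) (by omega)

theorem getD_eq_finRec {t e : ℕ} (ht : Tru t) (hle : finStage e ≤ t) :
    e < (stg t).length ∧ (stg t).getD e rec0 = finRec e := by
  have h1 := length_finStage e
  have h2 := (final_finStage e).2 t ht hle
  exact ⟨by have := h2.length_le; omega, getD_eq_of_prefix h2 (by omega)⟩

theorem goodRec_finRec (e : ℕ) : GoodRec e (finStage e) (finRec e) :=
  goodRec_stg _ e (by rw [length_finStage]; omega)

theorem finRec_chain (e : ℕ) : (finRec (e + 1)).2.2.1 = (finRec e).1 := by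
  have h1 := length_finStage (e + 1)
  have h2 := stg_chain (finStage (e + 1)) e (by omega)
  rwa [(final_finStage (e + 1)).getD_eq (by omega), (final_finStage (e + 1)).getD_eq (by omega)]
    at h2

theorem finStage_pos (e : ℕ) : 0 < finStage e := by
  rcases Nat.eq_zero_or_pos (finStage e) with h | h
  · have := length_finStage e
    rw [h, stg_zero] at this
    simp at this
  · exact h

/-- The requirement in position `e`, as a predicate of its past and of its next move. -/
def Req (e : ℕ) (x : Past) (β : Move) : Prop :=
  U2 e.unpair.1 (Encodable.encode (e.unpair.2, x, β))

theorem finRec_hist {e j : ℕ} {m : Move × ℕ} (h : (finRec e).2.2.2[j]? = some m) :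
    Req e ((finRec e).2.1, (finRec e).2.2.1, (finRec e).2.2.2.take j) m.1 := by
  obtain ⟨-, h1, -, h2⟩ := (goodRec_finRec e).hist j m h
  exact ((final_finStage e).1.of_bel h1).u2_of_sees h2

/-- A true move is seen at all late stages. At a late true stage the construction would then act in
this position or an earlier one, although these are final. -/
theorem finRec_no_move {e : ℕ} (h : (finRec e).2.2.2.length < 4) {β : Move}
    (hp : (finRec e).2.2.1 <+: β.1) : ¬ Req e (finRec e).2 β := by
  intro hreq
  obtain ⟨t₀, ht₀⟩ := hreq.eventually_sees
  obtain ⟨t₁, ht₁, htru₁⟩ := exists_tru (finStage e)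
  obtain ⟨t, ht, htru⟩ := exists_tru (t₀ + t₁ + Encodable.encode β + 1)
  have h0 : finStage e ≤ prd t :=
    (((final_finStage e).1.bel (by omega)).to_prd (by omega)).le
  obtain ⟨h1, h2⟩ := getD_eq_finRec (htru.of_bel (bel_prd t)) h0
  have hact : Act (stg (prd t)) e (Encodable.encode β) t := by
    refine ⟨h1, ?_⟩
    rw [h2, Denumerable.ofNat_encode]
    exact ⟨h, hp, ht₀ t (by omega)⟩
  rcases step_cases (stg (prd t)) t with ⟨-, h3⟩ | ⟨e', b, ha, h3, h4⟩
  · exact h3 e _ (by omega) hact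
  · have h5 := h3 e _ (by omega) hact
    rw [← stg_eq (by omega)] at h4
    have h6 := (final_finStage e).pos_le htru (by omega) ha h4
    rw [length_finStage] at h6
    omega

theorem finRec_prefix_succ (e : ℕ) : (finRec e).1 <+: (finRec (e + 1)).1 := by
  rw [← finRec_chain]; exact (goodRec_finRec (e + 1)).str_prefix

theorem finRec_prefix {e e' : ℕ} (h : e ≤ e') : (finRec e).1 <+: (finRec e').1 := by
  induction e', h using Nat.le_induction with
  | base => exact List.prefix_refl _
  | succ e' _ ih => exact ih.trans (finRec_prefix_succ e')

theorem finRec_prefix_str {e e' : ℕ} (h : e < e') : (finRec e).1 <+: (finRec e').2.2.1 := by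
  obtain ⟨d, rfl⟩ : ∃ d, e' = d + 1 := ⟨e' - 1, by omega⟩
  rw [finRec_chain]
  exact finRec_prefix (by omega)

/-- The index of a `Σ⁰₂` requirement. -/
theorem exists_req {P : ℕ → Past → Move → Prop}
    (hP : Sig2 fun x : ℕ × Past × Move => P x.1 x.2.1 x.2.2) :
    ∃ p, ∀ i x β, Req (Nat.pair p i) x β ↔ P i x β := by
  obtain ⟨p, hp⟩ := hP.exists_index
  refine ⟨p, fun i x β => ?_⟩
  rw [Req, Nat.unpair_pair]
  exact (hp (i, x, β)).symm

/-- A requirement that asks for one move only. -/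
theorem exists_req_one {Z : List ℕ → List ℕ → Prop}
    (hZ : Sig2 fun x : List ℕ × List ℕ => Z x.1 x.2) :
    ∃ p, ∀ i, Z (finRec (Nat.pair p i)).2.2.1 (finRec (Nat.pair p i)).1 ∨
      ∀ τ, (finRec (Nat.pair p i)).2.2.1 <+: τ → ¬ Z (finRec (Nat.pair p i)).2.2.1 τ := by
  obtain ⟨p, hp⟩ := exists_req (P := fun _ x β => x.2.2.length = 0 ∧ Z x.2.1 β.1)
    (Sig2.and (by fun_prop) (hZ.comp (f := fun x : ℕ × Past × Move => (x.2.1.2.1, x.2.2.1))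
      (by fun_prop)))
  refine ⟨p, fun i => ?_⟩
  set e := Nat.pair p i
  rcases Nat.eq_zero_or_pos (finRec e).2.2.2.length with h | h
  · right
    intro τ hτ hz
    refine finRec_no_move (by omega) (β := (τ, [], 0, 0, [])) hτ ?_
    exact (hp _ _ _).2 ⟨h, hz⟩
  · left
    obtain ⟨m, hm⟩ : ∃ m, (finRec e).2.2.2[(finRec e).2.2.2.length - 1]? = some m :=
      ⟨_, List.getElem?_eq_getElem (by omega)⟩
    have h1 := (hp _ _ _).1 (finRec_hist hm)
    simp only at h1
    rw [(goodRec_finRec e).cur_last _ m hm (by omega)]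
    exact h1.2

/-- The condition of being a proper extension is always satisfiable, so each copy of that
requirement lengthens the string. -/
theorem exists_long (n : ℕ) : ∃ e, n ≤ (finRec e).1.length := by
  obtain ⟨p, hp⟩ := exists_req_one (Z := fun σ τ => σ.length < τ.length) (by fun_prop)
  have key : ∀ i, (finRec (Nat.pair p i)).2.2.1.length < (finRec (Nat.pair p i)).1.length := by
    intro i
    refine (hp i).resolve_right fun h => ?_
    exact h _ (List.prefix_append _ [0]) (by simp)
  induction n with
  | zero => exact ⟨0, Nat.zero_le _⟩
  | succ n ih =>
    obtain ⟨e, he⟩ := ih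
    have h1 : e < Nat.pair p (e + 1) := Nat.right_le_pair p (e + 1)
    exact ⟨Nat.pair p (e + 1), by
      have := (finRec_prefix_str h1).length_le
      have := key (e + 1)
      omega⟩

/-- The generic function: the limit of the current strings of the final records. -/
noncomputable def gen (n : ℕ) : ℕ := (finRec (exists_long (n + 1)).choose).1.getD n 0

theorem isInit_finRec (e : ℕ) : IsInit (finRec e).1 gen := by
  intro n hn
  unfold gen
  set e' := (exists_long (n + 1)).choose with he'
  have h1 : n + 1 ≤ (finRec e').1.length := (exists_long (n + 1)).choose_spec
  rcases le_total e e' with h | h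
  · obtain ⟨u, hu⟩ := finRec_prefix h
    rw [← hu, List.getD_append _ _ _ _ hn]
  · obtain ⟨u, hu⟩ := finRec_prefix h
    rw [← hu, List.getD_append _ _ _ _ (by omega)]

theorem isInit_finRec_str (e : ℕ) : IsInit (finRec e).2.2.1 gen :=
  (isInit_finRec e).of_prefix (goodRec_finRec e).str_prefix

theorem exists_long_str (n : ℕ) : ∃ e₀, ∀ e, e₀ ≤ e → n ≤ (finRec e).2.2.1.length := by
  obtain ⟨e, he⟩ := exists_long n
  exact ⟨e + 1, fun e' h => he.trans (finRec_prefix_str (by omega)).length_le⟩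

/-- `gen` meets or avoids every `Σ⁰₂` set of strings. -/
theorem generic {Z : List ℕ → Prop} (hZ : Sig2 Z) :
    ∃ σ, IsInit σ gen ∧ (Z σ ∨ ∀ τ, σ <+: τ → ¬ Z τ) := by
  obtain ⟨p, hp⟩ := exists_req_one (Z := fun _ τ => Z τ)
    (hZ.comp (f := fun x : List ℕ × List ℕ => x.2) (by fun_prop))
  rcases hp 0 with h | h
  · exact ⟨_, isInit_finRec _, .inl h⟩
  · exact ⟨_, isInit_finRec_str _, .inr h⟩

end CatDeg


namespace CatDeg

/-! ## The degree of the generic extension of `0'` -/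

section GenericDegree

/-- The set of the theorem. -/
noncomputable def genSet : Set ℕ := dset gen

theorem jump_le_genSet :
    TuringReducible (charFun (jump ∅) : ℕ →. ℕ) (charFun genSet : ℕ →. ℕ) := by
  refine turingReducible_of_computable (q := fun a => 2 * a) (by fun_prop) fun a => ?_
  rw [genSet, charFun_dset_even (by omega), Nat.mul_div_cancel_left _ (by omega)]

@[fun_prop] theorem sig2_tru {α : Type} [Primcodable α] {t : α → ℕ} (ht : Computable t) :
    Sig2 fun a => Tru (t a) :=
  ⟨fun a _ q => t a ≤ q → kk (t a) ≤ kk q, by fun_prop, fun x => by simp [Tru]⟩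

theorem sig2_not_tru {α : Type} [Primcodable α] {t : α → ℕ} (ht : Computable t) :
    Sig2 fun a => ¬ Tru (t a) := by
  refine Sig2.of_eq (P := fun a => ∃ q, t a ≤ q ∧ kk q < kk (t a)) (by fun_prop) fun a => ?_
  simp [Tru]

theorem sig2_not_final {α : Type} [Primcodable α] {t : α → ℕ} (ht : Computable t) :
    Sig2 fun a => ¬ Final (t a) := by
  have h0 := sig2_not_tru ht
  refine Sig2.of_eq (P := fun a => ¬ Tru (t a) ∨
    ∃ q, Tru q ∧ t a ≤ q ∧ ¬ stg (t a) <+: stg q) ?_ fun a => ?_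
  · exact Sig2.or h0 (by fun_prop)
  · unfold Final
    by_cases h : Tru (t a) <;> simp [h]

theorem Final.isInit {T : ℕ} (hT : Final T) (hl : 0 < (stg T).length) :
    IsInit ((stg T).getD ((stg T).length - 1) rec0).1 gen := by
  rw [hT.getD_eq (by omega)]
  exact isInit_finRec _

/-- Even arguments are decided through `0'`. For an odd argument one searches for a final stage
whose last string is long enough, and being final is `Π⁰₂`. -/
theorem genSet_le_jump_jump :
    TuringReducible (charFun genSet : ℕ →. ℕ) (charFun (jump (jump ∅)) : ℕ →. ℕ) := by
  refine turingReducible_jump_jump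
    (W := fun a u => (a % 2 = 0 ∧ JGraph (a / 2) u) ∨ (a % 2 = 1 ∧ Final u ∧ 0 < (stg u).length ∧
      a / 2 < ((stg u).getD ((stg u).length - 1) rec0).1.length))
    (out := fun a u => if a % 2 = 0 then u else
      ((stg u).getD ((stg u).length - 1) rec0).1.getD (a / 2) 0 % 2) ?_ (by fun_prop) ?_ ?_
  · have h1 : Sig2 fun x : ℕ × ℕ => ¬ Final x.2 := sig2_not_final (by fun_prop)
    have h2 : Sig2 fun x : ℕ × ℕ => ¬ x.1 / 2 ∈ jump ∅ := sig2_not_jump (by fun_prop)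
    refine Sig2.of_eq (P := fun x : ℕ × ℕ =>
      (x.1 % 2 = 1 ∨ (x.2 = 0 ∧ x.1 / 2 ∈ jump ∅) ∨ (x.2 = 1 ∧ ¬ x.1 / 2 ∈ jump ∅) ∨ 1 < x.2) ∧
      (x.1 % 2 = 0 ∨ ¬ Final x.2 ∨ ¬ 0 < (stg x.2).length ∨
      ¬ x.1 / 2 < ((stg x.2).getD ((stg x.2).length - 1) rec0).1.length)) ?_ fun x => ?_
    · exact Sig2.and (Sig2.or (by fun_prop) (Sig2.or (by fun_prop) (Sig2.or
        (Sig2.and (by fun_prop) h2) (by fun_prop)))) (Sig2.or (by fun_prop)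
        (Sig2.or h1 (by fun_prop)))
    · have h3 : (x.2 = 0 ∧ x.1 / 2 ∈ jump ∅) ∨ (x.2 = 1 ∧ ¬ x.1 / 2 ∈ jump ∅) ∨ 1 < x.2 ↔
          ¬ JGraph (x.1 / 2) x.2 := by
        unfold JGraph
        by_cases h : x.1 / 2 ∈ jump ∅ <;> simp only [h, and_true, and_false, not_true_eq_false,
          not_false_eq_true, or_false, false_or] <;> omega
      rw [h3]
      rcases Nat.mod_two_eq_zero_or_one x.1 with h4 | h4
      · simp [h4]
      · simp only [h4, one_ne_zero, false_and, false_or, true_or, true_and]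
        tauto
  · intro a
    rcases Nat.mod_two_eq_zero_or_one a with h | h
    · exact ⟨_, .inl ⟨h, jGraph_iff.2 rfl⟩⟩
    · obtain ⟨e, he⟩ := exists_long (a / 2 + 1)
      refine ⟨finStage e, .inr ⟨h, final_finStage e, ?_, ?_⟩⟩
      · rw [length_finStage]; omega
      · rw [length_finStage, Nat.add_sub_cancel]
        exact he
  · rintro a u (⟨h1, h2⟩ | ⟨h1, h2, h3, h4⟩)
    · rw [if_pos h1, genSet, charFun_dset_even h1, jGraph_iff.1 h2]
    · rw [if_neg (by omega), genSet, charFun_dset_odd h1, h2.isInit h3 _ h4]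

/-- A `Σ⁰₂` graph would make disagreement with it a `Σ⁰₂` set of strings, which `gen` cannot meet,
being the function described, and cannot avoid, because any string can be extended by an entry of
wrong parity. -/
theorem not_sig2_graph_genSet : ¬ Sig2 fun x : ℕ × ℕ => charFun genSet x.1 = x.2 := by
  intro h1
  obtain ⟨Q, hQ, hQe⟩ : ∃ Q : ℕ × ℕ → Prop, Sig2 Q ∧
      ∀ a b, charFun genSet a = b ↔ Q (a, b) := ⟨_, h1, fun _ _ => Iff.rfl⟩
  have hZ : Sig2 fun τ : List ℕ => ∃ n : ℕ, ∃ b : ℕ, n < τ.length ∧ Q (2 * n + 1, b) ∧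
      ¬ b = τ.getD n 0 % 2 := by fun_prop
  obtain ⟨σ, hσ, h | h⟩ := generic hZ
  · obtain ⟨n, b, h2, h3, h4⟩ := h
    rw [← hQe, genSet, charFun_dset_odd (by omega)] at h3
    apply h4
    rw [hσ n h2, ← h3]
    congr 2
    omega
  -- Adding one to the true entry flips its parity, the only part of `gen` that the set records.
  · refine h (σ ++ [gen σ.length + 1]) (List.prefix_append _ _) ⟨σ.length, _, by simp,
      (hQe _ _).1 rfl, ?_⟩
    rw [genSet, charFun_dset_odd (by omega), show (2 * σ.length + 1) / 2 = σ.length by omega,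
      List.getD_append_right _ _ _ _ le_rfl]
    simp only [Nat.sub_self, List.getD_cons_zero]
    omega

theorem not_genSet_le_jump :
    ¬ TuringReducible (charFun genSet : ℕ →. ℕ) (charFun (jump ∅) : ℕ →. ℕ) :=
  fun h => not_sig2_graph_genSet (sig2_graph_of_turingReducible h)

theorem not_sig2_compl : ¬ Sig2 fun x : ℕ => ¬ U2 x x := by
  intro h
  obtain ⟨p, hp⟩ := h.exists_index
  have := hp p
  simp at this

/-- If `Ξ` decided `0''`, consider the strings on which it wrongly rejects some `x` of the diagonal
`Σ⁰₂` set. They cannot be met, and if they are avoided below `σ`, rejection on some extension of `σ`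
defines the complement in a `Σ⁰₂` way. -/
theorem not_jump_jump_le_genSet :
    ¬ TuringReducible (charFun (jump (jump ∅)) : ℕ →. ℕ) (charFun genSet : ℕ →. ℕ) := by
  intro h
  obtain ⟨Ξ, hΞ⟩ := turingReducible_iff.1 h
  have hU : Sig2 fun x : ℕ => U2 x x := sig2_u2 (by fun_prop) (by fun_prop)
  obtain ⟨q, hq, hqe⟩ := hU.reduction
  have hval : ∀ x b, b ∈ Ξ.eval (charFun genSet : ℕ →. ℕ) (q x) ↔
      b = charFun (jump (jump ∅)) (q x) := by
    intro x b
    rw [hΞ, mem_coe_iff]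
  have h0 : ∀ x, charFun (jump (jump ∅)) (q x) = 0 ↔ ¬ U2 x x := by
    intro x
    rw [hqe]
    unfold charFun
    split_ifs with h <;> simp [h]
  have hZ : Sig2 fun τ : List ℕ => ∃ x, U2 x x ∧ Conv τ Ξ.number (q x) 0 :=
    Sig2.exists (P := fun (τ : List ℕ) x => U2 x x ∧ Conv τ Ξ.number (q x) 0)
      (Sig2.and (hU.comp (f := fun x : List ℕ × ℕ => x.2) (by fun_prop)) (by fun_prop))
  obtain ⟨σ, hσ, h | h⟩ := generic hZ
  · obtain ⟨x, h1, h2⟩ := h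
    exact (h0 x).1 ((hval x 0).1 (conv_sound hσ h2)).symm h1
  · apply not_sig2_compl
    refine Sig2.of_eq (P := fun x => ∃ τ : List ℕ, σ <+: τ ∧ Conv τ Ξ.number (q x) 0)
      (by fun_prop) fun x => ?_
    constructor
    · rintro ⟨τ, h1, h2⟩ h3
      exact h τ h1 ⟨x, h3, h2⟩
    · intro hx
      obtain ⟨m, hm⟩ := conv_complete ((hval x 0).2 ((h0 x).2 hx).symm)
      have hi := isInit_map gen (m + σ.length)
      exact ⟨_, hσ.prefix_of_le hi (by simp), hm _ hi (by simp)⟩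

theorem zeroJump_lt_deg_genSet : zeroJump < deg genSet :=
  lt_of_le_not_ge (degFun_le_iff.2 jump_le_genSet) fun h => not_genSet_le_jump (degFun_le_iff.1 h)

theorem deg_genSet_lt_zeroDoubleJump : deg genSet < zeroDoubleJump :=
  lt_of_le_not_ge (degFun_le_iff.2 genSet_le_jump_jump)
    fun h => not_jump_jump_le_genSet (degFun_le_iff.1 h)

end GenericDegree

end CatDeg


namespace CatDeg

/-! ## Patterns of tuples -/

section Patterns

variable {α β γ : Type} [Primcodable α] [Primcodable β] [Primcodable γ]

@[fun_prop] theorem computable_map_fst {f : α → List (β × γ)} (hf : Computable f) :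
    Computable fun a => (f a).map Prod.fst :=
  (Primrec.list_map (f := fun l : List (β × γ) => l) (g := fun _ p => p.1) Primrec.id
    (Primrec.fst.comp Primrec.snd).to₂).to_comp.comp hf

@[fun_prop] theorem computable_map_snd {f : α → List (β × γ)} (hf : Computable f) :
    Computable fun a => (f a).map Prod.snd :=
  (Primrec.list_map (f := fun l : List (β × γ) => l) (g := fun _ p => p.2) Primrec.id
    (Primrec.snd.comp Primrec.snd).to₂).to_comp.comp hf

/-- The tuples `x` and `y` have the same length, satisfy the same equations between entries, and
the same ones among the first conditions `S`, `S'`. -/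
def PatEq (S S' : ℕ → List ℕ → Prop) (x y : List ℕ) : Prop :=
  x.length = y.length ∧
  (∀ i, i < x.length → ∀ j, j < x.length → (x.getD i 0 = x.getD j 0 ↔ y.getD i 0 = y.getD j 0)) ∧
  ∀ z, z < x.length → (S z x ↔ S' z y)

variable {S S' S'' : ℕ → List ℕ → Prop} {x y z : List ℕ}

theorem PatEq.refl (S : ℕ → List ℕ → Prop) (x : List ℕ) : PatEq S S x x :=
  ⟨rfl, fun _ _ _ _ => Iff.rfl, fun _ _ => Iff.rfl⟩

theorem PatEq.symm (h : PatEq S S' x y) : PatEq S' S y x :=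
  ⟨h.1.symm, fun i hi j hj =>
    (h.2.1 i (by have := h.1; omega) j (by have := h.1; omega)).symm,
    fun z hz => (h.2.2 z (by have := h.1; omega)).symm⟩

theorem PatEq.trans (h : PatEq S S' x y) (h' : PatEq S' S'' y z) : PatEq S S'' x z :=
  ⟨h.1.trans h'.1, fun i hi j hj => (h.2.1 i hi j hj).trans
    (h'.2.1 i (by have := h.1; omega) j (by have := h.1; omega)),
    fun k hk => (h.2.2 k hk).trans (h'.2.2 k (by have := h.1; omega))⟩

theorem PatEq.nodup (h : PatEq S S' x y) (hy : y.Nodup) : x.Nodup := by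
  rw [List.nodup_iff_injective_get] at hy ⊢
  intro i j hij
  have h1 := i.2
  have h2 := j.2
  have h3 := h.1
  have := (h.2.1 i i.2 j j.2).1 (by
    rw [List.getD_eq_getElem _ _ i.2, List.getD_eq_getElem _ _ j.2]; simpa using hij)
  rw [List.getD_eq_getElem _ _ (by omega), List.getD_eq_getElem _ _ (by omega)] at this
  have h4 := @hy ⟨i, by omega⟩ ⟨j, by omega⟩ (by simpa using this)
  exact Fin.ext (by simpa using h4)

@[fun_prop] theorem computablePred_patEq
    (hS : ComputablePred fun x : ℕ × List ℕ => S x.1 x.2)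
    (hS' : ComputablePred fun x : ℕ × List ℕ => S' x.1 x.2) {f g : α → List ℕ}
    (hf : Computable f) (hg : Computable g) : ComputablePred fun a => PatEq S S' (f a) (g a) := by
  unfold PatEq
  fun_prop

/-- Back-and-forth equivalence of `x` and `y` for one step, with tuples from `A` and `B`. -/
def Eq1 (A B : ℕ → Prop) (S S' : ℕ → List ℕ → Prop) (x y : List ℕ) : Prop :=
  (∀ c, (∀ a ∈ c, A a) → ∃ d, (∀ b ∈ d, B b) ∧ PatEq S S' (x ++ c) (y ++ d)) ∧
  (∀ d, (∀ b ∈ d, B b) → ∃ c, (∀ a ∈ c, A a) ∧ PatEq S S' (x ++ c) (y ++ d))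

/-- Two tuples of `A` matched with the same tuple of `B` are matched with each other. So maps read
from two incompatible conditions can be compared. -/
theorem Eq1.comp_symm {A B : ℕ → Prop} {x x' : List ℕ} (h : Eq1 A B S S' x y)
    (h' : Eq1 A B S S' x' y) : Eq1 A A S S x x' := by
  constructor
  · intro c hc
    obtain ⟨d, hd, h1⟩ := h.1 c hc
    obtain ⟨c', hc', h2⟩ := h'.2 d hd
    exact ⟨c', hc', h1.trans h2.symm⟩
  · intro c hc
    obtain ⟨d, hd, h1⟩ := h'.1 c hc
    obtain ⟨c', hc', h2⟩ := h.2 d hd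
    exact ⟨c', hc', h2.trans h1.symm⟩

theorem Eq1.patEq {A B : ℕ → Prop} (h : Eq1 A B S S' x y) (hl : x.length = y.length) :
    PatEq S S' x y := by
  obtain ⟨d, -, h1⟩ := h.1 [] (by simp)
  have : d = [] := by
    have := h1.1
    simp only [List.length_append, List.length_nil] at this
    exact List.length_eq_zero_iff.1 (by omega)
  simpa [this] using h1

end Patterns

/-! ## The requirement for a pair of computable structures -/

/-- The combinatorial content of an isomorphism of computable structures in the degree of the
generic set: universes `A` and `B`, atomic diagrams `SA` and `SB`, and an isomorphism `g`. -/
structure Setting where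
  A : ℕ → Prop
  B : ℕ → Prop
  SA : ℕ → List ℕ → Prop
  SB : ℕ → List ℕ → Prop
  g : ℕ → ℕ
  ψ : OracleCode
  Φ : OracleCode
  hA : ComputablePred A
  hB : ComputablePred B
  hSA : ComputablePred fun x : ℕ × List ℕ => SA x.1 x.2
  hSB : ComputablePred fun x : ℕ × List ℕ => SB x.1 x.2
  localA : ∀ z x m, z < m → (SA z (x.take m) ↔ SA z x)
  maps : ∀ a, A a → B (g a)
  inj : ∀ a a', A a → A a' → g a = g a' → a = a'
  surj : ∀ b, B b → ∃ a, A a ∧ g a = b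
  pres : ∀ x, (∀ a ∈ x, A a) → ∀ z, SA z x ↔ SB z (x.map g)
  outside : ∀ a, ¬ A a → g a = 0
  evalψ : ψ.eval (charFun genSet : ℕ →. ℕ) = (g : ℕ →. ℕ)
  evalΦ : Φ.eval (g : ℕ →. ℕ) = (charFun genSet : ℕ →. ℕ)

/-! ### What genericity says about `ψ`. -/

section SettingBasics

variable (s : Setting) {α : Type} [Primcodable α]

@[fun_prop] theorem Setting.computablePred_A {f : α → ℕ} (hf : Computable f) :
    ComputablePred fun a => s.A (f a) := computablePred_comp s.hA hf

@[fun_prop] theorem Setting.computablePred_B {f : α → ℕ} (hf : Computable f) :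
    ComputablePred fun a => s.B (f a) := computablePred_comp s.hB hf

@[fun_prop] theorem Setting.sig2_A {f : α → ℕ} (hf : Computable f) :
    Sig2 fun a => s.A (f a) := ComputablePred.sig2 (by fun_prop)

@[fun_prop] theorem Setting.computablePred_patAA {f g : α → List ℕ} (hf : Computable f)
    (hg : Computable g) : ComputablePred fun a => PatEq s.SA s.SA (f a) (g a) :=
  computablePred_patEq s.hSA s.hSA hf hg

@[fun_prop] theorem Setting.computablePred_patAB {f g : α → List ℕ} (hf : Computable f)
    (hg : Computable g) : ComputablePred fun a => PatEq s.SA s.SB (f a) (g a) :=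
  computablePred_patEq s.hSA s.hSB hf hg

theorem Setting.patEq_map {x : List ℕ} (hx : ∀ a ∈ x, s.A a) :
    PatEq s.SA s.SB x (x.map s.g) := by
  refine ⟨by simp, fun i hi j hj => ?_, fun z _ => s.pres x hx z⟩
  rw [List.getD_eq_getElem _ _ hi, List.getD_eq_getElem _ _ hj,
    List.getD_eq_getElem _ _ (by simpa using hi), List.getD_eq_getElem _ _ (by simpa using hj),
    List.getElem_map, List.getElem_map]
  exact ⟨fun h => by rw [h],
    s.inj _ _ (hx _ (List.getElem_mem hi)) (hx _ (List.getElem_mem hj))⟩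

theorem Setting.exists_preimage {d : List ℕ} (hd : ∀ b ∈ d, s.B b) :
    ∃ c : List ℕ, (∀ a ∈ c, s.A a) ∧ c.map s.g = d := by
  induction d with
  | nil => exact ⟨[], by simp, rfl⟩
  | cons b d ih =>
    obtain ⟨c, hc, rfl⟩ := ih fun b hb => hd b (List.mem_cons_of_mem _ hb)
    obtain ⟨a, ha, rfl⟩ := s.surj b (hd b List.mem_cons_self)
    refine ⟨a :: c, fun x hx => ?_, rfl⟩
    rcases List.mem_cons.1 hx with rfl | hx
    exacts [ha, hc x hx]

theorem Setting.eq1_map {x : List ℕ} (hx : ∀ a ∈ x, s.A a) :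
    Eq1 s.A s.B s.SA s.SB x (x.map s.g) := by
  constructor
  · intro c hc
    refine ⟨c.map s.g, fun b hb => ?_, ?_⟩
    · obtain ⟨a, ha, rfl⟩ := List.mem_map.1 hb
      exact s.maps a (hc a ha)
    · rw [← List.map_append]
      refine s.patEq_map fun a ha => ?_
      rcases List.mem_append.1 ha with h | h
      exacts [hx a h, hc a h]
  · intro d hd
    obtain ⟨c, hc, rfl⟩ := s.exists_preimage hd
    refine ⟨c, hc, ?_⟩
    rw [← List.map_append]
    refine s.patEq_map fun a ha => ?_
    rcases List.mem_append.1 ha with h | h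
    exacts [hx a h, hc a h]

theorem Setting.conv_ψ {τ : List ℕ} (hτ : IsInit τ gen) {a b : ℕ}
    (h : Conv τ s.ψ.number a b) : b = s.g a := by
  have h1 := conv_sound hτ h
  rw [← genSet, s.evalψ] at h1
  exact mem_coe_iff.1 h1

theorem Setting.exists_conv_ψ (a : ℕ) :
    ∃ m, ∀ τ, IsInit τ gen → m ≤ τ.length → Conv τ s.ψ.number a (s.g a) := by
  refine conv_complete (Ξ := s.ψ) (G := gen) ?_
  rw [← genSet, s.evalψ]
  exact mem_coe_iff.2 rfl

theorem Setting.exists_conv_ψ_lt (w : ℕ) :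
    ∃ m, ∀ τ, IsInit τ gen → m ≤ τ.length → ∀ a, a < w → Conv τ s.ψ.number a (s.g a) := by
  induction w with
  | zero => exact ⟨0, fun _ _ _ a ha => absurd ha (by omega)⟩
  | succ w ih =>
    obtain ⟨m, hm⟩ := ih
    obtain ⟨m', hm'⟩ := s.exists_conv_ψ w
    refine ⟨m + m', fun τ hτ hl a ha => ?_⟩
    rcases Nat.lt_succ_iff_lt_or_eq.1 ha with h | rfl
    · exact hm τ hτ (by omega) a h
    · exact hm' τ hτ (by omega)

/-- Below a suitable initial segment of the generic set, `ψ` cannot be wrong about one step of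
back-and-forth. -/
theorem Setting.exists_forcing : ∃ σ, IsInit σ gen ∧ ∀ τ, σ <+: τ → ∀ P : List (ℕ × ℕ),
    (∀ q ∈ P, s.A q.1 ∧ Conv τ s.ψ.number q.1 q.2) →
    (∀ q ∈ P, s.B q.2) ∧ Eq1 s.A s.B s.SA s.SB (P.map Prod.fst) (P.map Prod.snd) := by
  have h1 : Sig2 fun x : List (ℕ × ℕ) × List ℕ => ¬ ∃ d, (∀ b, b ∈ d → s.B b) ∧
      PatEq s.SA s.SB (x.1.map Prod.fst ++ x.2) (x.1.map Prod.snd ++ d) :=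
    (Sig1.exists (ComputablePred.sig1 (by fun_prop))).not_sig2
  have h2 : Sig2 fun x : List (ℕ × ℕ) × List ℕ => ¬ ∃ c, (∀ a, a ∈ c → s.A a) ∧
      PatEq s.SA s.SB (x.1.map Prod.fst ++ c) (x.1.map Prod.snd ++ x.2) :=
    (Sig1.exists (ComputablePred.sig1 (by fun_prop))).not_sig2
  obtain ⟨Q1, hQ1, hQ1e⟩ : ∃ Q : List (ℕ × ℕ) × List ℕ → Prop, Sig2 Q ∧ ∀ P c, Q (P, c) ↔
      ¬ ∃ d, (∀ b, b ∈ d → s.B b) ∧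
      PatEq s.SA s.SB (P.map Prod.fst ++ c) (P.map Prod.snd ++ d) := ⟨_, h1, fun _ _ => Iff.rfl⟩
  obtain ⟨Q2, hQ2, hQ2e⟩ : ∃ Q : List (ℕ × ℕ) × List ℕ → Prop, Sig2 Q ∧ ∀ P d, Q (P, d) ↔
      ¬ ∃ c, (∀ a, a ∈ c → s.A a) ∧
      PatEq s.SA s.SB (P.map Prod.fst ++ c) (P.map Prod.snd ++ d) := ⟨_, h2, fun _ _ => Iff.rfl⟩
  -- Matching a given tuple is a search, so the lack of a match for some tuple is `Σ⁰₂`. This is the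
  -- reason for allowing one step of back-and-forth only. On `gen` itself the pairs come from the
  -- isomorphism `g`, so the set is not met.
  have hZ : Sig2 fun τ : List ℕ => ∃ P : List (ℕ × ℕ),
      (∀ q, q ∈ P → s.A q.1 ∧ Conv τ s.ψ.number q.1 q.2) ∧
      ((¬ ∀ q, q ∈ P → s.B q.2) ∨ (∃ c, (∀ a, a ∈ c → s.A a) ∧ Q1 (P, c)) ∨
        (∃ d, ¬ (¬ ∀ b, b ∈ d → s.B b) ∧ Q2 (P, d))) := by
    fun_prop
  obtain ⟨σ, hσ, h | h⟩ := generic hZ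
  · exfalso
    obtain ⟨P, hP, h3⟩ := h
    have h4 : P.map Prod.snd = (P.map Prod.fst).map s.g := by
      rw [List.map_map]
      exact List.map_congr_left fun q hq => s.conv_ψ hσ (hP q hq).2
    have h5 : ∀ a ∈ P.map Prod.fst, s.A a := by
      intro a ha
      obtain ⟨q, hq, rfl⟩ := List.mem_map.1 ha
      exact (hP q hq).1
    have h6 := s.eq1_map h5
    rw [← h4] at h6
    rcases h3 with h3 | ⟨c, hc, h3⟩ | ⟨d, hd, h3⟩
    · refine h3 fun q hq => ?_
      rw [s.conv_ψ hσ (hP q hq).2]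
      exact s.maps _ (hP q hq).1
    · exact (hQ1e P c).1 h3 (h6.1 c hc)
    · exact (hQ2e P d).1 h3 (h6.2 d (not_not.1 hd))
  · refine ⟨σ, hσ, fun τ hτ P hP => ?_⟩
    have h3 := h τ hτ
    simp only [not_exists, not_and, not_or, not_not] at h3
    obtain ⟨h4, h5, h6⟩ := h3 P hP
    refine ⟨h4, fun c hc => ?_, fun d hd => ?_⟩
    · have := mt (hQ1e P c).2 (h5 c hc)
      exact not_not.1 this
    · have := mt (hQ2e P d).2 (h6 d hd)
      exact not_not.1 this

/-- Wrong computations of `ψ` are dense along the generic set. -/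
theorem Setting.exists_wrong {μ : List ℕ} (hμ : IsInit μ gen) :
    ∃ τ a b, μ <+: τ ∧ s.A a ∧ Conv τ s.ψ.number a b ∧ b ≠ s.g a := by
  by_contra hno
  push Not at hno
  apply not_sig2_graph_genSet
  -- If no extension of `μ` makes `ψ` err, values found on arbitrary extensions are values of `g`,
  -- and `Φ` applied to them describes the graph of the generic set.
  refine Sig2.of_eq (P := fun x : ℕ × ℕ => ∃ τ : List ℕ, μ <+: τ ∧
    Der (fun a b => (s.A a ∧ Conv τ s.ψ.number a b) ∨ (¬ s.A a ∧ b = 0)) s.Φ.number x.1 x.2)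
    (by fun_prop) fun x => ?_
  have hev : x.2 ∈ s.Φ.eval (s.g : ℕ →. ℕ) x.1 ↔ charFun genSet x.1 = x.2 := by
    rw [s.evalΦ, mem_coe_iff, eq_comm]
  rw [← hev]
  constructor
  · rintro ⟨τ, hτ, h⟩
    refine h.sound fun a b hab => mem_coe_iff.2 ?_
    rcases hab with ⟨h1, h2⟩ | ⟨h1, h2⟩
    · exact hno τ a b hτ h1 h2
    · rw [h2, s.outside a h1]
  · intro h
    obtain ⟨M, hM, hd⟩ := (Der.complete h).finite
    obtain ⟨w, hw⟩ := exists_list_bound Prod.fst M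
    obtain ⟨m, hm⟩ := s.exists_conv_ψ_lt w
    have hi := isInit_map gen (m + μ.length)
    refine ⟨_, hμ.prefix_of_le hi (by simp), hd.mono fun a b hab => ?_⟩
    have h1 := mem_coe_iff.1 (hM _ hab)
    simp only at h1
    subst h1
    by_cases h2 : s.A a
    · exact .inl ⟨h2, hm _ hi (by simp) a (hw _ hab)⟩
    · exact .inr ⟨h2, s.outside a h2⟩

/-- Take an initial segment of `gen` that already decides `ψ` below `w`: an error on an extension of
it has to occur at an argument not below `w`. -/
theorem Setting.infinite (w : ℕ) : ∃ a, w ≤ a ∧ s.A a := by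
  obtain ⟨m, hm⟩ := s.exists_conv_ψ_lt w
  have hi := isInit_map gen m
  obtain ⟨τ, a, b, hτ, ha, hc, hne⟩ := s.exists_wrong hi
  refine ⟨a, ?_, ha⟩
  by_contra hlt
  exact hne (hc.unique ((hm _ hi (by simp) a (by omega)).mono hτ))

end SettingBasics

/-- By stage `w` the universal c.e. set has settled up to a bound given by `s`. -/
def Settled (s w : ℕ) : Prop := ∀ n, n < Nat.pair s s + 1 → ¬ KSet n ∨ Kst n w

theorem exists_settled (s : ℕ) : ∃ w, Settled s w := by
  have : ∀ m, ∃ w, ∀ n, n < m → ¬ KSet n ∨ Kst n w := by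
    intro m
    induction m with
    | zero => exact ⟨0, fun n hn => absurd hn (by omega)⟩
    | succ m ih =>
      obtain ⟨w, hw⟩ := ih
      by_cases h : KSet m
      · obtain ⟨w', hw'⟩ := h
        refine ⟨w + w', fun n hn => ?_⟩
        rcases Nat.lt_succ_iff_lt_or_eq.1 hn with h | rfl
        · exact (hw n h).imp_right (Kst.mono (by omega))
        · exact .inr (hw'.mono (by omega))
      · refine ⟨w, fun n hn => ?_⟩
        rcases Nat.lt_succ_iff_lt_or_eq.1 hn with h' | rfl
        · exact hw n h'
        · exact .inl h
  exact this _

/-- For `s` past the index `e`, the code of `(e, s)` lies in the range that has settled by `w`, and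
its enumeration takes longer than the value `U s`. -/
theorem Settled.bound {U : ℕ → ℕ} {e : ℕ} (h1 : ∀ x, KSet (Nat.pair e x))
    (h2 : ∀ x w, Kst (Nat.pair e x) w → U x < w) {s w : ℕ} (h : Settled s w) (hs : e ≤ s) :
    U s < w := by
  have h3 : Nat.pair e s ≤ Nat.pair s s := by
    rcases Nat.lt_or_eq_of_le hs with h | rfl
    · exact (Nat.pair_lt_pair_left s h).le
    · exact le_rfl
  exact h2 s w ((h _ (by omega)).resolve_left (not_not.2 (h1 s)))

@[fun_prop] theorem sig2_settled {α : Type} [Primcodable α] {f g : α → ℕ} (hf : Computable f)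
    (hg : Computable g) : Sig2 fun a => Settled (f a) (g a) := by
  have h : Sig2 fun n => ¬ KSet n := sig1_kset.not_sig2
  obtain ⟨Q, hQ, hQe⟩ : ∃ Q : ℕ → Prop, Sig2 Q ∧ ∀ n, Q n ↔ ¬ KSet n := ⟨_, h, fun _ => Iff.rfl⟩
  unfold Settled
  simp only [← hQe]
  refine Sig2.forall_lt (by fun_prop) (Sig2.or (by fun_prop) (ComputablePred.sig2 (by fun_prop)))

/-- A default for `getD`. The length conditions in `Setting.Own` and `Moves` keep it from being read
there. -/
def move0 : Move × ℕ := (([], [], 0, 0, []), 0)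

/-- The requirement of the setting: to find and use a disagreement of `ψ`. The number `i` codes a
program, and `σ₀` is the condition below which `ψ` is reliable. -/
def Setting.Own (s : Setting) (σ₀ : List ℕ) (i : ℕ) (x : Past) (β : Move) : Prop :=
  -- First move: two strings on which `ψ` disagrees at the chosen argument but agrees up to a bound
  -- past all that was enumerated by the initialization. The program under attack converges on the
  -- first string, which becomes current.
  (x.2.2.length = 0 ∧ σ₀ <+: x.2.1 ∧ x.2.1 <+: β.1 ∧ x.2.1 <+: β.2.1 ∧ s.A β.2.2.1 ∧
    (∃ w, Settled x.1 w ∧ ∀ a, a < w + 1 → s.A a →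
      ∃ b, Conv β.1 s.ψ.number a b ∧ Conv β.2.1 s.ψ.number a b) ∧
    (∃ b b', ¬ b = b' ∧ Conv β.1 s.ψ.number β.2.2.1 b ∧ Conv β.2.1 s.ψ.number β.2.2.1 b') ∧
    Conv β.1 i.unpair.1 β.2.2.1 β.2.2.2.1) ∨
  -- Second move: `gen` is sent through the second string, because only there does it become certain
  -- that `ψ` converges on further arguments.
  (x.2.2.length = 1 ∧ β.1 = (x.2.2.getD 0 move0).1.2.1) ∨
  -- Third move: an extension of the second string with enough values of `ψ` is remembered, and
  -- `gen` returns to the first string. The bound is taken at the stage of the second move, from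
  -- which on the tuple is frozen.
  (x.2.2.length = 2 ∧ β.1 = (x.2.2.getD 0 move0).1.1 ∧ (x.2.2.getD 0 move0).1.2.1 <+: β.2.1 ∧
    ∃ w, Settled (x.2.2.getD 1 move0).2 w ∧ ∀ a, a < w + 1 → s.A a →
      ∃ b, Conv β.2.1 s.ψ.number a b) ∨
  -- Fourth move: `gen` has passed far enough above the first string to find, for each remembered
  -- value, an argument that `ψ` sends to it. The pairs form the partial map of `A`.
  (x.2.2.length = 3 ∧ (x.2.2.getD 0 move0).1.1 <+: β.1 ∧
    (∀ q, q ∈ β.2.2.2.2 → s.A q.1 ∧ s.A q.2 ∧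
      ∃ b, Conv (x.2.2.getD 2 move0).1.2.1 s.ψ.number q.1 b ∧ Conv β.1 s.ψ.number q.2 b) ∧
    ∃ w, Settled (x.2.2.getD 1 move0).2 w ∧ ∀ a, a < w + 1 → s.A a → ∃ a', (a, a') ∈ β.2.2.2.2)

theorem Setting.sig2_own (s : Setting) (σ₀ : List ℕ) :
    Sig2 fun x : ℕ × Past × Move => s.Own σ₀ x.1 x.2.1 x.2.2 := by
  unfold Setting.Own
  refine Sig2.or ?_ (Sig2.or ?_ (Sig2.or ?_ ?_)) <;> fun_prop

/-- The moves of a past were justified. -/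
def Setting.GoodPast (s : Setting) (σ₀ : List ℕ) (i : ℕ) (x : Past) : Prop :=
  ∀ (j : ℕ) (m : Move × ℕ), x.2.2[j]? = some m → s.Own σ₀ i (x.1, x.2.1, x.2.2.take j) m.1

/-- The condition `σ₀` forces the correctness of `ψ`. -/
def Setting.Forces (s : Setting) (σ₀ : List ℕ) : Prop := ∀ τ, σ₀ <+: τ → ∀ P : List (ℕ × ℕ),
    (∀ q ∈ P, s.A q.1 ∧ Conv τ s.ψ.number q.1 q.2) →
    (∀ q ∈ P, s.B q.2) ∧ Eq1 s.A s.B s.SA s.SB (P.map Prod.fst) (P.map Prod.snd)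

/-! ### Justified moves and what four of them achieve. -/

section OwnLemmas

variable {s : Setting} {σ₀ : List ℕ} {i : ℕ} {x : Past}

theorem Setting.GoodPast.own (h : s.GoodPast σ₀ i x) {j : ℕ} (hj : j < x.2.2.length) :
    s.Own σ₀ i (x.1, x.2.1, x.2.2.take j) (x.2.2.getD j move0).1 := by
  refine h j _ ?_
  rw [List.getD_eq_getElem _ _ hj, List.getElem?_eq_getElem hj]

theorem getD_take_move {h : List (Move × ℕ)} {i j : ℕ} (hij : i < j) :
    (h.take j).getD i move0 = h.getD i move0 := by
  rw [List.getD_eq_getElem?_getD, List.getElem?_take_of_lt hij, ← List.getD_eq_getElem?_getD]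

theorem Setting.GoodPast.own_zero (h : s.GoodPast σ₀ i x) (hj : 0 < x.2.2.length) {β : Move}
    (hβ : (x.2.2.getD 0 move0).1 = β) : σ₀ <+: x.2.1 ∧ x.2.1 <+: β.1 ∧ x.2.1 <+: β.2.1 ∧
    s.A β.2.2.1 ∧
    (∃ w, Settled x.1 w ∧ ∀ a, a < w + 1 → s.A a →
      ∃ b, Conv β.1 s.ψ.number a b ∧ Conv β.2.1 s.ψ.number a b) ∧
    (∃ b b', ¬ b = b' ∧ Conv β.1 s.ψ.number β.2.2.1 b ∧ Conv β.2.1 s.ψ.number β.2.2.1 b') ∧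
    Conv β.1 i.unpair.1 β.2.2.1 β.2.2.2.1 := by
  have h1 := h.own hj
  rw [hβ] at h1
  have h2 : (x.2.2.take 0).length = 0 := by simp
  rcases h1 with h1 | h1 | h1 | h1
  · exact h1.2
  all_goals exact absurd h1.1 (by simp)

theorem Setting.GoodPast.own_one (h : s.GoodPast σ₀ i x) (hj : 1 < x.2.2.length) :
    (x.2.2.getD 1 move0).1.1 = (x.2.2.getD 0 move0).1.2.1 := by
  have h1 := h.own hj
  have h2 : (x.2.2.take 1).length = 1 := by simp; omega
  rcases h1 with h1 | h1 | h1 | h1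
  · exact absurd (h2.symm.trans h1.1) (by omega)
  · rw [h1.2, getD_take_move (by omega)]
  all_goals exact absurd (h2.symm.trans h1.1) (by omega)

theorem Setting.GoodPast.own_two (h : s.GoodPast σ₀ i x) (hj : 2 < x.2.2.length) {β : Move}
    (hβ : (x.2.2.getD 2 move0).1 = β) : β.1 = (x.2.2.getD 0 move0).1.1 ∧
    (x.2.2.getD 0 move0).1.2.1 <+: β.2.1 ∧
    ∃ w, Settled (x.2.2.getD 1 move0).2 w ∧ ∀ a, a < w + 1 → s.A a →
      ∃ b, Conv β.2.1 s.ψ.number a b := by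
  have h1 := h.own hj
  have h2 : (x.2.2.take 2).length = 2 := by simp; omega
  rcases h1 with h1 | h1 | h1 | h1
  · exact absurd (h2.symm.trans h1.1) (by omega)
  · exact absurd (h2.symm.trans h1.1) (by omega)
  · have := h1.2
    rwa [hβ, getD_take_move (by omega), getD_take_move (by omega)] at this
  · exact absurd (h2.symm.trans h1.1) (by omega)

theorem Setting.GoodPast.own_three (h : s.GoodPast σ₀ i x) (hj : 3 < x.2.2.length) {β : Move}
    (hβ : (x.2.2.getD 3 move0).1 = β) : (x.2.2.getD 0 move0).1.1 <+: β.1 ∧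
    (∀ q, q ∈ β.2.2.2.2 → s.A q.1 ∧ s.A q.2 ∧
      ∃ b, Conv (x.2.2.getD 2 move0).1.2.1 s.ψ.number q.1 b ∧ Conv β.1 s.ψ.number q.2 b) ∧
    ∃ w, Settled (x.2.2.getD 1 move0).2 w ∧ ∀ a, a < w + 1 → s.A a →
      ∃ a', (a, a') ∈ β.2.2.2.2 := by
  have h1 := h.own hj
  have h2 : (x.2.2.take 3).length = 3 := by simp; omega
  rcases h1 with h1 | h1 | h1 | h1
  · exact absurd (h2.symm.trans h1.1) (by omega)
  · exact absurd (h2.symm.trans h1.1) (by omega)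
  · exact absurd (h2.symm.trans h1.1) (by omega)
  · have := h1.2
    rwa [hβ, getD_take_move (by omega), getD_take_move (by omega), getD_take_move (by omega)]
      at this

/-- The relation of a completed past. -/
def rel (x : Past) : List (ℕ × ℕ) := (x.2.2.getD 3 move0).1.2.2.2.2

/-- What a completed requirement has achieved. -/
structure Setting.Completed (s : Setting) (i : ℕ) (x : Past) : Prop where
  conv : Conv (x.2.2.getD 3 move0).1.1 i.unpair.1 (x.2.2.getD 0 move0).1.2.2.1
    (x.2.2.getD 0 move0).1.2.2.2.1
  moves : ∀ z, ((x.2.2.getD 0 move0).1.2.2.1, z) ∈ rel x → z ≠ (x.2.2.getD 0 move0).1.2.2.1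
  fixes : ∃ w, Settled x.1 w ∧ ∀ a z, a < w + 1 → (a, z) ∈ rel x → z = a
  covers : ∃ w, Settled (x.2.2.getD 1 move0).2 w ∧ ∀ a, a < w + 1 → s.A a →
    ∃ z, (a, z) ∈ rel x
  mem : ∀ q ∈ rel x, s.A q.1 ∧ s.A q.2
  eq1 : ∀ Q : List (ℕ × ℕ), (∀ q ∈ Q, q ∈ rel x) →
    Eq1 s.A s.A s.SA s.SA (Q.map Prod.fst) (Q.map Prod.snd)

/-- Each pair of the relation consists of arguments with one common value of `ψ`, the first read
above the second string and the second above the first. Disagreement at the chosen argument makes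
the relation move it. Agreement up to the bound, with the injectivity forced by `σ₀`, makes it fix
what lies below. Both sides match the same tuple of `B`, hence each other. -/
theorem Setting.GoodPast.completed (hf : s.Forces σ₀) (h : s.GoodPast σ₀ i x)
    (h4 : x.2.2.length = 4) : s.Completed i x := by
  obtain ⟨h01, h02, h03, h04, h05, ⟨b₀, b₁, h06, h07, h08⟩, h09⟩ := h.own_zero (by omega) rfl
  obtain ⟨h21, h22, h23⟩ := h.own_two (by omega) rfl
  obtain ⟨h31, h32, h33⟩ := h.own_three (by omega) rfl
  set β₀ := (x.2.2.getD 0 move0).1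
  set β₂ := (x.2.2.getD 2 move0).1
  set β₃ := (x.2.2.getD 3 move0).1 with hβ₃
  have hσ₃ : σ₀ <+: β₃.1 := h01.trans (h02.trans h31)
  have hσ₂ : σ₀ <+: β₂.2.1 := h01.trans (h03.trans h22)
  have hrel : rel x = β₃.2.2.2.2 := rfl
  -- Injectivity is part of one-step equivalence: the pairs `(a, b)` and `(a', b)` have equal second
  -- entries, so the first entries are equal.
  have hone : ∀ {τ a a' b}, σ₀ <+: τ → s.A a → s.A a' → Conv τ s.ψ.number a b →
      Conv τ s.ψ.number a' b → a = a' := by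
    intro τ a a' b hτ ha ha' hc hc'
    have h1 := (hf τ hτ [(a, b), (a', b)] (by simp [ha, ha', hc, hc'])).2.patEq (by simp)
    simpa using h1.2.1 0 (by simp) 1 (by simp)
  refine ⟨h09.mono h31, ?_, ?_, ?_, ?_, ?_⟩
  · intro z hz hza
    rw [hza, hrel] at hz
    obtain ⟨-, -, b, h1, h2⟩ := h32 _ hz
    have h3 := (h08.mono h22).unique h1
    have h4 := (h07.mono h31).unique h2
    exact h06 (h4.trans h3.symm)
  · obtain ⟨w, hw, h1⟩ := h05
    refine ⟨w, hw, fun a z haw haz => ?_⟩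
    rw [hrel] at haz
    obtain ⟨h2, h3, b, h5, h6⟩ := h32 _ haz
    obtain ⟨b', h7, h8⟩ := h1 a haw h2
    have h9 := (h8.mono h22).unique h5
    rw [h9] at h7
    exact hone hσ₃ h3 h2 h6 (h7.mono h31)
  · exact h33
  · intro q hq
    exact ⟨(h32 q hq).1, (h32 q hq).2.1⟩
  · intro Q hQ
    choose! b hb hb' using fun q hq => (h32 q (hQ q hq)).2.2
    have h1 := (hf _ hσ₂ (Q.map fun q => (q.1, b q)) (by
      intro r hr
      obtain ⟨q, hq, rfl⟩ := List.mem_map.1 hr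
      exact ⟨(h32 q (hQ q hq)).1, hb q hq⟩)).2
    have h2 := (hf _ hσ₃ (Q.map fun q => (q.2, b q)) (by
      intro r hr
      obtain ⟨q, hq, rfl⟩ := List.mem_map.1 hr
      exact ⟨(h32 q (hQ q hq)).2.1, hb' q hq⟩)).2
    simp only [List.map_map] at h1 h2
    exact h1.comp_symm h2

end OwnLemmas

/-! ### The final outcome of the requirement -/

section Outcome

variable {s : Setting} {σ₀ : List ℕ} {p : ℕ}

/-- `p` is an index of the requirement. -/
def Setting.IsIndex (s : Setting) (σ₀ : List ℕ) (p : ℕ) : Prop :=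
  ∀ i x β, Req (Nat.pair p i) x β ↔ s.Own σ₀ i x β

theorem Setting.exists_isIndex (s : Setting) (σ₀ : List ℕ) : ∃ p, s.IsIndex σ₀ p :=
  exists_req (s.sig2_own σ₀)

theorem Setting.IsIndex.goodPast_of_tru (hp : s.IsIndex σ₀ p) {t e : ℕ} (ht : Tru t)
    (he : e < (stg t).length) (hpe : e.unpair.1 = p) :
    s.GoodPast σ₀ e.unpair.2 ((stg t).getD e rec0).2 := by
  intro j m hm
  obtain ⟨-, h1, -, h2⟩ := (goodRec_stg t e he).hist j m hm
  have h3 := (ht.of_bel h1).u2_of_sees h2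
  rw [← hp, ← hpe, Nat.pair_unpair]
  exact h3

theorem Setting.IsIndex.goodPast (hp : s.IsIndex σ₀ p) (i : ℕ) :
    s.GoodPast σ₀ i (finRec (Nat.pair p i)).2 := by
  intro j m hm
  exact (hp _ _ _).1 (finRec_hist hm)

/-- A requirement that has moved once cannot stop before its fourth move. The second move is always
available, and the others become available because `gen` now runs through the string on which
convergence of `ψ` is wanted. -/
theorem Setting.IsIndex.final_length (hp : s.IsIndex σ₀ p) (hf : s.Forces σ₀) (i : ℕ) :
    (finRec (Nat.pair p i)).2.2.2.length = 0 ∨ (finRec (Nat.pair p i)).2.2.2.length = 4 := by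
  set e := Nat.pair p i
  have hgp : s.GoodPast σ₀ i (finRec e).2 := hp.goodPast i
  have hgood := goodRec_finRec e
  have hle := hgood.length_le
  by_contra hno
  have hpos : 0 < (finRec e).2.2.2.length := by omega
  obtain ⟨h01, h02, h03, -, -, -, -⟩ := hgp.own_zero hpos rfl
  have hcur : ∀ j, j + 1 = (finRec e).2.2.2.length →
      IsInit ((finRec e).2.2.2.getD j move0).1.1 gen := by
    intro j hj
    rw [← hgood.cur_last j ((finRec e).2.2.2.getD j move0) (by
      rw [List.getD_eq_getElem _ _ (by omega), List.getElem?_eq_getElem (by omega)]) hj]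
    exact isInit_finRec e
  have hlen : (finRec e).2.2.2.length = 1 ∨ (finRec e).2.2.2.length = 2 ∨
      (finRec e).2.2.2.length = 3 := by omega
  rcases hlen with hlen | hlen | hlen
  · refine finRec_no_move (e := e) (by omega)
      (β := (((finRec e).2.2.2.getD 0 move0).1.2.1, [], 0, 0, [])) h03 ?_
    exact (hp _ _ _).2 (.inr (.inl ⟨hlen, rfl⟩))
  -- The current string is now the second one, so it lies on `gen`, where `ψ` computes the total
  -- function `g`.
  · have hc := hcur 1 (by omega)
    rw [hgp.own_one (by omega)] at hc
    obtain ⟨w, hw⟩ := exists_settled ((finRec e).2.2.2.getD 1 move0).2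
    obtain ⟨m, hm⟩ := s.exists_conv_ψ_lt (w + 1)
    have hi := isInit_map gen (m + (((finRec e).2.2.2.getD 0 move0).1.2.1).length)
    refine finRec_no_move (e := e) (by omega) (β := (((finRec e).2.2.2.getD 0 move0).1.1,
      (List.range (m + (((finRec e).2.2.2.getD 0 move0).1.2.1).length)).map gen, 0, 0, [])) h02 ?_
    refine (hp _ _ _).2 (.inr (.inr (.inl ⟨hlen, rfl, hc.prefix_of_le hi (by simp), w, hw, ?_⟩)))
    intro a ha _
    exact ⟨_, hm _ hi (by simp) a ha⟩
  · have hc := hcur 2 (by omega)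
    obtain ⟨h21, h22, w, hw, h23⟩ := hgp.own_two (by omega) rfl
    rw [h21] at hc
    choose! b hb using h23
    have hσ : σ₀ <+: ((finRec e).2.2.2.getD 2 move0).1.2.1 := h01.trans (h03.trans h22)
    -- Forcing puts the remembered values in the universe of `B`, so `g` takes them, and `ψ` along
    -- `gen` will show this.
    have hpre : ∀ a, ∃ a', a < w + 1 → s.A a → s.A a' ∧ s.g a' = b a := by
      intro a
      by_cases h : a < w + 1 ∧ s.A a
      · have h1 := (hf _ hσ [(a, b a)] (by simpa using ⟨h.2, hb a h.1 h.2⟩)).1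
        obtain ⟨a', h2, h3⟩ := s.surj (b a) (by simpa using h1)
        exact ⟨a', fun _ _ => ⟨h2, h3⟩⟩
      · exact ⟨0, fun h1 h2 => absurd ⟨h1, h2⟩ h⟩
    choose f hf' using hpre
    classical
    set ρ : List (ℕ × ℕ) := ((List.range (w + 1)).filter fun a => s.A a).map
      fun a => (a, f a) with hρ
    have hmem : ∀ a, a < w + 1 → s.A a → (a, f a) ∈ ρ := by
      intro a h1 h2
      exact List.mem_map.2 ⟨a, by simpa using ⟨Nat.le_of_lt_succ h1, h2⟩, rfl⟩
    obtain ⟨n, hn⟩ := exists_list_bound Prod.snd ρ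
    obtain ⟨m, hm⟩ := s.exists_conv_ψ_lt n
    have hi := isInit_map gen (m + (((finRec e).2.2.2.getD 0 move0).1.1).length)
    have hτ := hc.prefix_of_le hi (by simp)
    refine finRec_no_move (e := e) (by omega) (β := (_, [], 0, 0, ρ)) (h02.trans hτ) ?_
    refine (hp _ _ _).2 (.inr (.inr (.inr ⟨hlen, hτ, ?_, w, hw, ?_⟩)))
    · intro q hq
      have hqn := hn q hq
      obtain ⟨a, ha, rfl⟩ := List.mem_map.1 hq
      obtain ⟨ha1, ha2⟩ : a < w + 1 ∧ s.A a := by simpa using ha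
      obtain ⟨h1, h2⟩ := hf' a ha1 ha2
      refine ⟨ha2, h1, b a, hb a ha1 ha2, ?_⟩
      have := hm _ hi (by simp) (f a) hqn
      rwa [h2] at this
    · exact fun a h1 h2 => ⟨f a, hmem a h1 h2⟩

/-- A program that would compute an isomorphism from the generic set is defeated. -/
theorem Setting.IsIndex.final_length_eq (hp : s.IsIndex σ₀ p) (hf : s.Forces σ₀) {i : ℕ}
    {Ξ : OracleCode} (hΞ : i.unpair.1 = Ξ.number)
    (hσ : σ₀ <+: (finRec (Nat.pair p i)).2.2.1)
    (htot : ∀ a, s.A a → ∃ v, v ∈ Ξ.eval (charFun genSet : ℕ →. ℕ) a) :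
    (finRec (Nat.pair p i)).2.2.2.length = 4 := by
  refine (hp.final_length hf i).resolve_left fun h0 => ?_
  set e := Nat.pair p i
  obtain ⟨w, hw⟩ := exists_settled (finRec e).2.1
  obtain ⟨m, hm⟩ := s.exists_conv_ψ_lt (w + 1)
  have hi := isInit_map gen (m + (finRec e).2.2.1.length)
  obtain ⟨τ, a, b, hτ, ha, hab, hne⟩ := s.exists_wrong hi
  obtain ⟨v, hv⟩ := htot a ha
  obtain ⟨m₁, hm₁⟩ := conv_complete hv
  obtain ⟨m₂, hm₂⟩ := s.exists_conv_ψ a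
  have hi' := isInit_map gen (m + m₁ + m₂ + (finRec e).2.2.1.length)
  have hpre := (isInit_finRec_str e).prefix_of_le hi' (by simp)
  -- The first string is an initial segment of `gen` and the second is where `ψ` errs. They agree on
  -- small arguments because both extend a segment that decides these.
  refine finRec_no_move (e := e) (by omega) (β := (_, τ, a, v, [])) hpre ?_
  refine (hp _ _ _).2 (.inl ⟨h0, hσ, hpre,
    ((isInit_finRec_str e).prefix_of_le hi (by simp)).trans hτ, ha, ⟨w, hw, ?_⟩,
    ⟨s.g a, b, hne.symm, hm₂ _ hi' (by simp; omega), hab⟩, ?_⟩)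
  · intro a' ha' _
    exact ⟨_, hm _ hi' (by simp; omega) a' ha', (hm _ hi (by simp) a' ha').mono hτ⟩
  · change Conv _ i.unpair.1 a v
    rw [hΞ]
    exact hm₁ _ hi' (by simp; omega)

end Outcome

end CatDeg


namespace CatDeg

/-! ## The enumeration of the new structure -/

/-! ### Recursion through unbounded searches. -/

section CourseSearch

variable {σ : Type} [Primcodable σ]

open Classical in
/-- The value found by an unbounded search. -/
noncomputable def searchStep (Q : List σ → ℕ → Prop) (G : List σ → ℕ → σ) (d : List σ → σ)
    (l : List σ) : σ :=
  if h : ∃ u, Q l u then G l (Nat.find h) else d l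

/-- Course-of-values recursion by a search that always succeeds is computable. -/
theorem computable_courseRec_search {Q : List σ → ℕ → Prop} {G : List σ → ℕ → σ}
    {d : List σ → σ} (hQ : ComputablePred fun x : List σ × ℕ => Q x.1 x.2)
    (hG : Computable fun x : List σ × ℕ => G x.1 x.2)
    (h : ∀ t, ∃ u, Q (courseList (searchStep Q G d) t) u) :
    Computable (courseRec (searchStep Q G d)) := by
  classical
  have hp : Partrec fun l : List σ => (Nat.rfind fun u => Part.some (decide (Q l u))).map
      fun u => G l u := by
    refine Partrec.map (Partrec.rfind ?_) hG.to₂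
    exact hQ.decide.partrec.to₂
  have hmem : ∀ t, searchStep Q G d (courseList (searchStep Q G d) t) ∈
      (Nat.rfind fun u => Part.some (decide (Q (courseList (searchStep Q G d) t) u))).map
        fun u => G (courseList (searchStep Q G d) t) u := by
    intro t
    have e : searchStep Q G d (courseList (searchStep Q G d) t) =
        G (courseList (searchStep Q G d) t) (Nat.find (h t)) := dif_pos (h t)
    rw [e]
    refine (Part.mem_map_iff _).2 ⟨Nat.find (h t), Nat.mem_rfind.2 ⟨?_, ?_⟩, rfl⟩
    · exact Part.mem_some_iff.2 (by simpa using Nat.find_spec (h t))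
    · intro m hm
      exact Part.mem_some_iff.2 (by simpa using Nat.find_min (h t) hm)
  have hrec := Partrec.nat_rec (f := fun t : ℕ => t) (g := fun _ => Part.some ([] : List σ))
    (h := fun _ (p : ℕ × List σ) => ((Nat.rfind fun u => Part.some (decide (Q p.2 u))).map
        fun u => G p.2 u).map fun y => p.2 ++ [y]) Computable.id
    (Computable.const []).partrec (by
      have h2 : Computable₂ fun (x : ℕ × ℕ × List σ) (y : σ) => x.2.2 ++ [y] :=
        Computable.to₂ (f := fun z : (ℕ × ℕ × List σ) × σ => z.1.2.2 ++ [z.2]) (by fun_prop)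
      exact ((hp.comp (Computable.snd.comp Computable.snd)).map h2).to₂)
  have hlist : Computable (courseList (searchStep Q G d)) := by
    refine hrec.of_eq fun t => Part.eq_some_iff.2 ?_
    induction t with
    | zero => exact Part.mem_some _
    | succ t ih =>
      exact Part.mem_bind_iff.2 ⟨_, ih, (Part.mem_map_iff _).2 ⟨_, hmem t, rfl⟩⟩
  refine (hp.comp hlist).of_eq fun t => Part.eq_some_iff.2 (hmem t)

end CourseSearch

/-! ### Records guiding the choice of the next tuple. -/

section Enumeration

variable (s : Setting) (p : ℕ)

/-- The last record. -/
def lastRec (S : List Rec) : Rec := S.getD (S.length - 1) rec0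

/-- Some requirement with index `p` waits for its third or fourth move. -/
def Frozen (S : List Rec) : Prop :=
  ∃ e, e < S.length ∧ (e.unpair.1 = p ∧
    ((S.getD e rec0).2.2.2.length = 2 ∨ (S.getD e rec0).2.2.2.length = 3))

/-- The last record is a completed one, and has to change the tuple `y`. -/
def Moves (S : List Rec) (y : List ℕ) : Prop :=
  (S.length - 1).unpair.1 = p ∧ (lastRec S).2.2.2.length = 4 ∧
    y[((lastRec S).2.2.2.getD 0 move0).1.2.2.2.1]? =
      some ((lastRec S).2.2.2.getD 0 move0).1.2.2.1 ∧
    ∀ b, b ∈ y → ∃ q, q ∈ rel (lastRec S).2 ∧ q.1 = b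

/-- The next tuple is related to the last one. -/
def Link (S : List Rec) (y : List ℕ) (a b : ℕ) : Prop :=
  (Moves p S y ∧ (a, b) ∈ rel (lastRec S).2) ∨ (¬ Moves p S y ∧ a = b)

variable {α : Type} [Primcodable α]

@[fun_prop] theorem computablePred_frozen {S : α → List Rec} (hS : Computable S) :
    ComputablePred fun a => Frozen p (S a) := by
  unfold Frozen
  fun_prop

@[fun_prop] theorem computablePred_moves {S : α → List Rec} {y : α → List ℕ} (hS : Computable S)
    (hy : Computable y) : ComputablePred fun a => Moves p (S a) (y a) := by
  unfold Moves rel lastRec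
  fun_prop

@[fun_prop] theorem computablePred_link {S : α → List Rec} {y : α → List ℕ} {a b : α → ℕ}
    (hS : Computable S) (hy : Computable y) (ha : Computable a) (hb : Computable b) :
    ComputablePred fun x => Link p (S x) (y x) (a x) (b x) := by
  unfold Link rel lastRec
  fun_prop

/-- The current tuple, and the tuple that approximates the true enumeration. -/
abbrev Tuples := List ℕ × List ℕ

def prevAll (l : List Tuples) : List ℕ := (l.getD (l.length - 1) ([], [])).1

noncomputable def prevTrue (l : List Tuples) : List ℕ := (l.getD (prd l.length) ([], [])).2

/-- `x` is suitable as the next tuple, with witnesses coded by numbers below `u`. -/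
def Cand (l : List Tuples) (x : List ℕ) (u : ℕ) : Prop :=
  (∀ a, a ∈ x → s.A a) ∧ x.Nodup ∧ l.length ≤ x.length ∧ (prevAll l).length ≤ x.length ∧
  (∀ n, n < l.length → s.A n → n ∈ x) ∧
  PatEq s.SA s.SA (x.take (prevAll l).length) (prevAll l) ∧
  (∀ r, r < l.length → Bel r l.length → ∃ k, k < u ∧
    ∃ c, (Encodable.decode k : Option (List ℕ)) = some c ∧ (∀ a, a ∈ c → s.A a) ∧
    PatEq s.SA s.SA ((l.getD r ([], [])).2 ++ c) x) ∧
  ∀ i, i < (prevTrue l).length →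
    i < x.length ∧ Link p (stg l.length) (prevTrue l) ((prevTrue l).getD i 0) (x.getD i 0)

@[fun_prop] theorem computablePred_cand {l : α → List Tuples} {x : α → List ℕ} {u : α → ℕ}
    (hl : Computable l) (hx : Computable x) (hu : Computable u) :
    ComputablePred fun a => Cand s p (l a) (x a) (u a) := by
  have : ComputablePred fun z : List Tuples × List ℕ × ℕ => Cand s p z.1 z.2.1 z.2.2 := by
    unfold Cand prevAll prevTrue
    fun_prop
  exact computablePred_comp this (f := fun a => (l a, x a, u a)) (by fun_prop)

def tupleOf (u : ℕ) : List ℕ := (Encodable.decode u.unpair.1 : Option (List ℕ)).getD []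

@[fun_prop] theorem computable_tupleOf {f : α → ℕ} (hf : Computable f) :
    Computable fun a => tupleOf (f a) := by
  unfold tupleOf; fun_prop

/-- The search for the next tuple ends. -/
def Stop (l : List Tuples) (u : ℕ) : Prop :=
  Frozen p (stg l.length) ∨ (l.length ≤ u ∧ ¬ Bel l.length u) ∨ Cand s p l (tupleOf u) u

open Classical in
noncomputable def stopVal (l : List Tuples) (u : ℕ) : Tuples :=
  if ¬ Frozen p (stg l.length) ∧ Cand s p l (tupleOf u) u then (tupleOf u, tupleOf u)
  else (prevAll l, prevTrue l)

/-- The tuples of the enumeration. -/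
noncomputable def tuples : ℕ → Tuples :=
  courseRec (searchStep (Stop s p) (stopVal s p) fun l => (prevAll l, prevTrue l))

theorem computable_tuples
    (h : ∀ t, ∃ u, Stop s p (courseList (searchStep (Stop s p) (stopVal s p)
      fun l => (prevAll l, prevTrue l)) t) u) : Computable (tuples s p) := by
  refine computable_courseRec_search ?_ ?_ h
  · unfold Stop
    fun_prop
  · unfold stopVal prevAll prevTrue
    fun_prop

/-- All the tuples before stage `t`. -/
noncomputable def past (t : ℕ) : List Tuples :=
  courseList (searchStep (Stop s p) (stopVal s p) fun l => (prevAll l, prevTrue l)) t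

@[simp] theorem length_past (t : ℕ) : (past s p t).length = t := length_courseList _ _

theorem past_getD {t r : ℕ} (h : r < t) : (past s p t).getD r ([], []) = tuples s p r :=
  courseList_getD _ h _

noncomputable def preAll (t : ℕ) : List ℕ := prevAll (past s p t)

noncomputable def preTrue (t : ℕ) : List ℕ := prevTrue (past s p t)

theorem preAll_zero : preAll s p 0 = [] := rfl

theorem preAll_succ (t : ℕ) : preAll s p (t + 1) = (tuples s p t).1 := by
  rw [preAll, prevAll, length_past, Nat.add_sub_cancel, past_getD s p (Nat.lt_succ_self t)]

theorem preTrue_zero : preTrue s p 0 = [] := rfl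

theorem preTrue_pos {t : ℕ} (ht : 0 < t) : preTrue s p t = (tuples s p (prd t)).2 := by
  rw [preTrue, prevTrue, length_past, past_getD s p (prd_lt ht)]

/-- `x` is suitable as the tuple of stage `t`. -/
structure Suitable (t : ℕ) (x : List ℕ) : Prop where
  mem : ∀ a ∈ x, s.A a
  nodup : x.Nodup
  le_length : t ≤ x.length
  pre_length : (preAll s p t).length ≤ x.length
  covers : ∀ n, n < t → s.A n → n ∈ x
  -- The diagram announced so far is kept, including what was announced at false stages.
  pat : PatEq s.SA s.SA (x.take (preAll s p t).length) (preAll s p t)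
  -- If only `r` turns out to be true, its tuple can be extended so as to realize what has been
  -- announced since.
  back : ∀ r, r < t → Bel r t → ∃ c, (∀ a ∈ c, s.A a) ∧
    PatEq s.SA s.SA ((tuples s p r).2 ++ c) x
  link : ∀ i, i < (preTrue s p t).length → i < x.length ∧
    Link p (stg t) (preTrue s p t) ((preTrue s p t).getD i 0) (x.getD i 0)

variable {s p}

theorem Cand.suitable {t u : ℕ} {x : List ℕ} (h : Cand s p (past s p t) x u) :
    Suitable s p t x := by
  obtain ⟨h1, h2, h3, h4, h5, h6, h7, h8⟩ := h
  rw [length_past] at h3 h5 h7 h8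
  refine ⟨h1, h2, h3, h4, h5, h6, fun r hr hb => ?_, h8⟩
  obtain ⟨k, -, c, -, h9, h10⟩ := h7 r hr hb
  rw [past_getD s p hr] at h10
  exact ⟨c, h9, h10⟩

/-- Only the bound on the codes of the witnesses is missing: finitely many stages need one, and the
second half of the code supplies it. -/
theorem Suitable.exists_cand {t : ℕ} {x : List ℕ} (h : Suitable s p t x) :
    ∃ u, Cand s p (past s p t) (tupleOf u) u := by
  have h1 : ∀ m, m ≤ t → ∃ K, ∀ r, r < m → Bel r t → ∃ k, k < K ∧
      ∃ c, (Encodable.decode k : Option (List ℕ)) = some c ∧ (∀ a, a ∈ c → s.A a) ∧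
      PatEq s.SA s.SA ((tuples s p r).2 ++ c) x := by
    intro m hm
    induction m with
    | zero => exact ⟨0, fun r hr => absurd hr (by omega)⟩
    | succ m ih =>
      obtain ⟨K, hK⟩ := ih (by omega)
      by_cases hb : Bel m t
      · obtain ⟨c, hc, hp⟩ := h.back m (by omega) hb
        refine ⟨K + Encodable.encode c + 1, fun r hr hb' => ?_⟩
        rcases Nat.lt_succ_iff_lt_or_eq.1 hr with hr | rfl
        · obtain ⟨k, hk, h2⟩ := hK r hr hb'
          exact ⟨k, by omega, h2⟩
        · exact ⟨Encodable.encode c, by omega, c, by simp, hc, hp⟩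
      · refine ⟨K, fun r hr hb' => ?_⟩
        rcases Nat.lt_succ_iff_lt_or_eq.1 hr with hr | rfl
        · exact hK r hr hb'
        · exact absurd hb' hb
  obtain ⟨K, hK⟩ := h1 t le_rfl
  refine ⟨Nat.pair (Encodable.encode x) K, ?_⟩
  have h2 : tupleOf (Nat.pair (Encodable.encode x) K) = x := by simp [tupleOf]
  rw [h2]
  refine ⟨h.mem, h.nodup, ?_, h.pre_length, ?_, h.pat, ?_, ?_⟩
  · rw [length_past]; exact h.le_length
  · rw [length_past]; exact h.covers
  · rw [length_past]
    intro r hr hb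
    obtain ⟨k, hk, h3⟩ := hK r hr hb
    rw [past_getD s p hr]
    exact ⟨k, hk.trans_le (Nat.right_le_pair _ _), h3⟩
  · rw [length_past]; exact h.link

/-- The two cases in the definition of a tuple. -/
theorem tuples_cases (t : ℕ) : tuples s p t = (preAll s p t, preTrue s p t) ∨
    (¬ Frozen p (stg t) ∧ ∃ x, Suitable s p t x ∧ tuples s p t = (x, x)) := by
  classical
  rw [tuples, courseRec, ← past, searchStep]
  split_ifs with h
  · rw [stopVal]
    split_ifs with h1
    · rw [length_past] at h1
      exact .inr ⟨h1.1, _, h1.2.suitable, rfl⟩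
    · exact .inl rfl
  · exact .inl rfl

theorem tuples_of_frozen {t : ℕ} (h : Frozen p (stg t)) :
    tuples s p t = (preAll s p t, preTrue s p t) :=
  tuples_cases t |>.resolve_right fun h1 => h1.1 h

/-- At a false stage the search ends when a later stage refutes the belief in `t`. Hence suitability
is needed only at true stages. -/
theorem Stop.exists_of_suitable {t : ℕ} (h : Tru t → ¬ Frozen p (stg t) → ∃ x, Suitable s p t x) :
    ∃ u, Stop s p (past s p t) u := by
  unfold Stop
  rw [length_past]
  by_cases hf : Frozen p (stg t)
  · exact ⟨0, .inl hf⟩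
  by_cases ht : Tru t
  · obtain ⟨x, hx⟩ := h ht hf
    obtain ⟨u, hu⟩ := hx.exists_cand
    exact ⟨u, .inr (.inr hu)⟩
  · have : ∃ u, t ≤ u ∧ ¬ Bel t u := by
      by_contra hno
      push Not at hno
      exact ht fun q hq => (hno q hq).kk_le
    obtain ⟨u, hu⟩ := this
    exact ⟨u, .inr (.inl hu)⟩

theorem tuples_of_tru {t : ℕ} (ht : Tru t) (hf : ¬ Frozen p (stg t))
    (h : ∃ x, Suitable s p t x) : ∃ x, Suitable s p t x ∧ tuples s p t = (x, x) := by
  classical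
  have hs := Stop.exists_of_suitable (t := t) fun _ _ => h
  have h1 := Nat.find_spec hs
  rw [tuples, courseRec, ← past, searchStep, dif_pos hs, stopVal]
  have h2 : Cand s p (past s p t) (tupleOf (Nat.find hs)) (Nat.find hs) := by
    rcases h1 with h1 | h1 | h1
    · rw [length_past] at h1
      exact absurd h1 hf
    · rw [length_past] at h1
      exact absurd (ht.bel h1.1) h1.2
    · exact h1
  rw [if_pos ⟨by rwa [length_past], h2⟩]
  exact ⟨_, h2.suitable, rfl⟩

end Enumeration

end CatDeg


namespace CatDeg

/-! ### Entries and prefixes of lists of numbers. -/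

theorem prefix_of_getD {x y : List ℕ} (hl : x.length ≤ y.length)
    (h : ∀ i, i < x.length → x.getD i 0 = y.getD i 0) : x <+: y := by
  rw [List.prefix_iff_eq_take]
  refine List.ext_getElem (by simp [hl]) fun i h1 h2 => ?_
  have := h i h1
  rw [List.getD_eq_getElem _ _ h1, List.getD_eq_getElem _ _ (by omega)] at this
  simpa using this

theorem getD_of_prefix {x y : List ℕ} (h : x <+: y) {i : ℕ} (hi : i < x.length) :
    y.getD i 0 = x.getD i 0 := by
  obtain ⟨u, rfl⟩ := h
  exact List.getD_append _ _ _ _ hi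

theorem getD_mem {x : List ℕ} {i : ℕ} (hi : i < x.length) : x.getD i 0 ∈ x := by
  rw [List.getD_eq_getElem _ _ hi]
  exact List.getElem_mem hi

theorem exists_getD_of_mem {x : List ℕ} {a : ℕ} (h : a ∈ x) :
    ∃ i, i < x.length ∧ x.getD i 0 = a := by
  obtain ⟨i, hi, rfl⟩ := List.getElem_of_mem h
  exact ⟨i, hi, List.getD_eq_getElem _ _ hi⟩

theorem getD_inj_of_nodup {x : List ℕ} (h : x.Nodup) {i j : ℕ} (hi : i < x.length)
    (hj : j < x.length) (hij : x.getD i 0 = x.getD j 0) : i = j := by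
  rw [List.getD_eq_getElem _ _ hi, List.getD_eq_getElem _ _ hj] at hij
  exact (List.Nodup.getElem_inj_iff h).1 hij

/-! ### Positions and stages -/

/-- A move of an earlier position discards the later records. So every record still present was
created after all the moves made by the positions before it. -/
theorem stg_init_lt (t : ℕ) : (stg t).length ≤ t ∧
    (∀ e, e < (stg t).length → e < ((stg t).getD e rec0).2.1) ∧
    ∀ e' e, e' < e → e < (stg t).length →
      ((stg t).getD e' rec0).2.1 < ((stg t).getD e rec0).2.1 ∧
      ∀ (j : ℕ) (m : Move × ℕ), ((stg t).getD e' rec0).2.2.2[j]? = some m →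
        m.2 < ((stg t).getD e rec0).2.1 := by
  refine stg_induction (P := fun t S => S.length ≤ t ∧
    (∀ e, e < S.length → e < (S.getD e rec0).2.1) ∧
    ∀ e' e, e' < e → e < S.length → (S.getD e' rec0).2.1 < (S.getD e rec0).2.1 ∧
      ∀ (j : ℕ) (m : Move × ℕ), (S.getD e' rec0).2.2.2[j]? = some m →
        m.2 < (S.getD e rec0).2.1) (by simp) ?_ ?_ t
  · rintro t ht ⟨h1, h2, h3⟩ hS
    have hlt := prd_lt ht
    rw [hS]
    refine ⟨by rw [List.length_append, List.length_singleton]; omega, fun e he => ?_,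
      fun e' e he' he => ?_⟩
    · rw [List.length_append, List.length_singleton] at he
      rcases Nat.lt_succ_iff_lt_or_eq.1 he with h | rfl
      · rw [getD_append_singleton_lt h]
        exact h2 e h
      · rw [getD_append_singleton_eq, newRec]
        simp only
        omega
    · rw [List.length_append, List.length_singleton] at he
      rcases Nat.lt_succ_iff_lt_or_eq.1 he with h | rfl
      · rw [getD_append_singleton_lt h, getD_append_singleton_lt (by omega)]
        exact h3 e' e he' h
      · rw [getD_append_singleton_eq, getD_append_singleton_lt he', newRec]
        have hg := goodRec_stg _ e' he'
        exact ⟨hg.init_bel.le.trans_lt hlt, fun j m hm => (hg.hist j m hm).2.1.le.trans_lt hlt⟩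
  · rintro t e₀ b ht ⟨h1, h2, h3⟩ ha hS
    have hlt := prd_lt ht
    rw [hS]
    refine ⟨by rw [length_take_append ha.1]; have := ha.1; omega, fun e he => ?_,
      fun e' e he' he => ?_⟩
    · rw [length_take_append ha.1] at he
      rcases Nat.lt_succ_iff_lt_or_eq.1 he with h | rfl
      · rw [getD_take_append_lt ha.1 h]
        exact h2 e (h.trans ha.1)
      · rw [getD_take_append_eq ha.1, upd]
        exact h2 e ha.1
    · rw [length_take_append ha.1] at he
      rcases Nat.lt_succ_iff_lt_or_eq.1 he with h | rfl
      · rw [getD_take_append_lt ha.1 h, getD_take_append_lt ha.1 (by omega)]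
        exact h3 e' e he' (h.trans ha.1)
      · rw [getD_take_append_eq ha.1, getD_take_append_lt ha.1 he', upd]
        exact h3 e' e he' ha.1

theorem lt_finStage (e : ℕ) : e < finStage e := by
  have h1 := (stg_init_lt (finStage e)).1
  rw [length_finStage] at h1
  omega

theorem finStage_mono {e e' : ℕ} (h : e ≤ e') : finStage e ≤ finStage e' := by
  by_contra hlt
  have h1 := ((final_finStage e').2 _ (final_finStage e).1 (by omega)).length_le
  rw [length_finStage, length_finStage] at h1
  obtain rfl : e = e' := by omega
  exact hlt le_rfl

/-- The last position at a true stage after the final stage of `e` was created after that stage. -/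
theorem finStage_lt_init {t e : ℕ} (ht : Tru t) (hlt : finStage e < t) :
    finStage e < (lastRec (stg t)).2.1 := by
  have h1 := ((final_finStage e).2 t ht hlt.le).length_le
  rw [length_finStage] at h1
  have h2 := stg_last t (by omega)
  rw [lastRec]
  set e' := (stg t).length - 1 with he'
  rcases Nat.lt_or_eq_of_le (show e ≤ e' by omega) with h | h
  · by_contra hle
    have h3 := (stg_history t e' (finStage e) (by omega) ((final_finStage e).1.bel hlt.le)
      (by omega)).1
    rw [length_finStage] at h3
    omega
  · exfalso
    rw [← h, (getD_eq_finRec ht hlt.le).2] at h2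
    have hg := goodRec_finRec e
    rcases h2.2 with ⟨h3, -⟩ | ⟨l, β, h3⟩
    · have := hg.init_bel.le
      omega
    · have := (hg.hist l.length (β, t) (by rw [h3]; simp)).2.1.le
      simp only at this
      omega

/-! ### Existence of the next tuple at true stages. -/

section Enumeration

variable {s : Setting} {σ₀ : List ℕ} {p : ℕ}

theorem Moves.completed (hp : s.IsIndex σ₀ p) (hf : s.Forces σ₀) {t : ℕ} (ht : Tru t)
    {y : List ℕ} (h : Moves p (stg t) y) :
    s.Completed ((stg t).length - 1).unpair.2 (lastRec (stg t)).2 := by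
  have hpos : 0 < (stg t).length := by
    by_contra h0
    have h1 := h.2.1
    rw [List.length_eq_zero_iff.1 (show (stg t).length = 0 by omega)] at h1
    simp [lastRec, rec0] at h1
  exact (hp.goodPast_of_tru ht (e := (stg t).length - 1) (by omega) h.1).completed hf h.2.1

theorem exists_link (hp : s.IsIndex σ₀ p) (hf : s.Forces σ₀) {t : ℕ} (ht : Tru t)
    {y : List ℕ} (hy : ∀ a ∈ y, s.A a) {a : ℕ} (ha : a ∈ y) :
    ∃ b, s.A b ∧ Link p (stg t) y a b := by
  by_cases h : Moves p (stg t) y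
  · obtain ⟨q, hq, rfl⟩ := h.2.2.2 a ha
    exact ⟨q.2, ((h.completed hp hf ht).mem q hq).2, .inl ⟨h, hq⟩⟩
  · exact ⟨a, hy a ha, .inr ⟨h, rfl⟩⟩

theorem Eq1.refl {A : ℕ → Prop} {S : ℕ → List ℕ → Prop} (x : List ℕ) : Eq1 A A S S x x :=
  ⟨fun c hc => ⟨c, hc, PatEq.refl _ _⟩, fun c hc => ⟨c, hc, PatEq.refl _ _⟩⟩

/-- The new tuple either repeats the old one or is its image under a completed relation, and both
cases preserve one step of back-and-forth. -/
theorem eq1_of_link (hp : s.IsIndex σ₀ p) (hf : s.Forces σ₀) {t : ℕ} (ht : Tru t)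
    {y x : List ℕ} (h : ∀ i, i < y.length →
      i < x.length ∧ Link p (stg t) y (y.getD i 0) (x.getD i 0)) :
    Eq1 s.A s.A s.SA s.SA y (x.take y.length) := by
  have hl : y.length ≤ x.length := by
    rcases Nat.eq_zero_or_pos y.length with h0 | h0
    · omega
    · have := (h (y.length - 1) (by omega)).1
      omega
  by_cases hm : Moves p (stg t) y
  · have h1 := (hm.completed hp hf ht).eq1 (y.zip (x.take y.length)) (by
      intro q hq
      obtain ⟨i, hi, rfl⟩ := List.getElem_of_mem hq
      rw [List.length_zip] at hi
      obtain ⟨h2, h3⟩ := h i (by omega)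
      rw [List.getD_eq_getElem _ _ h2, List.getD_eq_getElem _ _ (by omega)] at h3
      rcases h3 with h3 | h3
      · simpa using h3.2
      · exact absurd hm h3.1)
    rwa [List.map_fst_zip (by simp [hl]), List.map_snd_zip (by simp [hl])] at h1
  · have h1 : y <+: x := prefix_of_getD hl fun i hi => by
      rcases (h i hi).2 with h3 | h3
      · exact absurd h3.1 hm
      · exact h3.2
    rw [← List.prefix_iff_eq_take.1 h1]
    exact Eq1.refl y

theorem tuples_mem (t : ℕ) : ((∀ a ∈ (tuples s p t).1, s.A a) ∧ (tuples s p t).1.Nodup) ∧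
    (∀ a ∈ (tuples s p t).2, s.A a) ∧ (tuples s p t).2.Nodup := by
  induction t using Nat.strong_induction_on with
  | _ t ih =>
    rcases tuples_cases (s := s) (p := p) t with h | ⟨-, x, hx, h⟩
    · rw [h]
      rcases Nat.eq_zero_or_pos t with rfl | ht
      · simp [preAll_zero, preTrue_zero]
      · refine ⟨?_, ?_⟩
        · obtain ⟨k, rfl⟩ : ∃ k, t = k + 1 := ⟨t - 1, by omega⟩
          simp only [preAll_succ]
          exact (ih k (by omega)).1
        · simp only [preTrue_pos s p ht]
          exact (ih _ (prd_lt ht)).2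
    · rw [h]
      exact ⟨⟨hx.mem, hx.nodup⟩, hx.mem, hx.nodup⟩

theorem preTrue_mem (t : ℕ) : ∀ a ∈ preTrue s p t, s.A a := by
  rcases Nat.eq_zero_or_pos t with rfl | ht
  · simp [preTrue_zero]
  · rw [preTrue_pos s p ht]
    exact (tuples_mem _).2.1

theorem preAll_nodup (t : ℕ) : (preAll s p t).Nodup := by
  cases t with
  | zero => simp [preAll_zero]
  | succ t => rw [preAll_succ]; exact (tuples_mem t).1.2

/-- From the tuple of a true stage one can get back to those of the earlier true stages. -/
theorem tuples_back (hp : s.IsIndex σ₀ p) (hf : s.Forces σ₀) (t : ℕ) : Tru t → ∀ r, r ≤ t →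
    Tru r → ∀ x, (∀ a ∈ x, s.A a) → (tuples s p t).2 <+: x →
    ∃ c, (∀ a ∈ c, s.A a) ∧ PatEq s.SA s.SA ((tuples s p r).2 ++ c) x := by
  induction t using Nat.strong_induction_on with
  | _ t ih =>
    intro ht r hr htr x hx hpre
    rcases Nat.lt_or_eq_of_le hr with hlt | rfl
    · have htpos : 0 < t := by omega
      have ih' := ih _ (prd_lt htpos) (ht.of_bel (bel_prd t)) r ((htr.bel hr).to_prd hlt).le htr
      rcases tuples_cases (s := s) (p := p) t with h | ⟨-, x', hx', h⟩
      · rw [h, preTrue_pos s p htpos] at hpre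
        exact ih' x hx hpre
      · rw [h] at hpre
        obtain ⟨u, rfl⟩ := hpre
        have hlink := hx'.link
        have hy := preTrue_mem (s := s) (p := p) t
        have h1 := eq1_of_link hp hf ht hlink
        -- All entries of `x` beyond those linked to the previous true tuple are matched at once.
        -- One step suffices, because the resulting `c` is handed to the induction as a new
        -- extension.
        have h2 := h1.2 (x'.drop (preTrue s p t).length ++ u) (by
          intro a ha
          rcases List.mem_append.1 ha with ha | ha
          · exact hx a (List.mem_append_left _ (List.mem_of_mem_drop ha))
          · exact hx a (List.mem_append_right _ ha))
        obtain ⟨c, hc, h3⟩ := h2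
        rw [← List.append_assoc, List.take_append_drop] at h3
        obtain ⟨c', hc', h4⟩ := ih' (preTrue s p t ++ c) (by
          intro a ha
          rcases List.mem_append.1 ha with ha | ha
          exacts [hy a ha, hc a ha]) (by
          rw [preTrue_pos s p htpos]
          exact List.prefix_append _ _)
        exact ⟨c', hc', h4.trans h3⟩
    · obtain ⟨u, rfl⟩ := hpre
      exact ⟨u, fun a ha => hx a (List.mem_append_right _ ha), PatEq.refl _ _⟩

/-- The present tuple is compatible with that of the last true stage. -/
theorem tuples_compatible (t : ℕ) : ∀ r, r ≤ t → Tru r → (∀ r', Tru r' → r' ≤ t → r' ≤ r) →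
    ∃ c, (∀ a ∈ c, s.A a) ∧ PatEq s.SA s.SA ((tuples s p r).2 ++ c) (tuples s p t).1 := by
  induction t with
  | zero =>
    intro r hr _ _
    obtain rfl : r = 0 := by omega
    refine ⟨[], by simp, ?_⟩
    rcases tuples_cases (s := s) (p := p) 0 with h | ⟨-, x, hx, h⟩
    · rw [h]; exact PatEq.refl _ _
    · rw [h, List.append_nil]; exact PatEq.refl _ _
  | succ t ih =>
    intro r hr htr hlast
    rcases tuples_cases (s := s) (p := p) (t + 1) with h | ⟨-, x, hx, h⟩
    · rcases Nat.lt_or_eq_of_le hr with hlt | rfl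
      · rw [h, preAll_succ]
        exact ih r (by omega) htr fun r' h1 h2 => hlast r' h1 (by omega)
      -- A true stage that only copies has the tuple of its predecessor, which was the last true
      -- stage up to `t`.
      · rw [h, preAll_succ, preTrue_pos s p (by omega)]
        have hlt := prd_lt (show 0 < t + 1 by omega)
        exact ih _ (by omega) (htr.of_bel (bel_prd _))
          fun r' h1 h2 => ((h1.bel (by omega)).to_prd (by omega : r' < t + 1)).le
    · rcases Nat.lt_or_eq_of_le hr with hlt | rfl
      · rw [h]
        exact hx.back r hlt (htr.bel hr)
      · rw [h]
        exact ⟨[], by simp, by rw [List.append_nil]; exact PatEq.refl _ _⟩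

theorem Setting.exists_extension (s : Setting) {x : List ℕ} (hx : ∀ a ∈ x, s.A a) (hn : x.Nodup)
    (t : ℕ) : ∃ x', x <+: x' ∧ (∀ a ∈ x', s.A a) ∧ x'.Nodup ∧ t ≤ x'.length ∧
      ∀ n, n < t → s.A n → n ∈ x' := by
  have hadd : ∀ y : List ℕ, (∀ a ∈ y, s.A a) → y.Nodup → ∀ a, s.A a → a ∉ y →
      (∀ b ∈ y ++ [a], s.A b) ∧ (y ++ [a]).Nodup := by
    intro y hy hyn a ha hay
    refine ⟨fun b hb => ?_, List.Nodup.append hyn (List.nodup_singleton a) (by simpa using hay)⟩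
    rcases List.mem_append.1 hb with hb | hb
    · exact hy b hb
    · rw [List.mem_singleton.1 hb]; exact ha
  induction t with
  | zero => exact ⟨x, List.prefix_refl _, hx, hn, Nat.zero_le _, fun n hn => absurd hn (by omega)⟩
  | succ t ih =>
    obtain ⟨y, h1, h2, h3, h4, h5⟩ := ih
    obtain ⟨m, hm⟩ := exists_list_bound (fun a : ℕ => a) y
    obtain ⟨a, ham, ha⟩ := s.infinite m
    obtain ⟨h6, h7⟩ := hadd y h2 h3 a ha fun h => by have := hm a h; omega
    by_cases h8 : s.A t ∧ t ∉ y ++ [a]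
    · obtain ⟨h9, h10⟩ := hadd _ h6 h7 t h8.1 h8.2
      refine ⟨y ++ [a] ++ [t], h1.trans ((List.prefix_append _ _).trans (List.prefix_append _ _)),
        h9, h10, by simp; omega, fun n hn hA => ?_⟩
      rcases Nat.lt_succ_iff_lt_or_eq.1 hn with hn | rfl
      · simp [h5 n hn hA]
      · simp
    · refine ⟨y ++ [a], h1.trans (List.prefix_append _ _), h6, h7, by simp; omega,
        fun n hn hA => ?_⟩
      rcases Nat.lt_succ_iff_lt_or_eq.1 hn with hn | rfl
      · simp [h5 n hn hA]
      · by_contra h9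
        exact h8 ⟨hA, h9⟩

/-- The announced tuple realizes an extension of the true tuple `y`. One-step equivalence of `y`
with its image transports that extension to the image, which preserves the diagram. Used in the
other direction, it leads from the new tuple back to `y`, and then to the earlier true tuples. -/
theorem exists_suitable (hp : s.IsIndex σ₀ p) (hf : s.Forces σ₀) {t : ℕ} (ht : Tru t) :
    ∃ x, Suitable s p t x := by
  have h1 : ∃ c, (∀ a ∈ c, s.A a) ∧
      PatEq s.SA s.SA (preTrue s p t ++ c) (preAll s p t) := by
    rcases Nat.eq_zero_or_pos t with rfl | htpos
    · exact ⟨[], by simp, PatEq.refl _ _⟩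
    · obtain ⟨k, rfl⟩ : ∃ k, t = k + 1 := ⟨t - 1, by omega⟩
      rw [preTrue_pos s p htpos, preAll_succ]
      have hlt := prd_lt htpos
      exact tuples_compatible k _ (by omega) (ht.of_bel (bel_prd _))
        fun r' h1 h2 => ((h1.bel (by omega)).to_prd (by omega : r' < k + 1)).le
  obtain ⟨c, hc, hpat⟩ := h1
  have hy := preTrue_mem (s := s) (p := p) t
  choose! f hfA hfL using fun a ha => exists_link hp hf ht hy (a := a) ha
  set y := preTrue s p t with hydef
  have hlen : (y.map f).length = y.length := by simp
  have hlink : ∀ x', y.map f <+: x' → ∀ i, i < y.length →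
      i < x'.length ∧ Link p (stg t) y (y.getD i 0) (x'.getD i 0) := by
    intro x' hx' i hi
    refine ⟨by have := hx'.length_le; omega, ?_⟩
    rw [getD_of_prefix hx' (by omega), List.getD_eq_getElem (y.map f) _ (by omega),
      List.getElem_map, List.getD_eq_getElem _ _ hi]
    exact hfL _ (List.getElem_mem hi)
  have heq := eq1_of_link hp hf ht (hlink _ (List.prefix_refl _))
  rw [← hlen, List.take_length] at heq
  obtain ⟨d, hd, h2⟩ := heq.1 c hc
  -- The transported tuple has the announced pattern. In particular it has no repetitions, so it can
  -- be extended to cover further elements.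
  have h3 := h2.symm.trans hpat
  have h4 : ∀ a ∈ y.map f ++ d, s.A a := by
    intro a ha
    rcases List.mem_append.1 ha with ha | ha
    · obtain ⟨b, hb, rfl⟩ := List.mem_map.1 ha
      exact hfA b hb
    · exact hd a ha
  obtain ⟨x, hx1, hx2, hx3, hx4, hx5⟩ := s.exists_extension h4
    (h3.nodup (preAll_nodup (s := s) (p := p) t)) t
  have hzx : y.map f <+: x := (List.prefix_append _ _).trans hx1
  refine ⟨x, hx2, hx3, hx4, ?_, hx5, ?_, ?_, hlink x hzx⟩
  · rw [← h3.1]; exact hx1.length_le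
  · rw [← h3.1, ← List.prefix_iff_eq_take.1 hx1]; exact h3
  · intro r hr hb
    have htr := ht.of_bel hb
    have htpos : 0 < t := by omega
    obtain ⟨u, rfl⟩ := hzx
    obtain ⟨c', hc', h5⟩ := heq.2 u fun a ha => hx2 a (List.mem_append_right _ ha)
    obtain ⟨c'', hc'', h6⟩ := tuples_back hp hf (prd t) (ht.of_bel (bel_prd t)) r
      (hb.to_prd hr).le htr (y ++ c') (by
        intro a ha
        rcases List.mem_append.1 ha with ha | ha
        exacts [hy a ha, hc' a ha]) (by
        rw [hydef, preTrue_pos s p htpos]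
        exact List.prefix_append _ _)
    exact ⟨c'', hc'', h6.trans h5⟩

theorem computable_tuples_of_isIndex (hp : s.IsIndex σ₀ p) (hf : s.Forces σ₀) :
    Computable (tuples s p) :=
  computable_tuples s p fun _ => Stop.exists_of_suitable fun ht _ => exists_suitable hp hf ht

/-- By locality an atomic condition with number below the length of the shortened tuple does not see
the entries cut off. -/
theorem PatEq.take {m : ℕ} {x y : List ℕ} (h : PatEq s.SA s.SA x y) :
    PatEq s.SA s.SA (x.take m) (y.take m) := by
  have h1 := h.1
  refine ⟨by simp [h1], fun i hi j hj => ?_, fun z hz => ?_⟩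
  · rw [List.length_take] at hi hj
    simp only [List.getD_eq_getElem?_getD, List.getElem?_take_of_lt (show i < m by omega),
      List.getElem?_take_of_lt (show j < m by omega)]
    simpa only [List.getD_eq_getElem?_getD] using h.2.1 i (by omega) j (by omega)
  · rw [List.length_take] at hz
    rw [s.localA z x m (by omega), s.localA z y m (by omega)]
    exact h.2.2 z (by omega)

/-- No stage, true or false, revises what an earlier one has announced. This is what makes the copy
computable. -/
theorem tuples_coherent {t t' : ℕ} (h : t ≤ t') :
    (tuples s p t).1.length ≤ (tuples s p t').1.length ∧
    PatEq s.SA s.SA ((tuples s p t').1.take (tuples s p t).1.length) (tuples s p t).1 := by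
  induction t', h using Nat.le_induction with
  | base => exact ⟨le_rfl, by rw [List.take_length]; exact PatEq.refl _ _⟩
  | succ t' _ ih =>
    rcases tuples_cases (s := s) (p := p) (t' + 1) with h | ⟨-, x, hx, h⟩
    · rw [h, preAll_succ]
      exact ih
    · have h1 := hx.pre_length
      have h2 := hx.pat
      rw [preAll_succ] at h1 h2
      rw [h]
      refine ⟨ih.1.trans h1, ?_⟩
      have h3 := (h2.take (m := (tuples s p t).1.length)).trans ih.2
      rwa [List.take_take, Nat.min_eq_left ih.1] at h3

end Enumeration

end CatDeg


namespace CatDeg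

/-! ### The limit of the enumeration and the diagonalization. -/

section Persistence

variable (s : Setting) (p : ℕ)

theorem exists_entry_bound (t : ℕ) : ∃ n, ∀ r, r < t + 1 → ∀ a, a ∈ (tuples s p r).2 → a ≤ n := by
  have : ∀ m, ∃ n, ∀ r, r < m → ∀ a, a ∈ (tuples s p r).2 → a ≤ n := by
    intro m
    induction m with
    | zero => exact ⟨0, fun r hr => absurd hr (by omega)⟩
    | succ m ih =>
      obtain ⟨n, hn⟩ := ih
      obtain ⟨k, hk⟩ := exists_list_bound (fun a : ℕ => a) (tuples s p m).2
      refine ⟨n + k, fun r hr a ha => ?_⟩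
      rcases Nat.lt_succ_iff_lt_or_eq.1 hr with hr | rfl
      · exact (hn r hr a ha).trans (by omega)
      · have := hk a ha
        omega
  exact this _

open Classical in
/-- A bound of the entries of the tuples up to stage `t`. -/
noncomputable def entryBound (t : ℕ) : ℕ := Nat.find (exists_entry_bound s p t)

variable {s p}

theorem le_entryBound {r t a : ℕ} (h : r ≤ t) (ha : a ∈ (tuples s p r).2) :
    a ≤ entryBound s p t := by
  classical
  exact Nat.find_spec (exists_entry_bound s p t) r (by omega) a ha

theorem computable_entryBound (h : Computable (tuples s p)) : Computable (entryBound s p) := by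
  classical
  refine computable_find (P := fun t n => ∀ r, r < t + 1 → ∀ a, a ∈ (tuples s p r).2 → a ≤ n)
    ?_ (exists_entry_bound s p)
  obtain ⟨v, hv, hve⟩ : ∃ v : ℕ → Tuples, Computable v ∧ ∀ r, tuples s p r = v r :=
    ⟨_, h, fun _ => rfl⟩
  simp only [hve]
  fun_prop

/-- Settling for `s` implies that the bound has been exceeded, for `s` at least `c`. -/
def Exceeds (s : Setting) (p c : ℕ) : Prop :=
  ∀ t w, c ≤ t → Settled t w → entryBound s p t < w

theorem exists_exceeds (h : Computable (tuples s p)) : ∃ c, Exceeds s p c := by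
  obtain ⟨c, h1, h2⟩ := kset_of_computable (computable_entryBound h)
  exact ⟨c, fun t w ht hw => hw.bound h1 h2 ht⟩

variable {σ₀ : List ℕ} {c : ℕ}

/-- A requirement initialized after `T` fixes all elements up to a bound that exceeds every entry in
use by then, so applying its relation leaves the tuple of `T` alone. -/
theorem tuples_persist (hp : s.IsIndex σ₀ p) (hf : s.Forces σ₀) (hc : Exceeds s p c) {T t : ℕ}
    (hT : c ≤ T) (ht : Tru t) (hlt : T < t)
    (hpre : (tuples s p T).2 <+: (tuples s p (prd t)).2)
    (hinit : (lastRec (stg t)).2.2.2.length = 4 → T < (lastRec (stg t)).2.1) :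
    (tuples s p T).2 <+: (tuples s p t).2 := by
  have htpos : 0 < t := by omega
  rcases tuples_cases (s := s) (p := p) t with h | ⟨-, x, hx, h⟩
  · rw [h, preTrue_pos s p htpos]
    exact hpre
  · rw [h]
    have hlink := hx.link
    have hpre' : (tuples s p T).2 <+: preTrue s p t := by rwa [preTrue_pos s p htpos]
    have hl := hpre'.length_le
    refine prefix_of_getD ?_ fun i hi => ?_
    · rcases Nat.eq_zero_or_pos (preTrue s p t).length with h0 | h0
      · omega
      · have := (hlink ((preTrue s p t).length - 1) (by omega)).1
        simp only
        omega
    · obtain ⟨-, h1⟩ := hlink i (by omega)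
      rw [getD_of_prefix hpre' hi] at h1
      rcases h1 with ⟨hm, h1⟩ | ⟨-, h1⟩
      · obtain ⟨w, hw, h2⟩ := (hm.completed hp hf ht).fixes
        have h3 := hinit hm.2.1
        have h4 := hc _ w (hT.trans h3.le) hw
        have h5 := le_entryBound (s := s) (p := p) h3.le (getD_mem hi)
        exact (h2 _ _ (by omega) h1).symm
      · exact h1

theorem tuples_persist_final (hp : s.IsIndex σ₀ p) (hf : s.Forces σ₀) (hc : Exceeds s p c)
    {e t : ℕ} (he : c ≤ e) (ht : Tru t) (hle : finStage e ≤ t) :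
    (tuples s p (finStage e)).2 <+: (tuples s p t).2 := by
  refine tru_induction (T := finStage e)
    (P := fun t => (tuples s p (finStage e)).2 <+: (tuples s p t).2) (List.prefix_refl _) ?_
    (final_finStage e).1 t ht hle
  intro t ht hlt _ _ ih
  exact tuples_persist hp hf hc (he.trans (lt_finStage e).le) ht hlt ih
    fun _ => finStage_lt_init ht hlt

/-- All records present are final, so those of this index have made no move or four. None of them is
waiting, and the stage is not frozen. -/
theorem suitable_finStage (hp : s.IsIndex σ₀ p) (hf : s.Forces σ₀) (e : ℕ) :
    ∃ x, Suitable s p (finStage e) x ∧ tuples s p (finStage e) = (x, x) := by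
  refine tuples_of_tru (final_finStage e).1 ?_ (exists_suitable hp hf (final_finStage e).1)
  rintro ⟨e', h1, h2, h3⟩
  rw [(final_finStage e).getD_eq h1] at h3
  have h4 := hp.final_length hf e'.unpair.2
  rw [← h2, Nat.pair_unpair] at h4
  omega

/-- The limit of the tuples. -/
noncomputable def limitTuple (s : Setting) (p c n : ℕ) : ℕ :=
  (tuples s p (finStage (n + c))).2.getD n 0

theorem limitTuple_eq (hp : s.IsIndex σ₀ p) (hf : s.Forces σ₀) (hc : Exceeds s p c) {e n : ℕ}
    (he : c ≤ e) (hn : n < (tuples s p (finStage e)).2.length) :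
    limitTuple s p c n = (tuples s p (finStage e)).2.getD n 0 := by
  have h1 : n < (tuples s p (finStage (n + c))).2.length := by
    obtain ⟨x, hx, h⟩ := suitable_finStage hp hf (n + c)
    rw [h]
    have := hx.le_length
    have := lt_finStage (n + c)
    simp only
    omega
  unfold limitTuple
  rcases le_total e (n + c) with h | h
  · exact getD_of_prefix (tuples_persist_final hp hf hc he (final_finStage _).1
      (finStage_mono h)) hn
  · exact (getD_of_prefix (tuples_persist_final hp hf hc (Nat.le_add_left c n)
      (final_finStage _).1 (finStage_mono h)) h1).symm

theorem lt_length_finStage (hp : s.IsIndex σ₀ p) (hf : s.Forces σ₀) (e : ℕ) :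
    e < (tuples s p (finStage e)).2.length := by
  obtain ⟨x, hx, h⟩ := suitable_finStage hp hf e
  rw [h]
  exact (lt_finStage e).trans_le hx.le_length

theorem limitTuple_mem (hp : s.IsIndex σ₀ p) (hf : s.Forces σ₀) (n : ℕ) :
    s.A (limitTuple s p c n) := by
  have h1 := lt_length_finStage hp hf (n + c)
  exact (tuples_mem _).2.1 _ (getD_mem (by omega))

theorem limitTuple_injective (hp : s.IsIndex σ₀ p) (hf : s.Forces σ₀) (hc : Exceeds s p c) :
    Function.Injective (limitTuple s p c) := by
  intro m n h
  have h1 := lt_length_finStage hp hf (m + n + c)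
  rw [limitTuple_eq hp hf hc (e := m + n + c) (by omega) (by omega),
    limitTuple_eq hp hf hc (e := m + n + c) (by omega) (by omega)] at h
  exact getD_inj_of_nodup (tuples_mem _).2.2 (by omega) (by omega) h

theorem limitTuple_surjective (hp : s.IsIndex σ₀ p) (hf : s.Forces σ₀) (hc : Exceeds s p c)
    {a : ℕ} (ha : s.A a) : ∃ n, limitTuple s p c n = a := by
  obtain ⟨x, hx, h⟩ := suitable_finStage hp hf (a + c)
  have h1 := lt_finStage (a + c)
  obtain ⟨n, hn, h2⟩ := exists_getD_of_mem (hx.covers a (by omega) ha)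
  refine ⟨n, ?_⟩
  rw [limitTuple_eq hp hf hc (e := a + c) (by omega) (by rw [h]; exact hn), h]
  exact h2

theorem take_finStage (hp : s.IsIndex σ₀ p) (hf : s.Forces σ₀) (hc : Exceeds s p c) {e m : ℕ}
    (he : c ≤ e) (hm : m ≤ (tuples s p (finStage e)).2.length) :
    (tuples s p (finStage e)).2.take m = (List.range m).map (limitTuple s p c) := by
  refine List.ext_getElem (by simp [hm]) fun i h1 h2 => ?_
  have hi : i < m := by simpa using h2
  rw [List.getElem_map, List.getElem_range, limitTuple_eq hp hf hc he (by omega),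
    List.getElem_take, List.getD_eq_getElem _ _ (by omega)]

/-- The atomic diagram along the limit can be read off from the tuples. -/
theorem limitTuple_coherent (hp : s.IsIndex σ₀ p) (hf : s.Forces σ₀) (hc : Exceeds s p c)
    {t z m : ℕ} (hz : z < (tuples s p t).1.length) (hm : z < m) :
    s.SA z (tuples s p t).1 ↔ s.SA z ((List.range m).map (limitTuple s p c)) := by
  set e := t + c + m
  have h1 := lt_finStage e
  obtain ⟨x, hx, h⟩ := suitable_finStage hp hf e
  obtain ⟨h2, h3⟩ := tuples_coherent (s := s) (p := p) (t := t) (t' := finStage e) (by omega)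
  have h4 := hx.le_length
  rw [← take_finStage hp hf hc (e := e) (by omega) (by rw [h]; simp only; omega),
    s.localA z _ m hm, h, ← s.localA z x _ hz]
  rw [h] at h3
  exact (h3.2.2 z (by rw [h3.1]; exact hz)).symm

/-! ### The diagonalization -/

/-- The tuple at the stage of the first move of a completed requirement persists until the stage
of the last move. -/
theorem tuples_persist_first (hp : s.IsIndex σ₀ p) (hf : s.Forces σ₀) (hc : Exceeds s p c)
    {e : ℕ} (he : c ≤ e) {m₀ m₃ : Move × ℕ} (h₀ : (finRec e).2.2.2[0]? = some m₀)
    (h₃ : (finRec e).2.2.2[3]? = some m₃) (h : m₃.2 = finStage e) {t : ℕ} (ht : Tru t)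
    (hle : m₀.2 ≤ t) (hlt : t < finStage e) : (tuples s p m₀.2).2 <+: (tuples s p t).2 := by
  have hg := goodRec_finRec e
  have hm₀ := hg.hist 0 m₀ h₀
  have hi := (stg_init_lt (finStage e)).2.1 e (by rw [length_finStage]; omega)
  rw [← finRec] at hi
  have h1 := (final_finStage e).1.of_bel hm₀.2.1
  refine tru_induction (T := m₀.2)
    (P := fun t => t < finStage e → (tuples s p m₀.2).2 <+: (tuples s p t).2)
    (fun _ => List.prefix_refl _) ?_ h1 t ht hle hlt
  intro t ht hlt' hle' _ ih hlt
  refine tuples_persist hp hf hc (by omega) ht hlt' (ih ((prd_lt (by omega)).trans hlt))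
    fun h4 => ?_
  have h2 := stg_history (finStage e) e t (by rw [length_finStage]; omega) (ht.bel hlt.le)
    (by rw [← finRec]; omega)
  rw [← finRec] at h2
  obtain ⟨h2, j, hj, h3, hj'⟩ := h2
  have hj0 : 0 < j := (hj' 0 m₀ h₀).2 hlt'.le
  have hj3 : ¬ 3 < j := fun h5 => by
    have := (hj' 3 m₃ h₃).1 h5
    omega
  rw [lastRec] at h4 ⊢
  -- If another record is last, it was created after the first move. If `e` itself is last, it has
  -- made between one and three moves and cannot be the completed record.
  rcases Nat.lt_or_eq_of_le (show e ≤ (stg t).length - 1 by omega) with h5 | h5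
  · refine ((stg_init_lt t).2.2 e _ h5 (by omega)).2 0 m₀ ?_
    rw [h3]
    simp only
    rw [List.getElem?_take_of_lt hj0, h₀]
  · rw [← h5, h3] at h4
    simp only [List.length_take] at h4
    omega

/-- At the stage of its first move, a completed requirement does not wait. -/
theorem mem_tuples_first (hp : s.IsIndex σ₀ p) (hf : s.Forces σ₀) {e : ℕ} {m₀ m₁ : Move × ℕ}
    (h₀ : (finRec e).2.2.2[0]? = some m₀) (h₁ : (finRec e).2.2.2[1]? = some m₁) {a : ℕ}
    (ha : s.A a) (hlt : a < m₀.2) : a ∈ (tuples s p m₀.2).2 := by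
  have hg := goodRec_finRec e
  have hm₀ := hg.hist 0 m₀ h₀
  have hmm := hg.hist_mono 0 1 m₀ m₁ (by omega) h₀ h₁
  have htru := (final_finStage e).1.of_bel hm₀.2.1
  have h2 := stg_history (finStage e) e m₀.2 (by rw [length_finStage]; omega) hm₀.2.1
    (by rw [← finRec]; omega)
  rw [← finRec] at h2
  obtain ⟨h2, j, hj, h3, hj'⟩ := h2
  have hj0 : 0 < j := (hj' 0 m₀ h₀).2 le_rfl
  have hj1 : ¬ 1 < j := fun h5 => by
    have := (hj' 1 m₁ h₁).1 h5
    omega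
  have hlen : (stg m₀.2).length = e + 1 := by
    by_contra hne
    have h4 := ((stg_init_lt m₀.2).2.2 e (e + 1) (by omega) (by omega)).2 0 m₀ (by
      rw [h3]
      simp only
      rw [List.getElem?_take_of_lt hj0, h₀])
    have := (goodRec_stg m₀.2 (e + 1) (by omega)).init_bel.le
    omega
  -- The requirement in position `e` has made one move only. Those before it had made all their
  -- final moves when it was initialized, hence none or four.
  have hfr : ¬ Frozen p (stg m₀.2) := by
    rintro ⟨e', h4, h5, h6⟩
    rcases Nat.lt_or_eq_of_le (show e' ≤ e by omega) with h7 | rfl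
    · have h8 := (stg_init_lt (finStage e)).2.2 e' e h7 (by rw [length_finStage]; omega)
      rw [(final_finStage e).getD_eq (e := e') (by rw [length_finStage]; omega), ← finRec] at h8
      have h9 := stg_history (finStage e) e' m₀.2 (by rw [length_finStage]; omega) hm₀.2.1
        (by rw [(final_finStage e).getD_eq (e := e') (by rw [length_finStage]; omega)]; omega)
      rw [(final_finStage e).getD_eq (e := e') (by rw [length_finStage]; omega)] at h9
      obtain ⟨-, k, hk, h10, hk'⟩ := h9
      have h11 : k = (finRec e').2.2.2.length := by
        by_contra hne
        have h12 : k < (finRec e').2.2.2.length := by omega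
        have h13 := List.getElem?_eq_getElem h12
        have h14 := (hk' k _ h13).2 ((h8.2 k _ h13).le.trans hm₀.1.le)
        omega
      have h12 := hp.final_length hf e'.unpair.2
      rw [← h5, Nat.pair_unpair] at h12
      rw [h10] at h6
      simp only [List.length_take] at h6
      omega
    · rw [h3] at h6
      simp only [List.length_take] at h6
      omega
  obtain ⟨x, hx, h4⟩ := tuples_of_tru htru hfr (exists_suitable hp hf htru)
  rw [h4]
  exact hx.covers a hlt ha

/-- Between the second and the last move of a requirement, the tuples do not change. -/
theorem tuples_frozen {e : ℕ} (hpe : e.unpair.1 = p) {m₁ m₃ : Move × ℕ}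
    (h₁ : (finRec e).2.2.2[1]? = some m₁)
    (h₃ : (finRec e).2.2.2[3]? = some m₃) (h : m₃.2 = finStage e) {t : ℕ} (ht : Tru t)
    (hle : m₁.2 ≤ t) (hlt : t < finStage e) :
    (tuples s p t).2 = (tuples s p (prd m₁.2)).2 := by
  have hg := goodRec_finRec e
  have hm₁ := hg.hist 1 m₁ h₁
  have h1 := (final_finStage e).1.of_bel hm₁.2.1
  have hfr : ∀ t, Tru t → m₁.2 ≤ t → t < finStage e → Frozen p (stg t) := by
    intro t ht hle hlt
    have h2 := stg_history (finStage e) e t (by rw [length_finStage]; omega) (ht.bel hlt.le)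
      (by rw [← finRec]; omega)
    rw [← finRec] at h2
    obtain ⟨h2, j, hj, h3, hj'⟩ := h2
    have hj0 : 1 < j := (hj' 1 m₁ h₁).2 hle
    have hj3 : ¬ 3 < j := fun h5 => by
      have := (hj' 3 m₃ h₃).1 h5
      omega
    refine ⟨e, h2, hpe, ?_⟩
    rw [h3]
    simp only [List.length_take]
    omega
  have hpre : ∀ t, Tru t → m₁.2 ≤ t → t < finStage e →
      (tuples s p t).2 = (tuples s p (prd t)).2 := by
    intro t ht hle hlt
    rw [tuples_of_frozen (hfr t ht hle hlt)]
    exact preTrue_pos s p (by omega)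
  refine tru_induction (T := m₁.2)
    (P := fun t => t < finStage e → (tuples s p t).2 = (tuples s p (prd m₁.2)).2)
    (fun h => hpre _ h1 le_rfl h) ?_ h1 t ht hle hlt
  intro t ht hlt' hle' _ ih hlt
  rw [hpre t ht hlt'.le hlt]
  exact ih ((prd_lt (by omega)).trans hlt)

theorem lt_encode_move (β : Move) : β.2.2.1 ≤ Encodable.encode β := by
  obtain ⟨τ, τ', a, v, ρ⟩ := β
  simp only [Encodable.encode_prod_val]
  exact (Nat.left_le_pair _ _).trans ((Nat.right_le_pair _ _).trans (Nat.right_le_pair _ _))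

/-- A move is seen only through a code below `kk t ≤ t`, and this code bounds the argument chosen by
the move. -/
theorem GoodRec.lt_stage {e t j : ℕ} {r : Rec} (h : GoodRec e t r) {m : Move × ℕ}
    (hm : r.2.2.2[j]? = some m) : m.1.2.2.1 < m.2 := by
  obtain ⟨-, -, -, u, -, h1, -⟩ := h.hist j m hm
  refine lt_of_le_of_lt ?_ (h1.trans_le (kk_le _))
  refine le_trans ?_ ((Nat.right_le_pair u _).trans (Nat.right_le_pair _ _))
  simp only [Encodable.encode_prod_val (α := ℕ) (β := Past × Move),
    Encodable.encode_prod_val (α := Past) (β := Move)]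
  exact (lt_encode_move m.1).trans ((Nat.right_le_pair _ _).trans (Nat.right_le_pair _ _))

/-- The record is the last one at `finStage e`, so it was initialized or moved exactly at that
stage. -/
theorem exists_last_move {e : ℕ} (h : (finRec e).2.2.2.length = 4) :
    ∃ m, (finRec e).2.2.2[3]? = some m ∧ m.2 = finStage e := by
  have h1 := (stg_last (finStage e) (finStage_pos e)).2
  rw [length_finStage, Nat.add_sub_cancel, ← finRec] at h1
  rcases h1 with ⟨-, h1⟩ | ⟨l, β, h1⟩
  · rw [h1] at h
    simp at h
  · rw [h1] at h
    have hl : l.length = 3 := by simpa using h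
    refine ⟨(β, finStage e), ?_, rfl⟩
    rw [h1, ← hl]
    simp

/-- No program computes the inverse of the limit from the generic set. -/
theorem limitTuple_not_computed (hp : s.IsIndex σ₀ p) (hf : s.Forces σ₀) (hc : Exceeds s p c)
    (hσ : IsInit σ₀ gen) : ¬ ∃ Ξ : OracleCode, ∀ n,
      n ∈ Ξ.eval (charFun genSet : ℕ →. ℕ) (limitTuple s p c n) := by
  rintro ⟨Ξ, hΞ⟩
  obtain ⟨e₀, he₀⟩ := exists_long_str σ₀.length
  -- The second component is padding: it makes the position late enough for `Exceeds` and for its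
  -- string to extend `σ₀`.
  set i := Nat.pair Ξ.number (c + e₀) with hi
  set e := Nat.pair p i with he
  have hce : c + e₀ ≤ e := (Nat.right_le_pair _ _).trans (Nat.right_le_pair _ _)
  have hpe : e.unpair.1 = p := by rw [he, Nat.unpair_pair]
  have h4 : (finRec e).2.2.2.length = 4 := by
    refine hp.final_length_eq hf (i := i) (Ξ := Ξ) (by rw [hi, Nat.unpair_pair])
      (hσ.prefix_of_le (isInit_finRec_str _) (he₀ _ (by omega))) fun a ha => ?_
    obtain ⟨n, rfl⟩ := limitTuple_surjective hp hf hc ha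
    exact ⟨n, hΞ n⟩
  have hg := goodRec_finRec e
  have hgp : s.GoodPast σ₀ i (finRec e).2 := hp.goodPast i
  have hcomp := hgp.completed hf h4
  obtain ⟨m₃, h₃, hm₃⟩ := exists_last_move h4
  have h₀ : (finRec e).2.2.2[0]? = some ((finRec e).2.2.2.getD 0 move0) := by
    rw [List.getD_eq_getElem _ _ (by omega), List.getElem?_eq_getElem]
  have h₁ : (finRec e).2.2.2[1]? = some ((finRec e).2.2.2.getD 1 move0) := by
    rw [List.getD_eq_getElem _ _ (by omega), List.getElem?_eq_getElem]
  have ha := (hgp.own_zero (by omega) rfl).2.2.2.1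
  have hlta := hg.lt_stage h₀
  have hconv := hcomp.conv
  have hcov := hcomp.covers
  have hmv := hcomp.moves
  have hm₁ := hg.hist 1 _ h₁
  have hm₀ := hg.hist 0 _ h₀
  have hlt₁ := hg.hist_mono 1 3 _ _ (by omega) h₁ h₃
  have hlt₀ := hg.hist_mono 0 3 _ _ (by omega) h₀ h₃
  have h₃' : (finRec e).2.2.2.getD 3 move0 = m₃ := by
    rw [List.getD_eq_getElem?_getD, h₃, Option.getD_some]
  -- The computation found at the first move survives on `gen`. So if `Ξ` inverts the limit, its
  -- output is the place of the chosen element.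
  have hF : limitTuple s p c ((finRec e).2.2.2.getD 0 move0).1.2.2.2.1 =
      ((finRec e).2.2.2.getD 0 move0).1.2.2.1 := by
    obtain ⟨n, hn⟩ := limitTuple_surjective hp hf hc ha
    rw [h₃', ← hg.cur_last 3 m₃ h₃ (by omega), hi, Nat.unpair_pair] at hconv
    have h5 := conv_sound (isInit_finRec e) hconv
    have h6 := hΞ n
    rw [hn] at h6
    rw [← hn, Part.mem_unique h5 h6]
  have hlast : lastRec (stg (finStage e)) = finRec e := by
    rw [lastRec, length_finStage, Nat.add_sub_cancel, ← finRec]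
  have hprd : prd (finStage e) < finStage e := prd_lt (finStage_pos e)
  have htru := (final_finStage e).1.of_bel (bel_prd (finStage e))
  have hinit := (stg_init_lt (finStage e)).2.1 e (by rw [length_finStage]; omega)
  rw [← finRec] at hinit
  set y := preTrue s p (finStage e) with hy
  have hyV : y = (tuples s p (prd (finStage e))).2 := preTrue_pos s p (finStage_pos e)
  have hyA : ∀ b ∈ y, s.A b := preTrue_mem _
  -- The chosen element is below the stage of the first move, so it entered the tuple there, and it
  -- stays until the last move.
  have hay : ((finRec e).2.2.2.getD 0 move0).1.2.2.1 ∈ y := by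
    have h5 := mem_tuples_first hp hf h₀ h₁ ha hlta
    have h6 := tuples_persist_first hp hf hc (by omega) h₀ h₃ hm₃ htru
      (hm₀.2.1.to_prd (by omega)).le hprd
    rw [hyV]
    exact h6.subset h5
  -- Since the second move the tuple has been frozen, so its entries are below the bound up to which
  -- the relation is defined.
  have hcovy : ∀ b, b ∈ y → ∃ q, q ∈ rel (finRec e).2 ∧ q.1 = b := by
    intro b hb
    obtain ⟨w, hw, h5⟩ := hcov
    have h6 := hc _ w (by omega) hw
    have hb' := hb
    rw [hyV, tuples_frozen hpe h₁ h₃ hm₃ htru (hm₁.2.1.to_prd (by omega)).le hprd] at hb'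
    have h7 := le_entryBound (s := s) (p := p) (prd_lt (show 0 <
      ((finRec e).2.2.2.getD 1 move0).2 by omega)).le hb'
    obtain ⟨z, hz⟩ := h5 b (by omega) (hyA b hb)
    exact ⟨_, hz, rfl⟩
  obtain ⟨x, hx, hxe⟩ := suitable_finStage hp hf e
  have hFx : ∀ n, n < x.length → limitTuple s p c n = x.getD n 0 := by
    intro n hn
    rw [limitTuple_eq hp hf hc (e := e) (by omega) (by rw [hxe]; exact hn), hxe]
  have hlink := hx.link
  rw [← hy] at hlink
  -- If the relation is applied, the place given by `Ξ` receives another element. If it is not, the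
  -- element keeps its place, which by injectivity of the limit is the one given by `Ξ`, and then
  -- the relation should have been applied.
  by_cases hm : Moves p (stg (finStage e)) y
  · have h5 := hm.2.2.1
    rw [hlast] at h5
    obtain ⟨hlt, h5⟩ := List.getElem?_eq_some_iff.1 h5
    obtain ⟨h6, h7⟩ := hlink _ hlt
    rcases h7 with ⟨-, h7⟩ | ⟨h7, -⟩
    · rw [hlast, List.getD_eq_getElem _ _ hlt, h5] at h7
      exact hmv _ h7 ((hFx _ h6).symm.trans hF)
    · exact h7 hm
  · obtain ⟨n, hn, h5⟩ := exists_getD_of_mem hay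
    obtain ⟨h6, h7⟩ := hlink n hn
    rcases h7 with ⟨h7, -⟩ | ⟨-, h7⟩
    · exact hm h7
    · rw [h5, ← hFx n h6, ← hF] at h7
      have h8 := limitTuple_injective hp hf hc h7
      refine hm ⟨by rw [length_finStage]; exact hpe, by rw [hlast]; exact h4, ?_, ?_⟩
      · rw [hlast, h8, List.getElem?_eq_getElem hn, ← List.getD_eq_getElem _ 0 hn, h5]
      · rw [hlast]; exact hcovy

end Persistence

/-- The enumeration of the new structure. -/
theorem Setting.exists_enumeration (s : Setting) : ∃ (W : ℕ → List ℕ) (F : ℕ → ℕ),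
    Computable W ∧ (∀ n, s.A (F n)) ∧ Function.Injective F ∧ (∀ a, s.A a → ∃ n, F n = a) ∧
    (∀ z, ∃ t, z < (W t).length) ∧
    (∀ t z m, z < (W t).length → z < m → (s.SA z (W t) ↔ s.SA z ((List.range m).map F))) ∧
    ¬ ∃ Ξ : OracleCode, ∀ n, n ∈ Ξ.eval (charFun genSet : ℕ →. ℕ) (F n) := by
  obtain ⟨σ₀, hσ, hf⟩ := s.exists_forcing
  obtain ⟨p, hp⟩ := s.exists_isIndex σ₀
  have hcomp := computable_tuples_of_isIndex hp hf
  obtain ⟨c, hc⟩ := exists_exceeds hcomp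
  refine ⟨fun t => (tuples s p t).1, limitTuple s p c, by fun_prop,
    limitTuple_mem hp hf, limitTuple_injective hp hf hc,
    fun a ha => limitTuple_surjective hp hf hc ha, fun z => ⟨finStage z, ?_⟩,
    fun t z m hz hm => limitTuple_coherent hp hf hc hz hm, limitTuple_not_computed hp hf hc hσ⟩
  obtain ⟨x, -, h⟩ := suitable_finStage hp hf z
  have := lt_length_finStage hp hf z
  beta_reduce
  rw [h] at this ⊢
  exact this

end CatDeg


noncomputable section

namespace CatDeg

/-! ## Atomic diagrams -/

section Diagram

theorem computable_map_getD' :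
    Computable fun x : List ℕ × List ℕ => x.1.map fun i => x.2.getD i 0 :=
  (Primrec.list_map Primrec.fst
    ((Primrec.list_getD 0).comp (Primrec.snd.comp Primrec.fst) Primrec.snd).to₂).to_comp

variable {Φ Ψ α : Type} [Primcodable Φ] [Primcodable Ψ] [Primcodable α]

@[fun_prop] theorem computable_map_getD {l x : α → List ℕ} (hl : Computable l)
    (hx : Computable x) : Computable fun a => (l a).map fun i => (x a).getD i 0 :=
  computable_map_getD'.comp (f := fun x : List ℕ × List ℕ => x.1.map fun i => x.2.getD i 0)
    (g := fun a => (l a, x a)) (by fun_prop)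

/-- The equation with number `z` between a value of a function and an entry holds in `x`. -/
def SatFun (ar : Φ → ℕ) (F : Φ × List ℕ → ℕ) (z : ℕ) (x : List ℕ) : Prop :=
  ∃ φ, (Encodable.decode z.unpair.1 : Option (Φ × List ℕ × ℕ)) = some φ ∧
    (∀ i, i ∈ φ.2.1 → i < z.unpair.2 ∧ i < x.length) ∧
    (φ.2.2 < z.unpair.2 ∧ φ.2.2 < x.length) ∧ φ.2.1.length = ar φ.1 ∧
    F (φ.1, φ.2.1.map fun i => x.getD i 0) = x.getD φ.2.2 0

/-- The atomic relation with number `z` holds in `x`. -/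
def SatRel (ar : Ψ → ℕ) (R : Ψ × List ℕ → Bool) (z : ℕ) (x : List ℕ) : Prop :=
  ∃ φ, (Encodable.decode z.unpair.1 : Option (Ψ × List ℕ)) = some φ ∧
    (∀ i, i ∈ φ.2 → i < z.unpair.2 ∧ i < x.length) ∧ φ.2.length = ar φ.1 ∧
    R (φ.1, φ.2.map fun i => x.getD i 0) = true

/-- The atomic diagram. -/
def Sat (ar : Φ → ℕ) (F : Φ × List ℕ → ℕ) (ar' : Ψ → ℕ) (R : Ψ × List ℕ → Bool) (z : ℕ)
    (x : List ℕ) : Prop :=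
  (z % 2 = 0 ∧ SatFun ar F (z / 2) x) ∨ (z % 2 = 1 ∧ SatRel ar' R (z / 2) x)

variable {ar : Φ → ℕ} {F : Φ × List ℕ → ℕ} {ar' : Ψ → ℕ} {R : Ψ × List ℕ → Bool}

theorem computablePred_sat (har : Computable ar) (hF : Computable F) (har' : Computable ar')
    (hR : Computable R) : ComputablePred fun x : ℕ × List ℕ => Sat ar F ar' R x.1 x.2 := by
  unfold Sat SatFun SatRel
  fun_prop

theorem map_getD_take {l x : List ℕ} {m : ℕ} (h : ∀ i ∈ l, i < m) :
    (l.map fun i => (x.take m).getD i 0) = l.map fun i => x.getD i 0 :=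
  List.map_congr_left fun i hi => by
    rw [List.getD_eq_getElem?_getD, List.getElem?_take_of_lt (h i hi),
      ← List.getD_eq_getElem?_getD]

theorem getD_take_of_lt {x : List ℕ} {m i : ℕ} (h : i < m) : (x.take m).getD i 0 = x.getD i 0 := by
  rw [List.getD_eq_getElem?_getD, List.getElem?_take_of_lt h, ← List.getD_eq_getElem?_getD]

/-- The number of an atomic statement is at least the bound `z.unpair.2`-part that it carries on the
places it mentions. -/
theorem sat_take {z : ℕ} {x : List ℕ} {m : ℕ} (hz : z < m) :
    Sat ar F ar' R z (x.take m) ↔ Sat ar F ar' R z x := by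
  have hk : (z / 2).unpair.2 ≤ z := (Nat.unpair_right_le _).trans (Nat.div_le_self _ _)
  have hlen : ∀ i, i < (z / 2).unpair.2 ∧ i < (x.take m).length ↔
      i < (z / 2).unpair.2 ∧ i < x.length := by
    intro i
    rw [List.length_take]
    omega
  unfold Sat SatFun SatRel
  simp only [hlen]
  refine or_congr (and_congr_right fun _ => exists_congr fun φ => and_congr_right fun _ =>
    and_congr_right fun h1 => and_congr_right fun h2 => and_congr_right fun _ => ?_)
    (and_congr_right fun _ => exists_congr fun φ => and_congr_right fun _ =>
    and_congr_right fun h1 => and_congr_right fun _ => ?_)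
  · rw [map_getD_take fun i hi => by have := (h1 i hi).1; omega, getD_take_of_lt (by omega)]
  · rw [map_getD_take fun i hi => by have := (h1 i hi).1; omega]

theorem sat_fun {s : Φ} {l : List ℕ} {j k : ℕ} {x : List ℕ} (hl : ∀ i ∈ l, i < k ∧ i < x.length)
    (hj : j < k ∧ j < x.length) (har : l.length = ar s) :
    Sat ar F ar' R (2 * Nat.pair (Encodable.encode (s, l, j)) k) x ↔
      F (s, l.map fun i => x.getD i 0) = x.getD j 0 := by
  have h1 : 2 * Nat.pair (Encodable.encode (s, l, j)) k % 2 = 0 := by omega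
  have h2 : 2 * Nat.pair (Encodable.encode (s, l, j)) k / 2 =
    Nat.pair (Encodable.encode (s, l, j)) k := by omega
  rw [Sat, h1, h2]
  simp only [true_and, Nat.zero_ne_one, false_and, or_false, SatFun, Nat.unpair_pair,
    Encodable.encodek, Option.some.injEq]
  constructor
  · rintro ⟨φ, rfl, -, -, -, h⟩
    exact h
  · exact fun h => ⟨_, rfl, hl, hj, har, h⟩

theorem sat_rel {s : Ψ} {l : List ℕ} {k : ℕ} {x : List ℕ} (hl : ∀ i ∈ l, i < k ∧ i < x.length)
    (har : l.length = ar' s) :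
    Sat ar F ar' R (2 * Nat.pair (Encodable.encode (s, l)) k + 1) x ↔
      R (s, l.map fun i => x.getD i 0) = true := by
  have h1 : (2 * Nat.pair (Encodable.encode (s, l)) k + 1) % 2 = 1 := by omega
  have h2 : (2 * Nat.pair (Encodable.encode (s, l)) k + 1) / 2 =
    Nat.pair (Encodable.encode (s, l)) k := by omega
  rw [Sat, h1, h2]
  simp only [true_and, Nat.one_ne_zero, false_and, false_or, SatRel, Nat.unpair_pair,
    Encodable.encodek, Option.some.injEq]
  constructor
  · rintro ⟨φ, rfl, -, -, h⟩
    exact h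
  · exact fun h => ⟨_, rfl, hl, har, h⟩

/-- Reading off the functions and relations of the new structure. -/
theorem exists_read (har : Computable ar) (hF : Computable F) (har' : Computable ar')
    (hR : Computable R) {W : ℕ → List ℕ} (hW : Computable W) {G : ℕ → ℕ}
    (hWl : ∀ z, ∃ t, z < (W t).length)
    (hWG : ∀ t z m, z < (W t).length → z < m →
      (Sat ar F ar' R z (W t) ↔ Sat ar F ar' R z ((List.range m).map G)))
    (hG : ∀ (s : Φ) (l : List ℕ), l.length = ar s → ∃ j, F (s, l.map G) = G j) :
    (∃ f : Φ → List ℕ → ℕ, Computable₂ f ∧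
      ∀ (s : Φ) (l : List ℕ), l.length = ar s → F (s, l.map G) = G (f s l)) ∧
    ∃ r : Ψ → List ℕ → Bool, Computable₂ r ∧
      ∀ (s : Ψ) (l : List ℕ), l.length = ar' s → (R (s, l.map G) = true ↔ r s l = true) := by
  classical
  have hget : ∀ {m i}, i < m → ((List.range m).map G).getD i 0 = G i := by
    intro m i hi
    rw [List.getD_eq_getElem _ _ (by simpa using hi)]
    simp
  have hmap : ∀ {m} {l : List ℕ}, (∀ i ∈ l, i < m) →
      (l.map fun i => ((List.range m).map G).getD i 0) = l.map G :=
    fun h => List.map_congr_left fun i hi => hget (h i hi)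
  have hf : ∀ {t : ℕ} {s : Φ} {l : List ℕ} {j k : ℕ}, l.length = ar s → (∀ i ∈ l, i < k) → j < k →
      2 * Nat.pair (Encodable.encode ((s, l, j) : Φ × List ℕ × ℕ)) k < (W t).length →
      (Sat ar F ar' R (2 * Nat.pair (Encodable.encode (s, l, j)) k) (W t) ↔
        F (s, l.map G) = G j) := by
    intro t s l j k h1 h2 h3 h4
    have h5 := Nat.right_le_pair (Encodable.encode (s, l, j)) k
    rw [hWG t _ (2 * Nat.pair (Encodable.encode (s, l, j)) k + 1) h4 (by omega), sat_fun _ _ h1,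
      hmap, hget (by omega)]
    · intro i hi
      have := h2 i hi
      omega
    · intro i hi
      have := h2 i hi
      simp only [List.length_map, List.length_range]
      omega
    · simp only [List.length_map, List.length_range]
      omega
  have hr : ∀ {t : ℕ} {s : Ψ} {l : List ℕ} {k : ℕ}, l.length = ar' s → (∀ i ∈ l, i < k) →
      2 * Nat.pair (Encodable.encode ((s, l) : Ψ × List ℕ)) k + 1 < (W t).length →
      (Sat ar F ar' R (2 * Nat.pair (Encodable.encode (s, l)) k + 1) (W t) ↔
        R (s, l.map G) = true) := by
    intro t s l k h1 h2 h4
    have h5 := Nat.right_le_pair (Encodable.encode (s, l)) k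
    rw [hWG t _ (2 * Nat.pair (Encodable.encode (s, l)) k + 2) h4 (by omega), sat_rel _ h1, hmap]
    · intro i hi
      have := h2 i hi
      omega
    · intro i hi
      have := h2 i hi
      simp only [List.length_map, List.length_range]
      omega
  have hS := computablePred_sat har hF har' hR
  obtain ⟨Q, hQ, hQe⟩ : ∃ Q : ℕ × List ℕ → Prop, ComputablePred Q ∧
    ∀ z x, Sat ar F ar' R z x ↔ Q (z, x) := ⟨_, hS, fun _ _ => Iff.rfl⟩
  simp only [hQe] at hf hr
  constructor
  · have hex : ∀ a : Φ × List ℕ, ∃ u : ℕ, ¬ a.2.length = ar a.1 ∨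
        ((∀ i, i ∈ a.2 → i < u.unpair.2.unpair.1) ∧ u.unpair.1 < u.unpair.2.unpair.1 ∧
        2 * Nat.pair (Encodable.encode (a.1, a.2, u.unpair.1)) u.unpair.2.unpair.1 <
          (W u.unpair.2.unpair.2).length ∧
        Q (2 * Nat.pair (Encodable.encode (a.1, a.2, u.unpair.1)) u.unpair.2.unpair.1,
          W u.unpair.2.unpair.2)) := by
      rintro ⟨s, l⟩
      by_cases h : l.length = ar s
      · obtain ⟨j, hj⟩ := hG s l h
        obtain ⟨k, hk⟩ := exists_list_bound (fun i : ℕ => i) l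
        obtain ⟨t, ht⟩ := hWl (2 * Nat.pair (Encodable.encode (s, l, j)) (k + j + 1))
        -- The bound `k + j + 1` exceeds every place in `l` and also `j`, as the guards in `SatFun`
        -- demand.
        refine ⟨Nat.pair j (Nat.pair (k + j + 1) t), .inr ?_⟩
        have hk' : ∀ i, i ∈ l → i < k + j + 1 := fun i hi => by have := hk i hi; omega
        simp only [Nat.unpair_pair]
        exact ⟨hk', by omega, ht, (hf h hk' (by omega) ht).2 hj⟩
      · exact ⟨0, .inl h⟩
    refine ⟨fun s l => (Nat.find (hex (s, l))).unpair.1, ?_, fun s l h => ?_⟩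
    · have h1 : Computable fun a => Nat.find (hex a) := computable_find (P := fun (a : Φ × List ℕ) (u : ℕ) =>
        ¬ a.2.length = ar a.1 ∨
        ((∀ i, i ∈ a.2 → i < u.unpair.2.unpair.1) ∧ u.unpair.1 < u.unpair.2.unpair.1 ∧
        2 * Nat.pair (Encodable.encode (a.1, a.2, u.unpair.1)) u.unpair.2.unpair.1 <
          (W u.unpair.2.unpair.2).length ∧
        Q (2 * Nat.pair (Encodable.encode (a.1, a.2, u.unpair.1)) u.unpair.2.unpair.1,
          W u.unpair.2.unpair.2))) (by fun_prop) hex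
      exact computable_fst (computable_unpair h1)
    · obtain ⟨h1, h2, h3, h4⟩ := (Nat.find_spec (hex (s, l))).resolve_left (not_not.2 h)
      exact (hf h h1 h2 h3).1 h4
  · have hex : ∀ a : Ψ × List ℕ, ∃ u : ℕ, ¬ a.2.length = ar' a.1 ∨
        ((∀ i, i ∈ a.2 → i < u.unpair.1) ∧
        2 * Nat.pair (Encodable.encode a) u.unpair.1 + 1 < (W u.unpair.2).length) := by
      rintro ⟨s, l⟩
      obtain ⟨k, hk⟩ := exists_list_bound (fun i : ℕ => i) l
      obtain ⟨t, ht⟩ := hWl (2 * Nat.pair (Encodable.encode (s, l)) k + 1)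
      refine ⟨Nat.pair k t, .inr ?_⟩
      simp only [Nat.unpair_pair]
      exact ⟨hk, ht⟩
    have h1 : Computable fun a => Nat.find (hex a) := computable_find (P := fun (a : Ψ × List ℕ) (u : ℕ) =>
        ¬ a.2.length = ar' a.1 ∨
        ((∀ i, i ∈ a.2 → i < u.unpair.1) ∧
        2 * Nat.pair (Encodable.encode a) u.unpair.1 + 1 < (W u.unpair.2).length))
        (by fun_prop) hex
    obtain ⟨v, hv, hve⟩ : ∃ v : Ψ × List ℕ → ℕ, Computable v ∧ ∀ a, Nat.find (hex a) = v a :=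
      ⟨_, h1, fun _ => rfl⟩
    have h2 : ComputablePred fun a : Ψ × List ℕ =>
        Q (2 * Nat.pair (Encodable.encode a) (v a).unpair.1 + 1, W (v a).unpair.2) := by
      fun_prop
    refine ⟨fun s l => decide (Q (2 * Nat.pair (Encodable.encode (s, l)) (v (s, l)).unpair.1 + 1,
      W (v (s, l)).unpair.2)), h2.decide.to₂, fun s l h => ?_⟩
    obtain ⟨h3, h4⟩ := (Nat.find_spec (hex (s, l))).resolve_left (not_not.2 h)
    rw [hve] at h3 h4
    rw [decide_eq_true_eq, hr h h3 h4]

end Diagram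

end CatDeg

end


noncomputable section

namespace CatDeg

/-! ## Computable structures -/

namespace CompStructure

variable {τ : Vocabulary}

/-- `F` computes the functions of `A`. -/
def FunSpec (A : CompStructure τ) (F : (Σ n, τ.lang.Functions n) × List ℕ → ℕ) : Prop :=
  ∀ (n : ℕ) (s : τ.lang.Functions n) (v : Fin n → A.dom),
    ((FirstOrder.Language.Structure.funMap s v : A.dom) : ℕ) =
      F (⟨n, s⟩, List.ofFn fun i => (v i : ℕ))

/-- `R` computes the relations of `A`. -/
def RelSpec (A : CompStructure τ) (R : (Σ n, τ.lang.Relations n) × List ℕ → Bool) : Prop :=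
  ∀ (n : ℕ) (s : τ.lang.Relations n) (v : Fin n → A.dom),
    FirstOrder.Language.Structure.RelMap s v ↔ R (⟨n, s⟩, List.ofFn fun i => (v i : ℕ)) = true

theorem exists_spec (A : CompStructure τ) : ∃ F R, Computable F ∧ Computable R ∧
    A.FunSpec F ∧ A.RelSpec R := by
  obtain ⟨F, hF, hF'⟩ := A.computable_fun
  obtain ⟨R, hR, hR'⟩ := A.computable_rel
  exact ⟨fun x => F x.1 x.2, fun x => R x.1 x.2, hF, hR, hF', hR'⟩

/-! ### Isomorphisms as functions on numbers, and transport of atomic diagrams. -/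

section Isomorphisms

variable {A B C : CompStructure τ}

theorem Iso.natFun_apply (g : Iso A B) {a : ℕ} (ha : a ∈ A.dom) :
    g.natFun a = (g ⟨a, ha⟩ : ℕ) := dif_pos ha

theorem Iso.natFun_mem (g : Iso A B) {a : ℕ} (ha : a ∈ A.dom) : g.natFun a ∈ B.dom := by
  rw [g.natFun_apply ha]
  exact (g ⟨a, ha⟩).2

theorem Iso.natFun_of_notMem (g : Iso A B) {a : ℕ} (ha : a ∉ A.dom) : g.natFun a = 0 :=
  dif_neg ha

theorem Iso.natFun_inj (g : Iso A B) {a b : ℕ} (ha : a ∈ A.dom) (hb : b ∈ A.dom)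
    (h : g.natFun a = g.natFun b) : a = b := by
  rw [g.natFun_apply ha, g.natFun_apply hb] at h
  exact congrArg Subtype.val (g.injective (Subtype.ext h))

theorem Iso.natFun_comp (f : Iso A B) (g : Iso B C) {a : ℕ} (ha : a ∈ A.dom) :
    Iso.natFun (A := A) (B := C) (g.comp f) a = g.natFun (f.natFun a) := by
  rw [Iso.natFun_apply _ ha, g.natFun_apply (f.natFun_mem ha)]
  exact congrArg (fun b => (g b : ℕ)) (Subtype.ext (f.natFun_apply ha).symm)

theorem Iso.natFun_symm (g : Iso A B) {a : ℕ} (ha : a ∈ A.dom) :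
    Iso.natFun (A := B) (B := A) g.symm (g.natFun a) = a := by
  rw [Iso.natFun_apply _ (g.natFun_mem ha)]
  have : (⟨g.natFun a, g.natFun_mem ha⟩ : B.dom) = g ⟨a, ha⟩ :=
    Subtype.ext (g.natFun_apply ha)
  rw [this, FirstOrder.Language.Equiv.symm_apply_apply]

theorem Iso.natFun_symm' (g : Iso A B) {b : ℕ} (hb : b ∈ B.dom) :
    g.natFun (Iso.natFun (A := B) (B := A) g.symm b) = b :=
  Iso.natFun_symm (A := B) (B := A) g.symm hb

theorem exists_ofFn {X : Set ℕ} {l : List ℕ} (hl : ∀ a ∈ l, a ∈ X) {n : ℕ} (h : l.length = n) :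
    ∃ v : Fin n → X, l = List.ofFn fun i => (v i : ℕ) := by
  subst h
  exact ⟨fun i => ⟨l.get i, hl _ (List.get_mem _ _)⟩, (List.ofFn_get l).symm⟩

theorem FunSpec.map (g : Iso A B) {F F' : (Σ n, τ.lang.Functions n) × List ℕ → ℕ}
    (hF : A.FunSpec F) (hF' : B.FunSpec F') {s : Σ n, τ.lang.Functions n} {l : List ℕ}
    (hl : ∀ a ∈ l, a ∈ A.dom) (h : l.length = s.1) :
    F (s, l) ∈ A.dom ∧ F' (s, l.map g.natFun) = g.natFun (F (s, l)) := by
  obtain ⟨n, s⟩ := s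
  obtain ⟨v, rfl⟩ := exists_ofFn hl h
  have h1 := hF n s v
  have h2 := hF' n s (g ∘ v)
  have h3 : F (⟨n, s⟩, List.ofFn fun i => (v i : ℕ)) ∈ A.dom := by
    rw [← h1]; exact Subtype.coe_prop _
  refine ⟨h3, ?_⟩
  rw [List.map_ofFn]
  have h4 : (g.natFun ∘ fun i => (v i : ℕ)) = fun i => ((g ∘ v) i : ℕ) := by
    funext i
    exact g.natFun_apply (v i).2
  rw [h4, ← h2, ← h1, g.natFun_apply (Subtype.coe_prop _)]
  exact congrArg Subtype.val (g.map_fun s v).symm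

theorem RelSpec.map (g : Iso A B) {R R' : (Σ n, τ.lang.Relations n) × List ℕ → Bool}
    (hR : A.RelSpec R) (hR' : B.RelSpec R') {s : Σ n, τ.lang.Relations n} {l : List ℕ}
    (hl : ∀ a ∈ l, a ∈ A.dom) (h : l.length = s.1) :
    R' (s, l.map g.natFun) = R (s, l) := by
  obtain ⟨n, s⟩ := s
  obtain ⟨v, rfl⟩ := exists_ofFn hl h
  have h1 := hR n s v
  have h2 := hR' n s (g ∘ v)
  rw [List.map_ofFn]
  have h4 : (g.natFun ∘ fun i => (v i : ℕ)) = fun i => ((g ∘ v) i : ℕ) := by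
    funext i
    exact g.natFun_apply (v i).2
  rw [h4, Bool.eq_iff_iff, ← h2, ← h1]
  exact g.map_rel s v

/-- The guards on places keep the default of `getD` from being read, so each atomic statement
concerns elements of the universe and is preserved by the isomorphism. -/
theorem sat_map (g : Iso A B) {F F' : (Σ n, τ.lang.Functions n) × List ℕ → ℕ}
    {R R' : (Σ n, τ.lang.Relations n) × List ℕ → Bool}
    (hF : A.FunSpec F) (hF' : B.FunSpec F') (hR : A.RelSpec R) (hR' : B.RelSpec R')
    {x : List ℕ} (hx : ∀ a ∈ x, a ∈ A.dom) (z : ℕ) :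
    Sat (fun s => s.1) F (fun s => s.1) R z x ↔
      Sat (fun s => s.1) F' (fun s => s.1) R' z (x.map g.natFun) := by
  have hget : ∀ i, i < x.length → (x.map g.natFun).getD i 0 = g.natFun (x.getD i 0) := by
    intro i hi
    rw [List.getD_eq_getElem _ _ (by simpa using hi), List.getElem_map,
      List.getD_eq_getElem _ _ hi]
  have hmap : ∀ l : List ℕ, (∀ i ∈ l, i < x.length) →
      (l.map fun i => (x.map g.natFun).getD i 0) = (l.map fun i => x.getD i 0).map g.natFun := by
    intro l hl
    rw [List.map_map]
    exact List.map_congr_left fun i hi => hget i (hl i hi)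
  have hmem : ∀ l : List ℕ, (∀ i ∈ l, i < x.length) →
      ∀ a ∈ (l.map fun i => x.getD i 0), a ∈ A.dom := by
    intro l hl a ha
    obtain ⟨i, hi, rfl⟩ := List.mem_map.1 ha
    exact hx _ (getD_mem (hl i hi))
  unfold Sat SatFun SatRel
  rw [List.length_map]
  refine or_congr (and_congr_right fun _ => exists_congr fun φ => and_congr_right fun _ =>
    and_congr_right fun h1 => and_congr_right fun h2 => and_congr_right fun h3 => ?_)
    (and_congr_right fun _ => exists_congr fun φ => and_congr_right fun _ =>
    and_congr_right fun h1 => and_congr_right fun h3 => ?_)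
  · have h1' : ∀ i ∈ φ.2.1, i < x.length := fun i hi => (h1 i hi).2
    obtain ⟨h4, h5⟩ := hF.map g hF' (s := φ.1) (hmem _ h1') (by simpa using h3)
    rw [hmap _ h1', h5, hget _ h2.2]
    exact ⟨fun h => by rw [h], g.natFun_inj h4 (hx _ (getD_mem h2.2))⟩
  · have h1' : ∀ i ∈ φ.2, i < x.length := fun i hi => (h1 i hi).2
    rw [hmap _ h1', hR.map g hR' (s := φ.1) (hmem _ h1') (by simpa using h3)]

end Isomorphisms

/-- The copy of `A` along an enumeration `G` of its universe. -/
theorem exists_copy (A : CompStructure τ) {F : (Σ n, τ.lang.Functions n) × List ℕ → ℕ}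
    {R : (Σ n, τ.lang.Relations n) × List ℕ → Bool} (hF : Computable F) (hR : Computable R)
    (hFA : A.FunSpec F) (hRA : A.RelSpec R) {W : ℕ → List ℕ} (hW : Computable W) {G : ℕ → ℕ}
    (hGA : ∀ n, G n ∈ A.dom) (hGi : Function.Injective G) (hGs : ∀ a ∈ A.dom, ∃ n, G n = a)
    (hWl : ∀ z, ∃ t, z < (W t).length)
    (hWG : ∀ t z m, z < (W t).length → z < m →
      (Sat (fun s => s.1) F (fun s => s.1) R z (W t) ↔
        Sat (fun s => s.1) F (fun s => s.1) R z ((List.range m).map G))) :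
    ∃ (N : CompStructure τ) (f : Iso A N), ∀ n, f.natFun (G n) = n := by
  have hmem : ∀ l : List ℕ, ∀ a ∈ l.map G, a ∈ A.dom := by
    intro l a ha
    obtain ⟨i, -, rfl⟩ := List.mem_map.1 ha
    exact hGA i
  obtain ⟨⟨f, hf, hf'⟩, r, hr, hr'⟩ := exists_read τ.computable_arityFun hF
    τ.computable_arityRel hR hW hWl hWG fun s l h => by
      obtain ⟨n, hn⟩ := hGs _ (hFA.map (FirstOrder.Language.Equiv.refl τ.lang A.dom) hFA (s := s)
        (hmem l) (by simpa using h)).1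
      exact ⟨n, hn.symm⟩
  let e : A.dom ≃ (Set.univ : Set ℕ) := (Equiv.ofBijective
    (fun n : (Set.univ : Set ℕ) => (⟨G n, hGA n⟩ : A.dom))
    ⟨fun m n h => Subtype.ext (hGi (congrArg Subtype.val h)), fun a => by
      obtain ⟨n, hn⟩ := hGs a a.2
      exact ⟨⟨n, trivial⟩, Subtype.ext hn⟩⟩).symm
  have he : ∀ n : (Set.univ : Set ℕ), ((e.symm n : A.dom) : ℕ) = G n := fun n => rfl
  let N : CompStructure τ :=
    { dom := Set.univ
      str := e.inducedStructure
      computable_dom := (computablePred_const True).of_eq fun _ => by simp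
      computable_fun := ⟨f, hf, fun n s v => by
        have h1 := hFA n s (e.symm ∘ v)
        have h2 := hf' ⟨n, s⟩ (List.ofFn fun i => (v i : ℕ)) (by simp)
        rw [List.map_ofFn] at h2
        have h3 := h1.trans h2
        apply hGi
        rw [← h3, ← he]
        change ((e.symm (e (FirstOrder.Language.Structure.funMap s (e.symm ∘ v))) : A.dom) : ℕ) = _
        rw [Equiv.symm_apply_apply]⟩
      computable_rel := ⟨r, hr, fun n s v => by
        have h1 := hRA n s (e.symm ∘ v)
        have h2 := hr' ⟨n, s⟩ (List.ofFn fun i => (v i : ℕ)) (by simp)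
        rw [List.map_ofFn] at h2
        exact h1.trans h2⟩ }
  refine ⟨N, e.inducedStructureEquiv, fun n => ?_⟩
  rw [Iso.natFun_apply _ (hGA n)]
  have h4 : (⟨G n, hGA n⟩ : A.dom) = e.symm ⟨n, trivial⟩ := rfl
  have h5 : e ⟨G n, hGA n⟩ = ⟨n, trivial⟩ := by rw [h4, Equiv.apply_symm_apply]
  exact congrArg Subtype.val h5

/-- An isomorphism in the degree of the generic set is not the worst one. -/
theorem exists_not_le {A B : CompStructure τ} (g : Iso A B) (hg : Iso.deg g = CatDeg.deg genSet) :
    ∃ (N : CompStructure τ) (f : Iso A N), ¬ Iso.deg f ≤ CatDeg.deg genSet := by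
  obtain ⟨F, R, hF, hR, hFA, hRA⟩ := A.exists_spec
  obtain ⟨F', R', hF', hR', hFB, hRB⟩ := B.exists_spec
  obtain ⟨ψ, hψ⟩ := turingReducible_iff.1 (degFun_le_iff.1 hg.le)
  obtain ⟨Φ, hΦ⟩ := turingReducible_iff.1 (degFun_le_iff.1 hg.ge)
  let s : Setting :=
    { A := fun a => a ∈ A.dom
      B := fun b => b ∈ B.dom
      SA := Sat (fun s => s.1) F (fun s => s.1) R
      SB := Sat (fun s => s.1) F' (fun s => s.1) R'
      g := g.natFun
      ψ := ψ
      Φ := Φ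
      hA := A.computable_dom
      hB := B.computable_dom
      hSA := computablePred_sat τ.computable_arityFun hF τ.computable_arityRel hR
      hSB := computablePred_sat τ.computable_arityFun hF' τ.computable_arityRel hR'
      localA := fun z x m hz => sat_take hz
      maps := fun a ha => g.natFun_mem ha
      inj := fun a b ha hb => g.natFun_inj ha hb
      surj := fun b hb => ⟨_, Iso.natFun_mem (A := B) (B := A) g.symm hb, g.natFun_symm' hb⟩
      pres := fun x hx z => sat_map g hFA hFB hRA hRB hx z
      outside := fun a ha => g.natFun_of_notMem ha
      evalψ := hψ
      evalΦ := hΦ }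
  obtain ⟨W, G, hW, hGA, hGi, hGs, hWl, hWG, hno⟩ := s.exists_enumeration
  obtain ⟨N, f, hf⟩ := A.exists_copy hF hR hFA hRA hW hGA hGi hGs hWl hWG
  refine ⟨N, f, fun hle => ?_⟩
  obtain ⟨Ξ, hΞ⟩ := turingReducible_iff.1 (degFun_le_iff.1 hle)
  refine hno ⟨Ξ, fun n => ?_⟩
  rw [hΞ]
  exact mem_coe_iff.2 (hf n).symm

/-! ### Degrees of compositions -/

section Degrees

variable {A B C : CompStructure τ}

theorem Iso.deg_comp_le {h : ℕ → ℕ} (f : Iso A B) (g : Iso B C) (hf : Iso.deg f ≤ degFun h)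
    (hg : Iso.deg g ≤ degFun h) : Iso.deg (A := A) (B := C) (g.comp f) ≤ degFun h := by
  classical
  have hf' := RecursiveIn.iff_nat.1 (degFun_le_iff.1 hf)
  have hg' := RecursiveIn.iff_nat.1 (degFun_le_iff.1 hg)
  have h1 : ComputablePred fun n : ℕ => n.unpair.1 ∈ A.dom :=
    computablePred_comp A.computable_dom (by fun_prop)
  -- Composing the functions on numbers may give a nonzero value outside the universe. The decidable
  -- universe allows a correction to the default `0`.
  have h2 : Computable fun n : ℕ => if n.unpair.1 ∈ A.dom then n.unpair.2 else 0 :=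
    computable_ite h1 (by fun_prop) (by fun_prop)
  refine degFun_le_iff.2 (RecursiveIn.iff_nat.2 ?_)
  refine (recIn_comp (recIn_of_computable h2 _)
    (recIn_pair (recIn_of_computable Computable.id _) (recIn_comp hg' hf'))).of_eq fun n => ?_
  refine congrArg Part.some ?_
  simp only [Nat.unpair_pair, id]
  split_ifs with hn
  · exact (Iso.natFun_comp f g hn).symm
  · exact (Iso.natFun_of_notMem _ hn).symm

/-- A preimage is found by search, which ends at once outside the computable universe of `B`. -/
theorem Iso.deg_symm_le (f : Iso A B) : Iso.deg (A := B) (B := A) f.symm ≤ Iso.deg f := by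
  classical
  have hA := A.computable_dom
  have hB := B.computable_dom
  refine degFun_le_iff.2 (turingReducible_of_search
    (R := fun b u v => ¬ b ∈ B.dom ∨ (u ∈ A.dom ∧ v = b)) (q := fun _ u => u)
    (out := fun b u => if b ∈ B.dom then u else 0) ?_ (by fun_prop) ?_ ?_ ?_)
  · exact computablePred_or (computablePred_not (computablePred_comp hB (by fun_prop)))
      (computablePred_and (computablePred_comp hA (by fun_prop)) (by fun_prop))
  · exact computable_ite (computablePred_comp hB (by fun_prop)) (by fun_prop) (by fun_prop)
  · intro b
    by_cases hb : b ∈ B.dom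
    · exact ⟨_, .inr ⟨Iso.natFun_mem (A := B) (B := A) f.symm hb, f.natFun_symm' hb⟩⟩
    · exact ⟨0, .inl hb⟩
  · intro b u h
    split_ifs with hb
    · obtain ⟨h1, h2⟩ := h.resolve_left (not_not.2 hb)
      rw [← h2, f.natFun_symm h1]
    · exact Iso.natFun_of_notMem _ hb

end Degrees

/-- Both witnessing copies are reached from `A` below `D`. The composite between them is therefore
below `D`, and above it by strength, so `exists_not_le` applies to it. -/
theorem not_isStrongDegreeOfCategoricity (A : CompStructure τ) (hr : A.Rigid) :
    ¬ A.IsStrongDegreeOfCategoricity (CatDeg.deg genSet) := by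
  rintro ⟨⟨⟨X, -, hX⟩, -⟩, A₀, A₁, hA₀, hA₁, hs⟩
  obtain ⟨f₀, hf₀⟩ := hX A₀ hA₀
  obtain ⟨f₁, hf₁⟩ := hX A₁ hA₁
  have hi : Iso.deg (A := A₀) (B := A) f₀.symm ≤ CatDeg.deg genSet := f₀.deg_symm_le.trans hf₀
  have h1 : Iso.deg (A := A₀) (B := A₁) (f₁.comp f₀.symm) ≤ CatDeg.deg genSet :=
    Iso.deg_comp_le (A := A₀) (B := A) f₀.symm f₁ hi hf₁
  obtain ⟨N, f, hf⟩ := exists_not_le (A := A₀) (B := A₁) (f₁.comp f₀.symm) (h1.antisymm (hs _))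
  obtain ⟨f', hf'⟩ := hX N ⟨f.comp f₀⟩
  -- Rigidity: `f'` inverse after `f` after `f₀` is an automorphism of `A`, hence trivial. So `f`
  -- inherits a bound that it was chosen to violate.
  have h2 : f = f'.comp f₀.symm := by
    ext x
    have h3 := congrArg (fun k : Iso A A => k (f₀.symm x)) (hr (f'.symm.comp (f.comp f₀)))
    have h4 := congrArg f' h3
    simp only [FirstOrder.Language.Equiv.comp_apply, FirstOrder.Language.Equiv.apply_symm_apply,
      FirstOrder.Language.Equiv.refl_apply] at h4
    rw [h4, FirstOrder.Language.Equiv.comp_apply]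
  rw [h2] at hf
  exact hf (Iso.deg_comp_le (A := A₀) (B := A) f₀.symm f' hi hf')

end CompStructure

end CatDeg

end

theorem mainTheorem9 :
    ∃ D : Set ℕ,
      CatDeg.zeroJump < CatDeg.deg D ∧ CatDeg.deg D < CatDeg.zeroDoubleJump ∧
      (∀ (τ : CatDeg.Vocabulary) (A B : CatDeg.CompStructure τ)
        (g : CatDeg.CompStructure.Iso A B),
        CatDeg.CompStructure.Iso.IsDelta03 g →
        CatDeg.CompStructure.Iso.deg g = CatDeg.deg D →
        ∃ (N : CatDeg.CompStructure τ) (f : CatDeg.CompStructure.Iso A N),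
          ¬ CatDeg.CompStructure.Iso.deg f ≤ CatDeg.deg D) ∧
      ¬ ∃ (τ : CatDeg.Vocabulary) (A : CatDeg.CompStructure τ),
          A.Rigid ∧ A.IsStrongDegreeOfCategoricity (CatDeg.deg D) := by
  refine ⟨CatDeg.genSet, CatDeg.zeroJump_lt_deg_genSet, CatDeg.deg_genSet_lt_zeroDoubleJump,
    fun τ A B g _ hg => CatDeg.CompStructure.exists_not_le g hg, ?_⟩
  rintro ⟨τ, A, hr, hs⟩
  exact A.not_isStrongDegreeOfCategoricity hr hs
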